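/- Let $r\ge 1$ be an integer, let $U\subset\mathbb R^3$ be open and bounded, and let $h$ be a real function of class $C^{r+1}$ on $U$ having $0$ as a regular value; put $\Sigma=h^{-1}(0)\cap U$. Let $C^r$ be the space of vector fields $X:\overline U\to\mathbb R^3$ that are $C^r$ on $U$ with all derivatives $D^iX$, $0\le i\le r$, extending continuously to $\overline U$, with norm $\|X\|_r=\sup\{\|D^iX(x)\|: x\in\overline U,\ 0\le i\le r\}$, and let $\Omega^r=C^r\times C^r$ with the product topology. An element $Z=(X,Y)\in\Omega^r$ is regarded as the piecewise smooth (Filippov) vector field equal to $X$ where $h>0$ and to $Y$ where $h<0$. Write $Xf=\langle\nabla f,X\rangle$ and $X^2h=X(Xh)$. Let $\Sigma^s=\{x\in\Sigma: Xh<0<Yh\}$ and $\Sigma^e=\{x\in\Sigma: Yh<0<Xh\}$ be the sliding and escaping regions, and let $\widetilde Z=\dfrac{Yh\,X-Xh\,Y}{Yh-Xh}$ be the sliding vector field (defined where $Yh\neq Xh$; it is tangent to $\Sigma$). A visible fold of $X$ is a point $q\in\Sigma$ with $Xh(q)=0$ and $X^2h(q)>0$. A sliding Shilnikov orbit of $Z$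 is a set $\Gamma\subset U$ obtained as follows. There are a point $p\in\Sigma^s$ which is an unstable hyperbolic focus of $\widetilde Z$ on $\Sigma$ (that is, $\widetilde Z(p)=0$ and the linearization of $\widetilde Z$ on $T_p\Sigma$ has a pair of non-real complex conjugate eigenvalues with positive real part) and a point $q\in\partial\Sigma^s$ which is a visible fold of $X$ with $Yh(q)\neq0$, such that (j) the orbit of $\widetilde Z$ through $q$ lies in $\Sigma^s$ for all negative times and converges to $p$ backward in time; (jj) the orbit of $X$ starting at $q$ reaches $p$ after some time $t_0>0$, staying in $\{x\in U: h(x)>0\}$ at all times strictly between $0$ and $t_0$; and $\Gamma$ is the union of $\{p\}$ and these two orbit arcs (including $q$). Alternatively, all of this holds with time reversed: $p\in\Sigma^e$ is a stable hyperbolic focus of $\widetilde Z$ (eigenvalues non-real with negative real part), $q\in\partial\Sigma^e$, the orbit of $\widetilde Z$ through $q$ lies in $\Sigma^e$ for positive times and converges to $p$ forward in time, and $t_0<0$. **Theorem A.** Let $Z_0\in\Omega^r$ have a sliding Shilnikov orbit $\Gamma_0$. Then for every sufficiently small open neighbourhood $V$ of $\Gamma_0$ (that is, for every open $V$ with $\Gamma_0\subset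 V\subset V_0$, where $V_0$ is a suitable open neighbourhood of $\Gamma_0$) there exist an open neighbourhood $W\subset\Omega^r$ of $Z_0$ and a $C^1$ function $g:W\to\mathbb R$ having $0$ as a regular value (that is, $Dg(Z)$ is surjective whenever $g(Z)=0$) such that $Z\in W$ has a sliding Shilnikov orbit $\Gamma$ contained in $V$ if and only if $g(Z)=0$. In this sense a sliding Shilnikov orbit is a phenomenon of codimension one. -/

import Mathlib

open Set Filter Topology TopologicalSpace BoundedContinuousFunction

namespace SlidingShilnikov

/-- Three dimensional Euclidean space. -/
abbrev E3 : Type := EuclideanSpace ℝ (Fin 3)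

noncomputable section

/-- Candidate jets of order `r` on the closure of `U`: one bounded continuous function
`F i` on the closure for each order `i = 0, …, r`, with values in the `i`-multilinear maps.
The norm is `max_{i ≤ r} sup_{x ∈ closure U} ‖F i x‖`. -/
def PreJet (U : Opens E3) (r : ℕ) : Type :=
  (i : Fin (r + 1)) → (closure (U : Set E3) →ᵇ (E3 [×(i : ℕ)]→L[ℝ] E3))

instance (U : Opens E3) (r : ℕ) : NormedAddCommGroup (PreJet U r) :=
  inferInstanceAs (NormedAddCommGroup
    ((i : Fin (r + 1)) → (closure (U : Set E3) →ᵇ (E3 [×(i : ℕ)]→L[ℝ] E3))))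

instance (U : Opens E3) (r : ℕ) : NormedSpace ℝ (PreJet U r) :=
  inferInstanceAs (NormedSpace ℝ
    ((i : Fin (r + 1)) → (closure (U : Set E3) →ᵇ (E3 [×(i : ℕ)]→L[ℝ] E3))))

open Classical in
/-- The vector field underlying a jet (its component of order `0`), extended by `0` outside the
closure of `U`. -/
def PreJet.field {U : Opens E3} {r : ℕ} (F : PreJet U r) (x : E3) : E3 :=
  if hx : x ∈ closure (U : Set E3) then F 0 ⟨x, hx⟩ 0 else 0

theorem PreJet.field_add {U : Opens E3} {r : ℕ} (F G : PreJet U r) :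
    (F + G).field = F.field + G.field := by
  funext x
  rw [Pi.add_apply]
  by_cases hx : x ∈ closure (U : Set E3)
  · simp only [PreJet.field, hx, dif_pos]
    rfl
  · simp [PreJet.field, hx]

theorem PreJet.field_smul {U : Opens E3} {r : ℕ} (c : ℝ) (F : PreJet U r) :
    (c • F).field = c • F.field := by
  funext x
  rw [Pi.smul_apply]
  by_cases hx : x ∈ closure (U : Set E3)
  · simp only [PreJet.field, hx, dif_pos]
    rfl
  · simp [PreJet.field, hx]

theorem PreJet.field_zero {U : Opens E3} {r : ℕ} :
    (0 : PreJet U r).field = 0 := by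
  funext x
  rw [Pi.zero_apply]
  by_cases hx : x ∈ closure (U : Set E3)
  · simp only [PreJet.field, hx, dif_pos]
    rfl
  · simp [PreJet.field, hx]

/-- The normed space of `C^r` vector fields on the closure of `U`: the field is `C^r` on `U` and
its derivatives of order `≤ r` extend continuously (and boundedly) to the closure of `U`.
A field is stored together with these extended derivatives, which it determines, so that the norm
inherited from `PreJet U r` is the `C^r` norm `sup {‖D^i X x‖ : x ∈ closure U, i ≤ r}`. -/
def CrField (U : Opens E3) (r : ℕ) : Submodule ℝ (PreJet U r) where
  carrier := {F | ContDiffOn ℝ r F.field U ∧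
    ∀ (i : Fin (r + 1)) (x : E3) (hx : x ∈ U),
      F i ⟨x, subset_closure hx⟩ = iteratedFDeriv ℝ i F.field x}
  zero_mem' := by
    refine ⟨?_, fun i x hx => ?_⟩
    · rw [PreJet.field_zero]
      exact contDiff_const.contDiffOn
    · rw [PreJet.field_zero]
      rw [show (0 : E3 → E3) = fun _ => (0 : E3) from rfl, iteratedFDeriv_fun_zero]
      rfl
  add_mem' := by
    rintro F G ⟨hF, hF'⟩ ⟨hG, hG'⟩
    refine ⟨?_, fun i x hx => ?_⟩
    · rw [PreJet.field_add]
      exact hF.add hG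
    · have hi : ((i : ℕ) : WithTop ℕ∞) ≤ (r : WithTop ℕ∞) := by
        exact_mod_cast Nat.lt_succ_iff.mp i.2
      have h1 := (hF.contDiffAt (U.isOpen.mem_nhds hx)).of_le hi
      have h2 := (hG.contDiffAt (U.isOpen.mem_nhds hx)).of_le hi
      rw [PreJet.field_add, iteratedFDeriv_add_apply h1 h2, ← hF' i x hx, ← hG' i x hx]
      rfl
  smul_mem' := by
    rintro c F ⟨hF, hF'⟩
    refine ⟨?_, fun i x hx => ?_⟩
    · rw [PreJet.field_smul]
      exact contDiffOn_const.smul hF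
    · have hi : ((i : ℕ) : WithTop ℕ∞) ≤ (r : WithTop ℕ∞) := by
        exact_mod_cast Nat.lt_succ_iff.mp i.2
      have h1 := (hF.contDiffAt (U.isOpen.mem_nhds hx)).of_le hi
      rw [PreJet.field_smul, iteratedFDeriv_const_smul_apply h1, ← hF' i x hx]
      rfl

/-- The space `Ω^r = C^r × C^r` of piecewise `C^r` vector fields `Z = (X, Y)`, with the product
topology; `X` acts where `h > 0` and `Y` where `h < 0`. -/
abbrev Omega (U : Opens E3) (r : ℕ) : Type := CrField U r × CrField U r

/-- The component `X` of `Z = (X, Y)`, as a map. -/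
def Omega.X {U : Opens E3} {r : ℕ} (Z : Omega U r) : E3 → E3 := PreJet.field Z.1.1

/-- The component `Y` of `Z = (X, Y)`, as a map. -/
def Omega.Y {U : Opens E3} {r : ℕ} (Z : Omega U r) : E3 → E3 := PreJet.field Z.2.1

/-- The derivative `V f` of a function `f` in the direction of a vector field `V`. -/
def lieD (V : E3 → E3) (f : E3 → ℝ) (x : E3) : ℝ := fderiv ℝ f x (V x)

/-- The sliding region `Σ^s` of the pair `(X, Y)`, with switching surface `h = 0` in `U`. -/
def slidingRegion (U : Opens E3) (h : E3 → ℝ) (X Y : E3 → E3) : Set E3 :=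
  {x | x ∈ U ∧ h x = 0 ∧ lieD X h x < 0 ∧ 0 < lieD Y h x}

/-- The escaping region `Σ^e`. -/
def escapingRegion (U : Opens E3) (h : E3 → ℝ) (X Y : E3 → E3) : Set E3 :=
  {x | x ∈ U ∧ h x = 0 ∧ 0 < lieD X h x ∧ lieD Y h x < 0}

/-- The sliding vector field `(Yh X - Xh Y) / (Yh - Xh)`; meaningful where `Yh ≠ Xh`. -/
def slidingField (h : E3 → ℝ) (X Y : E3 → E3) (x : E3) : E3 :=
  (lieD Y h x - lieD X h x)⁻¹ • (lieD Y h x • X x - lieD X h x • Y x)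

/-- `lam` is an eigenvalue of the linearization at `p`, along the tangent plane
`ker (dh p)` of the switching surface, of a vector field `V` tangent to that surface:
`u + i v`, with `u, v` tangent, is an eigenvector. -/
def IsTangentEigenvalue (h : E3 → ℝ) (V : E3 → E3) (p : E3) (lam : ℂ) : Prop :=
  ∃ u v : E3, fderiv ℝ h p u = 0 ∧ fderiv ℝ h p v = 0 ∧ (u ≠ 0 ∨ v ≠ 0) ∧
    fderiv ℝ V p u = lam.re • u - lam.im • v ∧
    fderiv ℝ V p v = lam.im • u + lam.re • v

/-- `p` is an unstable hyperbolic focus of `V` on the switching surface: an equilibrium whose two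
eigenvalues form a non-real conjugate pair with positive real part. -/
def IsUnstableFocus (h : E3 → ℝ) (V : E3 → E3) (p : E3) : Prop :=
  V p = 0 ∧ ∃ lam : ℂ, lam.im ≠ 0 ∧ 0 < lam.re ∧ IsTangentEigenvalue h V p lam

/-- `p` is a stable hyperbolic focus of `V` on the switching surface. -/
def IsStableFocus (h : E3 → ℝ) (V : E3 → E3) (p : E3) : Prop :=
  V p = 0 ∧ ∃ lam : ℂ, lam.im ≠ 0 ∧ lam.re < 0 ∧ IsTangentEigenvalue h V p lam

/-- `c` is a trajectory of the vector field `V` on the time interval `I`. -/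
def IsTrajectory (V : E3 → E3) (c : ℝ → E3) (I : Set ℝ) : Prop :=
  ∀ t ∈ I, HasDerivWithinAt c (V (c t)) I t

/-- `q` is a visible fold point of `X`, where the sliding vector field is defined. -/
def IsVisibleFold (U : Opens E3) (h : E3 → ℝ) (X Y : E3 → E3) (q : E3) : Prop :=
  q ∈ U ∧ h q = 0 ∧ lieD X h q = 0 ∧ 0 < lieD X (lieD X h) q ∧ lieD Y h q - lieD X h q ≠ 0

/-- Sliding Shilnikov orbit `Γ` at a pseudo saddle-focus `p ∈ Σ^s`: the sliding orbit through the
visible fold point `q ∈ ∂Σ^s` converges to `p` backward in time, and the orbit of `X`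
starting at `q` reaches `p` after a time `t₀ > 0`, through the region `h > 0` where `X` acts. -/
def IsShilnikovSliding (U : Opens E3) (h : E3 → ℝ) (X Y : E3 → E3) (Γ : Set E3) : Prop :=
  ∃ (p q : E3) (t₀ : ℝ) (c x : ℝ → E3),
    p ∈ slidingRegion U h X Y ∧ IsUnstableFocus h (slidingField h X Y) p ∧
    q ∈ closure (slidingRegion U h X Y) \ slidingRegion U h X Y ∧ IsVisibleFold U h X Y q ∧
    (c 0 = q ∧ IsTrajectory (slidingField h X Y) c (Iic 0) ∧
      (∀ t < 0, c t ∈ slidingRegion U h X Y) ∧ Tendsto c atBot (𝓝 p)) ∧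
    (0 < t₀ ∧ x 0 = q ∧ x t₀ = p ∧ IsTrajectory X x (Icc 0 t₀) ∧
      ∀ t ∈ Ioo 0 t₀, x t ∈ U ∧ 0 < h (x t)) ∧
    Γ = {p} ∪ c '' Iic 0 ∪ x '' Icc 0 t₀

/-- Sliding Shilnikov orbit `Γ` at a pseudo saddle-focus `p ∈ Σ^e`: the same with the directions
of time reversed. -/
def IsShilnikovEscaping (U : Opens E3) (h : E3 → ℝ) (X Y : E3 → E3) (Γ : Set E3) : Prop :=
  ∃ (p q : E3) (t₀ : ℝ) (c x : ℝ → E3),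
    p ∈ escapingRegion U h X Y ∧ IsStableFocus h (slidingField h X Y) p ∧
    q ∈ closure (escapingRegion U h X Y) \ escapingRegion U h X Y ∧ IsVisibleFold U h X Y q ∧
    (c 0 = q ∧ IsTrajectory (slidingField h X Y) c (Ici 0) ∧
      (∀ t > 0, c t ∈ escapingRegion U h X Y) ∧ Tendsto c atTop (𝓝 p)) ∧
    (t₀ < 0 ∧ x 0 = q ∧ x t₀ = p ∧ IsTrajectory X x (Icc t₀ 0) ∧
      ∀ t ∈ Ioo t₀ 0, x t ∈ U ∧ 0 < h (x t)) ∧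
    Γ = {p} ∪ c '' Ici 0 ∪ x '' Icc t₀ 0

/-- `Γ` is a sliding Shilnikov orbit of `Z = (X, Y)`. -/
def IsSlidingShilnikovOrbit {U : Opens E3} {r : ℕ} (h : E3 → ℝ) (Z : Omega U r)
    (Γ : Set E3) : Prop :=
  IsShilnikovSliding U h (Omega.X Z) (Omega.Y Z) Γ ∨
    IsShilnikovEscaping U h (Omega.X Z) (Omega.Y Z) Γ

end

end SlidingShilnikov

/-! Everything is local near the compact set Γ₀, so h, X and Y are multiplied by a cutoff equal to 1
near Γ₀. This replaces them by a compactly supported C² function H on the whole space and by bounded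
C¹ fields there, depending on Z through a continuous linear map. Such fields form a Banach space
`BddC1`, their flows are complete, and the flow is C¹ jointly in field, time and initial point
(`BddC1.contDiff_flow`); the last fact comes from the implicit function theorem applied to the
integral equation. Dividing by Yh - Xh is made harmless by a C¹ function ρ equal to the reciprocal
away from zero, so the sliding field too becomes a complete field, tangent to every level of H.

For Z near Z₀ the focus continues to a C¹ function p(Z), the only equilibrium nearby, which attracts
nearby points of the surface backward in time (`focus_continuation`). Follow the X-orbit of p(Z)
backward. Along it Xh has a zero at the flight time T of Γ₀, simple because X²h(q) > 0 at the
visible fold; hence there is a unique zero τ(Z) close to T, depending on Z in a C¹ way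
(`exists_turning_time`). The splitting function is g(Z) = H(φ_X(-τ(Z), p(Z))), the height at which
the backward orbit turns.

If g(Z) = 0, the turning point is a visible fold on the surface. The backward sliding orbit from it
stays close to the old one until it is trapped by p(Z), so an orbit in V exists
(`eventually_exists_orbit`). Conversely, V₀ is chosen so that an orbit in V must have p(Z) as its
focus and τ(Z) as its flight time, and cannot be of escaping type (`eventually_return_eq_zero`).

For regularity, only Y is perturbed, by a field η tangent to the surface at p₀. To first order X and
its flow are unchanged, the focus moves by a tangent vector d that can be prescribed through η(p₀),
and the variation of τ does not contribute because Xh(q₀) = 0. So Dg is dH at q₀ applied to the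
transported d, and d can be chosen to make this nonzero (`exists_transversal_direction`). The
escaping case follows from the sliding one by replacing Z with -Z. -/

namespace SlidingShilnikov
noncomputable section

/-! ### Joint C¹ regularity of maps linear in one variable -/

/-- A map which is linear in the first variable, with values depending in a Lipschitz way on the
second one, is `C¹` as soon as its partial derivative in the second variable is continuous. -/
theorem contDiff_one_of_linear_fst {B G H : Type*} [NormedAddCommGroup B] [NormedSpace ℝ B]
    [NormedAddCommGroup G] [NormedSpace ℝ G] [NormedAddCommGroup H] [NormedSpace ℝ H]
    {ev : G → B →L[ℝ] H} (hev : LipschitzWith 1 ev) {D : B × G → G →L[ℝ] H}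
    (hD : ∀ b x, HasFDerivAt (fun y => ev y b) (D (b, x)) x) (hDc : Continuous D) :
    ContDiff ℝ 1 fun z : B × G => ev z.2 z.1 := by
  refine contDiff_one_iff_hasFDerivAt.2
    ⟨fun z => (ev z.2).comp (ContinuousLinearMap.fst ℝ _ _) +
      (D z).comp (ContinuousLinearMap.snd ℝ _ _), ?_, ?_⟩
  · exact ((hev.continuous.comp continuous_snd).clm_comp continuous_const).add
      (hDc.clm_comp continuous_const)
  · rintro ⟨b, x⟩
    have h1 : HasFDerivAt (fun z : B × G => ev z.2 b)
        ((D (b, x)).comp (ContinuousLinearMap.snd ℝ _ _)) (b, x) :=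
      HasFDerivAt.comp (g := fun y => ev y b) (b, x) (hD b x) hasFDerivAt_snd
    -- Write `ev z.2 z.1` as `ev z.2 (z.1 - b)` plus `ev z.2 b`. In the first summand, replacing
    -- `z.2` by `x` costs at most `‖z.2 - x‖ * ‖z.1 - b‖`, which is quadratic.
    have h2 : HasFDerivAt (fun z : B × G => ev z.2 (z.1 - b))
        ((ev x).comp (ContinuousLinearMap.fst ℝ _ _)) (b, x) := by
      rw [hasFDerivAt_iff_isLittleO]
      have : (fun z : B × G => ev z.2 (z.1 - b) - ev x (z.1 - b)) =o[𝓝 (b, x)]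
          fun z => z - (b, x) := by
        refine Asymptotics.IsBigO.trans_isLittleO (g := fun z : B × G =>
          ‖z - (b, x)‖ * ‖z - (b, x)‖) ?_ ?_
        · refine Asymptotics.IsBigO.of_bound 1 (Eventually.of_forall fun z => ?_)
          rw [one_mul, norm_mul, norm_norm, ← _root_.sub_apply]
          have hl : ‖ev z.2 - ev x‖ ≤ ‖z.2 - x‖ := by
            simpa [dist_eq_norm] using hev.dist_le_mul z.2 x
          exact (ContinuousLinearMap.le_opNorm _ _).trans
            (mul_le_mul (hl.trans (norm_snd_le (z - (b, x))))
            (norm_fst_le (z - (b, x))) (norm_nonneg _) (norm_nonneg _))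
        · have h0 : Tendsto (fun z : B × G => ‖z - (b, x)‖) (𝓝 (b, x)) (𝓝 0) := by
            have : Continuous fun z : B × G => ‖z - (b, x)‖ := by fun_prop
            simpa using this.tendsto (b, x)
          have := ((Asymptotics.isLittleO_one_iff ℝ).2 h0).mul_isBigO
            (Asymptotics.isBigO_refl (fun z : B × G => ‖z - (b, x)‖) (𝓝 (b, x)))
          simpa using this.norm_right
      refine this.congr (fun z => ?_) fun z => rfl
      simp
    have := h2.add h1
    convert! this using 1
    funext z
    simp

/-! ### The Banach space of bounded C¹ vector fields -/

section BddC1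

variable {E : Type*} [NormedAddCommGroup E] [NormedSpace ℝ E]

variable (E) in
/-- Pairs of a bounded continuous field and a candidate for its derivative. -/
def FieldPair : Type _ := (E →ᵇ E) × (E →ᵇ (E →L[ℝ] E))

instance : NormedAddCommGroup (FieldPair E) :=
  inferInstanceAs (NormedAddCommGroup ((E →ᵇ E) × (E →ᵇ (E →L[ℝ] E))))

instance : NormedSpace ℝ (FieldPair E) :=
  inferInstanceAs (NormedSpace ℝ ((E →ᵇ E) × (E →ᵇ (E →L[ℝ] E))))

instance [CompleteSpace E] : CompleteSpace (FieldPair E) :=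
  inferInstanceAs (CompleteSpace ((E →ᵇ E) × (E →ᵇ (E →L[ℝ] E))))

variable (E) in
/-- The space of bounded `C¹` vector fields with bounded derivative, a field being stored together
with its derivative. -/
def bddC1Submodule : Submodule ℝ (FieldPair E) where
  carrier := {f | ∀ x, HasFDerivAt f.1 (f.2 x) x}
  zero_mem' := fun x => hasFDerivAt_const (0 : E) x
  add_mem' := fun hf hg x => (hf x).add (hg x)
  smul_mem' := fun c _ hf x => (hf x).const_smul c

variable (E) in
/-- The type of bounded `C¹` vector fields with bounded derivative. -/
abbrev BddC1 : Type _ := bddC1Submodule E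

namespace BddC1

/-- The underlying vector field. -/
def fld (b : BddC1 E) : E → E := b.1.1

/-- The derivative of the underlying vector field. -/
def der (b : BddC1 E) : E → E →L[ℝ] E := b.1.2

theorem hasFDerivAt (b : BddC1 E) (x : E) : HasFDerivAt b.fld (b.der x) x := b.2 x

theorem continuous_fld (b : BddC1 E) : Continuous b.fld := b.1.1.continuous

theorem continuous_der (b : BddC1 E) : Continuous b.der := b.1.2.continuous

theorem norm_fld_le (b : BddC1 E) (x : E) : ‖b.fld x‖ ≤ ‖b‖ :=
  (b.1.1.norm_coe_le_norm x).trans (norm_fst_le b.1)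

theorem norm_der_le (b : BddC1 E) (x : E) : ‖b.der x‖ ≤ ‖b‖ :=
  (b.1.2.norm_coe_le_norm x).trans (norm_snd_le b.1)

@[simp] theorem fld_add (b c : BddC1 E) (x : E) : (b + c).fld x = b.fld x + c.fld x := rfl
@[simp] theorem fld_sub (b c : BddC1 E) (x : E) : (b - c).fld x = b.fld x - c.fld x := rfl
@[simp] theorem fld_smul (a : ℝ) (b : BddC1 E) (x : E) : (a • b).fld x = a • b.fld x := rfl
@[simp] theorem der_sub (b c : BddC1 E) (x : E) : (b - c).der x = b.der x - c.der x := rfl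

theorem norm_fld_sub_le (b : BddC1 E) (x y : E) : ‖b.fld x - b.fld y‖ ≤ ‖b‖ * ‖x - y‖ :=
  convex_univ.norm_image_sub_le_of_norm_hasFDerivWithin_le
    (fun z _ => (b.hasFDerivAt z).hasFDerivWithinAt) (fun z _ => b.norm_der_le z)
    (mem_univ y) (mem_univ x)

theorem lipschitzWith (b : BddC1 E) : LipschitzWith ‖b‖₊ b.fld :=
  LipschitzWith.of_dist_le_mul fun x y => by
    simpa [dist_eq_norm] using b.norm_fld_sub_le x y

theorem norm_le_of {b : BddC1 E} {C : ℝ} (hC : 0 ≤ C) (h : ∀ x, ‖b.fld x‖ ≤ C)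
    (h' : ∀ x, ‖b.der x‖ ≤ C) : ‖b‖ ≤ C :=
  max_le ((BoundedContinuousFunction.norm_le hC).2 h) ((BoundedContinuousFunction.norm_le hC).2 h')

/-- Uniform convergence of the derivatives passes differentiability to the limit. The resulting
completeness matters because the implicit function theorem is later applied with this space of
fields as parameter space. -/
theorem isClosed : IsClosed (bddC1Submodule E : Set (FieldPair E)) := by
  refine IsSeqClosed.isClosed fun f g hf hg x => ?_
  have h1 : Tendsto (fun n => (f n).1) atTop (𝓝 g.1) := (continuous_fst.tendsto g).comp hg
  have h2 : Tendsto (fun n => (f n).2) atTop (𝓝 g.2) := (continuous_snd.tendsto g).comp hg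
  rw [BoundedContinuousFunction.tendsto_iff_tendstoUniformly] at h1 h2
  exact hasFDerivAt_of_tendstoUniformly h2 (fun n => hf n) (fun y => h1.tendsto_at y) x

instance [CompleteSpace E] : CompleteSpace (BddC1 E) := isClosed.completeSpace_coe

/-- Evaluation of fields at a point. -/
def evalL (x : E) : BddC1 E →L[ℝ] E :=
  LinearMap.mkContinuous
    { toFun := fun b => b.fld x, map_add' := fun _ _ => rfl, map_smul' := fun _ _ => rfl } 1
    (fun b => by rw [one_mul]; exact b.norm_fld_le x)

@[simp] theorem evalL_apply (x : E) (b : BddC1 E) : evalL x b = b.fld x := rfl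

theorem lipschitz_evalL : LipschitzWith 1 (evalL : E → BddC1 E →L[ℝ] E) :=
  LipschitzWith.of_dist_le_mul fun x y => by
    rw [dist_eq_norm, dist_eq_norm, NNReal.coe_one, one_mul]
    refine ContinuousLinearMap.opNorm_le_bound _ (norm_nonneg _) fun b => ?_
    simpa [mul_comm] using b.norm_fld_sub_le x y

theorem continuous_der_uncurry : Continuous fun z : BddC1 E × E => z.1.der z.2 := by
  rw [continuous_iff_continuousAt]
  rintro ⟨b, x⟩
  rw [ContinuousAt, tendsto_iff_norm_sub_tendsto_zero]
  have h1 : Tendsto (fun z : BddC1 E × E => ‖z.1 - b‖ + ‖b.der z.2 - b.der x‖) (𝓝 (b, x))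
      (𝓝 0) := by
    have hc : Continuous fun z : BddC1 E × E => ‖z.1 - b‖ + ‖b.der z.2 - b.der x‖ :=
      (continuous_fst.sub continuous_const).norm.add
        ((b.continuous_der.comp continuous_snd).sub continuous_const).norm
    simpa using hc.tendsto (b, x)
  refine squeeze_zero (fun _ => norm_nonneg _) (fun z => ?_) h1
  calc ‖z.1.der z.2 - b.der x‖ = ‖(z.1 - b).der z.2 + (b.der z.2 - b.der x)‖ := by simp
    _ ≤ _ := (norm_add_le _ _).trans (add_le_add_left (norm_der_le _ _) _)

/-- The evaluation map is `C¹` jointly in the field and the point. -/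
theorem contDiff_eval : ContDiff ℝ 1 fun z : BddC1 E × E => z.1.fld z.2 :=
  contDiff_one_of_linear_fst (D := fun z => z.1.der z.2) lipschitz_evalL
    (fun b x => b.hasFDerivAt x) continuous_der_uncurry

end BddC1

end BddC1

/-! ### The superposition operator on continuous paths -/

section Superposition

variable {E : Type*} [NormedAddCommGroup E] [NormedSpace ℝ E]
variable {K : Type*} [TopologicalSpace K] [CompactSpace K]

/-- Pointwise application of a continuous family of operators. -/
def pointwiseApply : C(K, E →L[ℝ] E) →L[ℝ] C(K, E) →L[ℝ] C(K, E) :=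
  LinearMap.mkContinuous₂
    (LinearMap.mk₂ ℝ (fun (A : C(K, E →L[ℝ] E)) (η : C(K, E)) =>
        (⟨fun s => A s (η s), by fun_prop⟩ : C(K, E)))
      (fun A B η => by ext; simp) (fun c A η => by ext; simp)
      (fun A η ζ => by ext; simp) (fun c A η => by ext; simp)) 1
    (fun A η => by
      rw [one_mul]
      refine (ContinuousMap.norm_le _ (by positivity)).2 fun s => ?_
      exact ((A s).le_opNorm _).trans
        (mul_le_mul (A.norm_coe_le_norm s) (η.norm_coe_le_norm s) (norm_nonneg _) (by positivity)))

theorem norm_pointwiseApply_le (A : C(K, E →L[ℝ] E)) : ‖pointwiseApply A‖ ≤ ‖A‖ :=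
  ContinuousLinearMap.opNorm_le_bound _ (by positivity) fun η =>
    (ContinuousMap.norm_le _ (by positivity)).2 fun s => ((A s).le_opNorm _).trans
      (mul_le_mul (A.norm_coe_le_norm s) (η.norm_coe_le_norm s) (norm_nonneg _) (by positivity))

namespace BddC1

/-- Composition of fields with a continuous map, as a linear map in the field. -/
def compL (γ : C(K, E)) : BddC1 E →L[ℝ] C(K, E) :=
  LinearMap.mkContinuous
    { toFun := fun b => ⟨fun s => b.fld (γ s), b.continuous_fld.comp γ.continuous⟩
      map_add' := fun _ _ => rfl
      map_smul' := fun _ _ => rfl } 1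
    (fun b => by
      rw [one_mul]
      exact (ContinuousMap.norm_le _ (norm_nonneg _)).2 fun s => b.norm_fld_le (γ s))

theorem lipschitz_compL : LipschitzWith 1 (compL : C(K, E) → BddC1 E →L[ℝ] C(K, E)) :=
  LipschitzWith.of_dist_le_mul fun x y => by
    rw [dist_eq_norm, dist_eq_norm, NNReal.coe_one, one_mul]
    refine ContinuousLinearMap.opNorm_le_bound _ (norm_nonneg _) fun b => ?_
    refine (ContinuousMap.norm_le _ (by positivity)).2 fun s => ?_
    calc ‖b.fld (x s) - b.fld (y s)‖ ≤ ‖b‖ * ‖x s - y s‖ := b.norm_fld_sub_le _ _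
      _ ≤ ‖b‖ * ‖x - y‖ := by gcongr; exact (x - y).norm_coe_le_norm s
      _ = _ := mul_comm _ _

/-- The derivative of a field along a continuous map. -/
def derComp (z : BddC1 E × C(K, E)) : C(K, E →L[ℝ] E) :=
  ⟨fun s => z.1.der (z.2 s), z.1.continuous_der.comp z.2.continuous⟩

theorem norm_derComp_le (z : BddC1 E × C(K, E)) : ‖derComp z‖ ≤ ‖z.1‖ :=
  (ContinuousMap.norm_le _ (norm_nonneg _)).2 fun _ => z.1.norm_der_le _

/-- The topology of `C(K, _)` is the compact-open one, so joint continuity of the evaluated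
derivative is enough; no uniform continuity of `der` on `E` is required. -/
theorem continuous_derComp : Continuous (derComp : BddC1 E × C(K, E) → C(K, E →L[ℝ] E)) := by
  refine ContinuousMap.continuous_of_continuous_uncurry _ ?_
  exact continuous_der_uncurry.comp
    ((continuous_fst.comp continuous_fst).prodMk
      ((continuous_snd.comp continuous_fst).eval continuous_snd))

/-- Continuity of `derComp` in the sup norm makes the derivative of `b` vary by at most ε on all
segments from `γ s` to `η s` at once; the mean value inequality on each segment then gives a bound
uniform in `s`. -/
theorem hasFDerivAt_compL (b : BddC1 E) (γ : C(K, E)) :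
    HasFDerivAt (fun η => compL η b) (pointwiseApply (derComp (b, γ))) γ := by
  rw [hasFDerivAt_iff_isLittleO, Asymptotics.isLittleO_iff]
  intro ε hε
  have hc : Continuous fun η : C(K, E) => derComp (b, η) :=
    continuous_derComp.comp (continuous_const.prodMk continuous_id)
  obtain ⟨δ, hδ, hball⟩ := (Metric.continuousAt_iff
    (f := fun η : C(K, E) => derComp (b, η))).1 (hc.continuousAt (x := γ)) ε hε
  filter_upwards [Metric.ball_mem_nhds γ hδ] with η hη
  refine (ContinuousMap.norm_le _ (by positivity)).2 fun s => ?_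
  have hseg : ∀ z ∈ segment ℝ (γ s) (η s), ‖b.der z - b.der (γ s)‖ ≤ ε := by
    rintro z hz
    rw [segment_eq_image'] at hz
    obtain ⟨t, ht, rfl⟩ := hz
    have h1 : dist (γ + t • (η - γ)) γ < δ := by
      rw [dist_eq_norm, add_sub_cancel_left, norm_smul, Real.norm_of_nonneg ht.1]
      rw [Metric.mem_ball, dist_eq_norm] at hη
      exact (mul_le_of_le_one_left (norm_nonneg _) ht.2).trans_lt hη
    have h2 := (hball h1).le
    rw [← dist_eq_norm]
    exact (ContinuousMap.dist_apply_le_dist (f := derComp (b, γ + t • (η - γ)))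
      (g := derComp (b, γ)) s).trans h2
  have := (convex_segment (γ s) (η s)).norm_image_sub_le_of_norm_hasFDerivWithin_le'
    (f := b.fld) (fun z _ => (b.hasFDerivAt z).hasFDerivWithinAt) hseg
    (left_mem_segment ℝ _ _) (right_mem_segment ℝ _ _)
  refine this.trans ?_
  gcongr
  exact (η - γ).norm_coe_le_norm s

/-- The superposition operator is `C¹` jointly in the field and the path. -/
theorem contDiff_superposition :
    ContDiff ℝ 1 fun z : BddC1 E × C(K, E) => compL z.2 z.1 :=
  contDiff_one_of_linear_fst (D := fun z => pointwiseApply (derComp z)) lipschitz_compL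
    hasFDerivAt_compL (pointwiseApply.continuous.comp continuous_derComp)

end BddC1
end Superposition

/-! ### Complete flows of bounded C¹ fields -/

section Flow

variable {E : Type*} [NormedAddCommGroup E] [NormedSpace ℝ E] [CompleteSpace E]

namespace BddC1

/-- The speed never exceeds ‖b‖, so in time T a solution stays in the ball of radius ‖b‖T. With this
radius the Picard–Lindelöf condition holds on an interval of any length. -/
theorem exists_solution_Icc (b : BddC1 E) (x : E) {T : ℝ} (hT : 0 < T) :
    ∃ γ : ℝ → E, γ 0 = x ∧ ∀ t ∈ Ioo (-T) T, HasDerivAt γ (b.fld (γ t)) t := by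
  have hpl : IsPicardLindelof (fun _ => b.fld) (tmin := -T) (tmax := T)
      ⟨0, by constructor <;> linarith⟩ x (‖b‖₊ * ⟨T, hT.le⟩) 0 ‖b‖₊ ‖b‖₊ :=
    IsPicardLindelof.of_time_independent (fun y _ => b.norm_fld_le y)
      b.lipschitzWith.lipschitzOnWith (by simp; exact le_rfl)
  obtain ⟨γ, h0, hγ⟩ := hpl.exists_eq_forall_mem_Icc_hasDerivWithinAt₀
  exact ⟨γ, h0, fun t ht => (hγ t (Ioo_subset_Icc_self ht)).hasDerivAt (Icc_mem_nhds ht.1 ht.2)⟩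

theorem exists_solution (b : BddC1 E) (x : E) :
    ∃ γ : ℝ → E, γ 0 = x ∧ ∀ t, HasDerivAt γ (b.fld (γ t)) t := by
  have hpos : ∀ n : ℕ, (0 : ℝ) < n + 1 := fun n => by positivity
  choose c hc0 hc using fun n : ℕ => b.exists_solution_Icc x (hpos n)
  have huniq : ∀ m n : ℕ, m ≤ n → EqOn (c m) (c n) (Ioo (-((m : ℝ) + 1)) (m + 1)) := by
    intro m n hmn
    have hmn' : (m : ℝ) ≤ n := by exact_mod_cast hmn
    refine ODE_solution_unique_of_mem_Ioo (v := fun _ => b.fld) (s := fun _ => univ) (t₀ := 0)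
      (fun t _ => b.lipschitzWith.lipschitzOnWith) ⟨by linarith [hpos m], hpos m⟩
      (fun t ht => ⟨hc m t ht, mem_univ _⟩)
      (fun t ht => ⟨hc n t ⟨by linarith [ht.1], by linarith [ht.2]⟩, mem_univ _⟩) ?_
    rw [hc0, hc0]
  have key : ∀ n : ℕ, ∀ t ∈ Ioo (-((n : ℝ) + 1)) (n + 1), c ⌈|t|⌉₊ t = c n t := by
    intro n t ht
    have h1 : |t| ≤ ⌈|t|⌉₊ := Nat.le_ceil _
    rcases le_total ⌈|t|⌉₊ n with h | h
    · exact huniq _ _ h ⟨by linarith [neg_abs_le t], by linarith [le_abs_self t]⟩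
    · exact (huniq _ _ h ht).symm
  -- The solution of index n lives on the open interval of radius n + 1, so t is an interior point
  -- for the index ⌈|t|⌉ and differentiability can be read off there.
  refine ⟨fun t => c ⌈|t|⌉₊ t, by simp [hc0], fun t => ?_⟩
  have ht : t ∈ Ioo (-((⌈|t|⌉₊ : ℝ) + 1)) (⌈|t|⌉₊ + 1) := by
    have h1 : |t| ≤ ⌈|t|⌉₊ := Nat.le_ceil _
    exact ⟨by linarith [neg_abs_le t], by linarith [le_abs_self t]⟩
  refine (hc _ t ht).congr_of_eventuallyEq ?_
  filter_upwards [Ioo_mem_nhds ht.1 ht.2] with s hs using key _ s hs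

/-- The flow of a bounded `C¹` field. -/
def flow (b : BddC1 E) (t : ℝ) (x : E) : E := (b.exists_solution x).choose t

@[simp] theorem flow_zero (b : BddC1 E) (x : E) : b.flow 0 x = x :=
  (b.exists_solution x).choose_spec.1

theorem hasDerivAt_flow (b : BddC1 E) (x : E) (t : ℝ) :
    HasDerivAt (fun s => b.flow s x) (b.fld (b.flow t x)) t :=
  (b.exists_solution x).choose_spec.2 t

theorem continuous_flow_time (b : BddC1 E) (x : E) : Continuous fun t => b.flow t x :=
  continuous_iff_continuousAt.2 fun t => (b.hasDerivAt_flow x t).continuousAt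

theorem eq_flow {b : BddC1 E} {γ : ℝ → E} (hγ : ∀ t, HasDerivAt γ (b.fld (γ t)) t) (t : ℝ) :
    γ t = b.flow t (γ 0) :=
  congrFun (ODE_solution_unique_univ (v := fun _ => b.fld) (s := fun _ => univ) (t₀ := 0)
    (fun _ => b.lipschitzWith.lipschitzOnWith) (fun s => ⟨hγ s, mem_univ _⟩)
    (fun s => ⟨b.hasDerivAt_flow (γ 0) s, mem_univ _⟩) (by simp)) t

theorem flow_add (b : BddC1 E) (s t : ℝ) (x : E) : b.flow (s + t) x = b.flow s (b.flow t x) := by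
  have := eq_flow (b := b) (γ := fun s => b.flow (s + t) x)
    (fun s => by simpa using (b.hasDerivAt_flow x (s + t)).comp_add_const s t) s
  simpa using this

theorem flow_neg_flow (b : BddC1 E) (t : ℝ) (x : E) : b.flow (-t) (b.flow t x) = x := by
  rw [← flow_add]; simp

theorem flow_flow_neg (b : BddC1 E) (t : ℝ) (x : E) : b.flow t (b.flow (-t) x) = x := by
  rw [← flow_add]; simp

theorem flow_eq_of_Icc {b : BddC1 E} {γ : ℝ → E} {T : ℝ}
    (hγ : ∀ t ∈ Icc 0 T, HasDerivWithinAt γ (b.fld (γ t)) (Icc 0 T) t) :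
    ∀ t ∈ Icc 0 T, γ t = b.flow t (γ 0) := by
  refine ODE_solution_unique (v := fun _ => b.fld) (fun _ => b.lipschitzWith)
    (fun t ht => (hγ t ht).continuousWithinAt) (fun t ht => ?_)
    (b.continuous_flow_time _).continuousOn
    (fun t _ => (b.hasDerivAt_flow _ t).hasDerivWithinAt) (by simp)
  have := hγ t (Ico_subset_Icc_self ht)
  exact this.mono_of_mem_nhdsWithin (Icc_mem_nhdsGE_of_mem ht)

theorem flow_eq_of_Iic {b : BddC1 E} {γ : ℝ → E}
    (hγ : ∀ t ∈ Iic (0 : ℝ), HasDerivWithinAt γ (b.fld (γ t)) (Iic 0) t) :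
    ∀ t ∈ Iic (0 : ℝ), γ t = b.flow t (γ 0) := by
  intro t ht
  refine ODE_solution_unique_of_mem_Icc_left (a := t) (b := 0) (v := fun _ => b.fld)
    (s := fun _ => univ)
    (fun _ _ => b.lipschitzWith.lipschitzOnWith)
    (fun s hs => ((hγ s hs.2).continuousWithinAt).mono Icc_subset_Iic_self) (fun s hs => ?_)
    (fun _ _ => mem_univ _)
    (b.continuous_flow_time _).continuousOn
    (fun t _ => (b.hasDerivAt_flow _ t).hasDerivWithinAt) (fun _ _ => mem_univ _) (by simp)
    (left_mem_Icc.2 ht)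
  exact (hγ s hs.2).mono (Iic_subset_Iic.2 hs.2)

end BddC1

end Flow

/-- The implicit function theorem asks for invertibility of the left-hand side; this identifies it
with a partial derivative computed by hand. -/
theorem fderiv_comp_inr_eq {A B C : Type*} [NormedAddCommGroup A] [NormedSpace ℝ A]
    [NormedAddCommGroup B] [NormedSpace ℝ B] [NormedAddCommGroup C] [NormedSpace ℝ C]
    {f : A × B → C} {u : A × B} {f₂ : B →L[ℝ] C} (hf : DifferentiableAt ℝ f u)
    (h₂ : HasFDerivAt (fun y => f (u.1, y)) f₂ u.2) :
    fderiv ℝ f u ∘L .inr ℝ A B = f₂ :=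
  (HasFDerivAt.comp (g := f) u.2 hf.hasFDerivAt (hasFDerivAt_prodMk_right u.1 u.2)).unique h₂

/-! ### C¹ dependence of the flow on field, time and initial point -/

section FlowSmooth

variable {E : Type*} [NormedAddCommGroup E] [NormedSpace ℝ E]

/-- The primitive vanishing at `0` of a continuous map on the unit interval. -/
def primitiveL : C(unitInterval, E) →L[ℝ] C(unitInterval, E) :=
  have hint : ∀ (η : C(unitInterval, E)) (a b : ℝ), IntervalIntegrable
      (fun u => η (projIcc 0 1 zero_le_one u)) MeasureTheory.volume a b := fun η a b =>
    (η.continuous.comp continuous_projIcc).intervalIntegrable a b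
  LinearMap.mkContinuous
    { toFun := fun η =>
        ⟨fun s => ∫ u in (0 : ℝ)..s, η (projIcc 0 1 zero_le_one u),
          (intervalIntegral.continuous_primitive (hint η) 0).comp continuous_subtype_val⟩
      map_add' := fun η ζ => by
        ext s
        exact intervalIntegral.integral_add (hint η 0 s) (hint ζ 0 s)
      map_smul' := fun c η => by
        ext s
        exact intervalIntegral.integral_smul c _ } 1
    (fun η => by
      rw [one_mul]
      refine (ContinuousMap.norm_le _ (norm_nonneg _)).2 fun s => ?_
      refine (intervalIntegral.norm_integral_le_of_norm_le_const (C := ‖η‖)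
        fun u _ => η.norm_coe_le_norm _).trans ?_
      rw [sub_zero, abs_of_nonneg s.2.1]
      exact mul_le_of_le_one_right (norm_nonneg _) s.2.2)

theorem primitiveL_apply (η : C(unitInterval, E)) (s : unitInterval) :
    primitiveL η s = ∫ u in (0 : ℝ)..s, η (projIcc 0 1 zero_le_one u) := rfl

theorem norm_primitiveL_le (η : C(unitInterval, E)) : ‖primitiveL η‖ ≤ ‖η‖ := by
  refine (ContinuousMap.norm_le _ (norm_nonneg _)).2 fun s => ?_
  refine (intervalIntegral.norm_integral_le_of_norm_le_const (C := ‖η‖)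
    fun u _ => η.norm_coe_le_norm _).trans ?_
  rw [sub_zero, abs_of_nonneg s.2.1]
  exact mul_le_of_le_one_right (norm_nonneg _) s.2.2

/-- Constant maps on the unit interval. -/
def constL : E →L[ℝ] C(unitInterval, E) :=
  LinearMap.mkContinuous
    { toFun := fun x => ContinuousMap.const _ x
      map_add' := fun _ _ => rfl
      map_smul' := fun _ _ => rfl } 1
    (fun x => by
      rw [one_mul]
      exact (ContinuousMap.norm_le _ (norm_nonneg _)).2 fun _ => le_rfl)

namespace BddC1

/-- The defect in the integral equation for the orbit of `x` under the field `b`, with the time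
interval `[0, t]` rescaled to the unit interval. -/
def defect (z : (BddC1 E × ℝ × E) × C(unitInterval, E)) : C(unitInterval, E) :=
  z.2 - constL z.1.2.2 - z.1.2.1 • primitiveL (compL z.2 z.1.1)

theorem contDiff_defect :
    ContDiff ℝ 1 (defect : (BddC1 E × ℝ × E) × C(unitInterval, E) → C(unitInterval, E)) := by
  have h1 : ContDiff ℝ 1 fun z : (BddC1 E × ℝ × E) × C(unitInterval, E) => compL z.2 z.1.1 :=
    contDiff_superposition.comp ((contDiff_fst.comp contDiff_fst).prodMk contDiff_snd)
  have h2 := (primitiveL (E := E)).contDiff.comp h1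
  have h3 : ContDiff ℝ 1 fun z : (BddC1 E × ℝ × E) × C(unitInterval, E) => constL z.1.2.2 :=
    (constL (E := E)).contDiff.comp (contDiff_snd.comp (contDiff_snd.comp contDiff_fst))
  have h4 : ContDiff ℝ 1 fun z : (BddC1 E × ℝ × E) × C(unitInterval, E) => z.1.2.1 :=
    contDiff_fst.comp (contDiff_snd.comp contDiff_fst)
  exact (contDiff_snd.sub h3).sub (h4.smul h2)

theorem hasFDerivAt_defect (p : BddC1 E × ℝ × E) (γ : C(unitInterval, E)) :
    HasFDerivAt (fun η => defect (p, η))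
      (1 - p.2.1 • (primitiveL ∘L pointwiseApply (derComp (p.1, γ)))) γ := by
  have h1 := (primitiveL (E := E)).hasFDerivAt.comp γ (hasFDerivAt_compL p.1 γ)
  exact ((hasFDerivAt_id γ).sub_const (constL p.2.2)).sub (h1.const_smul p.2.1)

/-- For |t|‖b‖ < 1 the integral operator is a strict contraction in the sup norm, so the integral
equation has at most one solution. -/
theorem eq_of_defect_eq_zero {p : BddC1 E × ℝ × E} (hp : |p.2.1| * ‖p.1‖ < 1)
    {γ η : C(unitInterval, E)} (hγ : defect (p, γ) = 0) (hη : defect (p, η) = 0) : γ = η := by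
  have h1 : γ - η = p.2.1 • primitiveL (compL γ p.1 - compL η p.1) := by
    have : γ - η - (p.2.1 • primitiveL (compL γ p.1 - compL η p.1)) = 0 := by
      rw [← sub_zero (0 : C(unitInterval, E))]
      nth_rewrite 1 [← hγ]
      rw [← hη, map_sub, smul_sub]
      simp only [defect]
      abel
    exact sub_eq_zero.1 this
  have h2 : ‖γ - η‖ ≤ |p.2.1| * ‖p.1‖ * ‖γ - η‖ := by
    calc ‖γ - η‖ = |p.2.1| * ‖primitiveL (compL γ p.1 - compL η p.1)‖ := by
          conv_lhs => rw [h1]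
          rw [norm_smul, Real.norm_eq_abs]
      _ ≤ |p.2.1| * (‖p.1‖ * ‖γ - η‖) := by
          gcongr
          refine (norm_primitiveL_le _).trans ?_
          refine (ContinuousMap.norm_le _ (by positivity)).2 fun s => ?_
          refine (p.1.norm_fld_sub_le (γ s) (η s)).trans ?_
          gcongr
          exact (γ - η).norm_coe_le_norm s
      _ = _ := by ring
  have h3 : ‖γ - η‖ = 0 := by nlinarith [norm_nonneg (γ - η)]
  exact sub_eq_zero.1 (norm_eq_zero.1 h3)

variable [CompleteSpace E]

/-- The orbit of `x` on the time interval `[0, t]`, rescaled to the unit interval. -/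
def orbitPath (p : BddC1 E × ℝ × E) : C(unitInterval, E) :=
  ⟨fun s => p.1.flow (p.2.1 * s) p.2.2,
    (p.1.continuous_flow_time p.2.2).comp (continuous_const.mul continuous_subtype_val)⟩

theorem defect_orbitPath (p : BddC1 E × ℝ × E) : defect (p, orbitPath p) = 0 := by
  obtain ⟨b, t, x⟩ := p
  ext s
  have hder : ∀ u : ℝ, HasDerivAt (fun u => b.flow (t * u) x) (t • b.fld (b.flow (t * u) x)) u :=
    fun u => by
      have h := (b.hasDerivAt_flow x (t * u)).scomp u ((hasDerivAt_id u).const_mul t)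
      simp only [mul_one] at h
      exact h
  have hcont : Continuous fun u : ℝ => t • b.fld (b.flow (t * u) x) :=
    continuous_const.smul (b.continuous_fld.comp
      ((b.continuous_flow_time x).comp (continuous_const.mul continuous_id)))
  have h1 := intervalIntegral.integral_eq_sub_of_hasDerivAt (a := 0) (b := (s : ℝ))
    (fun u _ => hder u) (hcont.intervalIntegrable _ _)
  rw [intervalIntegral.integral_smul] at h1
  have h2 : ∫ u in (0 : ℝ)..s, compL (orbitPath (b, t, x)) b (projIcc 0 1 zero_le_one u) =
      ∫ u in (0 : ℝ)..s, b.fld (b.flow (t * u) x) := by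
    refine intervalIntegral.integral_congr fun u hu => ?_
    rw [uIcc_of_le s.2.1] at hu
    have hu' : u ∈ Icc (0 : ℝ) 1 := ⟨hu.1, hu.2.trans s.2.2⟩
    simp only [projIcc_of_mem zero_le_one hu']
    rfl
  change b.flow (t * s) x - x - t • primitiveL (compL (orbitPath (b, t, x)) b) s = 0
  rw [primitiveL_apply, h2, h1]
  simp

theorem isInvertible_one_sub {G : Type*} [NormedAddCommGroup G] [NormedSpace ℝ G]
    [CompleteSpace G] {A : G →L[ℝ] G} (hA : ‖A‖ < 1) :
    (1 - A : G →L[ℝ] G).IsInvertible := by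
  obtain ⟨u, hu⟩ := isUnit_one_sub_of_norm_lt_one hA
  rw [← hu]
  exact ⟨ContinuousLinearEquiv.ofUnit u, rfl⟩

/-- For small time the derivative of the defect in the path is the identity minus an operator of
norm below 1, so a Neumann series inverts it. The implicit function is again a zero of the defect,
hence is the orbit by uniqueness; no prior continuity of `orbitPath` is used. -/
theorem contDiffAt_orbitPath {p : BddC1 E × ℝ × E} (hp : |p.2.1| * ‖p.1‖ < 1) :
    ContDiffAt ℝ 1 orbitPath p := by
  have hF : ContDiffAt ℝ 1 defect (p, orbitPath p) := contDiff_defect.contDiffAt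
  have hinv : (fderiv ℝ defect (p, orbitPath p) ∘L .inr ℝ _ _).IsInvertible := by
    rw [fderiv_comp_inr_eq (hF.differentiableAt one_ne_zero) (hasFDerivAt_defect p (orbitPath p))]
    refine isInvertible_one_sub (lt_of_le_of_lt ?_ hp)
    rw [norm_smul, Real.norm_eq_abs]
    gcongr
    refine ContinuousLinearMap.opNorm_le_bound _ (norm_nonneg _) fun η => ?_
    refine (norm_primitiveL_le _).trans ((ContinuousLinearMap.le_opNorm _ _).trans ?_)
    gcongr
    exact (norm_pointwiseApply_le _).trans (norm_derComp_le (p.1, orbitPath p))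
  refine (hF.contDiffAt_implicitFunction one_ne_zero hinv).congr_of_eventuallyEq ?_
  have hopen : ∀ᶠ z : BddC1 E × ℝ × E in 𝓝 p, |z.2.1| * ‖z.1‖ < 1 := by
    have hc : Continuous fun z : BddC1 E × ℝ × E => |z.2.1| * ‖z.1‖ := by fun_prop
    exact hc.continuousAt.eventually_lt continuousAt_const hp
  filter_upwards [hF.eventually_apply_implicitFunction one_ne_zero hinv, hopen] with z hz hz'
  rw [defect_orbitPath] at hz
  exact eq_of_defect_eq_zero hz' (defect_orbitPath z) hz

theorem contDiffAt_flow_of_small {p : BddC1 E × ℝ × E} (hp : |p.2.1| * ‖p.1‖ < 1) :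
    ContDiffAt ℝ 1 (fun z : BddC1 E × ℝ × E => z.1.flow z.2.1 z.2.2) p := by
  have h := (ContinuousMap.evalCLM ℝ (1 : unitInterval) (M := E)).contDiff.contDiffAt.comp p
    (contDiffAt_orbitPath hp)
  refine h.congr_of_eventuallyEq (Eventually.of_forall fun z => ?_)
  simp [orbitPath]

/-- The flow is `C¹` jointly in the field, the time and the initial point. -/
theorem contDiff_flow : ContDiff ℝ 1 fun z : BddC1 E × ℝ × E => z.1.flow z.2.1 z.2.2 := by
  rw [contDiff_iff_contDiffAt]
  rintro ⟨b, t, x⟩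
  -- The smallness condition does not involve the initial point, so the flow at time t is a
  -- composition of N flows at time t/N, each covered by the short-time result.
  obtain ⟨N, hN⟩ := exists_nat_gt (|t| * ‖b‖)
  have hN0 : (0 : ℝ) < N := lt_of_le_of_lt (by positivity) hN
  have hsmall : |t / N| * ‖b‖ < 1 := by
    rw [abs_div, Nat.abs_cast, div_mul_eq_mul_div, div_lt_one hN0]
    exact hN
  have key : ∀ n : ℕ, ContDiffAt ℝ 1
      (fun z : BddC1 E × ℝ × E => z.1.flow (n * (z.2.1 / N)) z.2.2) (b, t, x) := by
    intro n
    induction n with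
    | zero =>
      simp only [Nat.cast_zero, zero_mul, flow_zero]
      exact (contDiff_snd.comp contDiff_snd).contDiffAt
    | succ n ih =>
      have h1 : ContDiffAt ℝ 1 (fun z : BddC1 E × ℝ × E =>
          (z.1, z.2.1 / N, z.1.flow (n * (z.2.1 / N)) z.2.2)) (b, t, x) :=
        contDiffAt_fst.prodMk
          (((contDiff_fst.comp contDiff_snd).contDiffAt.div_const _).prodMk ih)
      have h2 := ContDiffAt.comp (b, t, x)
        (contDiffAt_flow_of_small (p := (b, t / N, b.flow (n * (t / N)) x)) hsmall) h1
      refine h2.congr_of_eventuallyEq (Eventually.of_forall fun z => ?_)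
      simp only [Function.comp]
      rw [← flow_add]
      congr 1
      push_cast
      ring
  refine (key N).congr_of_eventuallyEq (Eventually.of_forall fun z => ?_)
  simp only
  congr 1
  field_simp

theorem continuous_flow : Continuous fun z : BddC1 E × ℝ × E => z.1.flow z.2.1 z.2.2 :=
  contDiff_flow.continuous

end BddC1
end FlowSmooth

/-! ### Linear algebra of a focus in a plane -/

section Focus

variable {E : Type*} [NormedAddCommGroup E] [NormedSpace ℝ E]

/-- Applying A - a to the relation turns it by a quarter: y u - x v = 0 as well. Combining the two
kills (x² + y²) u and (x² + y²) v. -/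
theorem focus_linear_relation {A : E →L[ℝ] E} {u v : E} {a β : ℝ} (hβ : β ≠ 0)
    (huv : u ≠ 0 ∨ v ≠ 0) (hu : A u = a • u - β • v) (hv : A v = β • u + a • v)
    {x y : ℝ} (h : x • u + y • v = 0) : x = 0 ∧ y = 0 := by
  have h1 : y • u - x • v = 0 := by
    have h2 : A (x • u + y • v) - a • (x • u + y • v) = 0 := by rw [h]; simp
    rw [map_add, map_smul, map_smul, hu, hv] at h2
    have h3 : β • (y • u - x • v) = 0 := by rw [← h2]; module
    exact (smul_eq_zero.1 h3).resolve_left hβ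
  have hx : (x ^ 2 + y ^ 2) • u = 0 := by
    have : (x ^ 2 + y ^ 2) • u = x • (x • u + y • v) + y • (y • u - x • v) := by module
    rw [this, h, h1]; simp
  have hy : (x ^ 2 + y ^ 2) • v = 0 := by
    have : (x ^ 2 + y ^ 2) • v = y • (x • u + y • v) - x • (y • u - x • v) := by module
    rw [this, h, h1]; simp
  have hz : x ^ 2 + y ^ 2 = 0 := by
    rcases huv with h0 | h0
    · exact (smul_eq_zero.1 hx).resolve_right h0
    · exact (smul_eq_zero.1 hy).resolve_right h0
  constructor <;> nlinarith [sq_nonneg x, sq_nonneg y]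

/-- Coordinates adapted to a focus in a plane `ker ℓ` of a three dimensional space. -/
theorem exists_focus_basis (hdim : Module.finrank ℝ E = 3) {A : E →L[ℝ] E} {ℓ : E →L[ℝ] ℝ}
    (hℓA : ∀ x, ℓ (A x) = 0) (hℓ : ℓ ≠ 0) {u v : E} {a β : ℝ} (ha : 0 < a) (hβ : β ≠ 0)
    (hℓu : ℓ u = 0) (hℓv : ℓ v = 0)
    (huv : u ≠ 0 ∨ v ≠ 0) (hu : A u = a • u - β • v) (hv : A v = β • u + a • v) :
    ∃ (n : E) (B : Module.Basis (Fin 3) ℝ E), ℓ n = 1 ∧ A n = 0 ∧ B 0 = u ∧ B 1 = v ∧ B 2 = n := by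
  have : FiniteDimensional ℝ E := FiniteDimensional.of_finrank_pos (by omega)
  obtain ⟨m₀, hm₀⟩ : ∃ m, ℓ m ≠ 0 := by
    by_contra! hcon
    exact hℓ (ContinuousLinearMap.ext hcon)
  have hind : ∀ n : E, ℓ n ≠ 0 → LinearIndependent ℝ ![u, v, n] := by
    intro n hn
    rw [Fintype.linearIndependent_iff]
    intro g hg
    simp only [Fin.sum_univ_three, Matrix.cons_val_zero, Matrix.cons_val_one,
      Matrix.cons_val] at hg
    have h2 : g 2 = 0 := by
      have := congrArg ℓ hg
      simp only [map_add, map_smul, hℓu, hℓv, map_zero, smul_eq_mul, mul_zero, zero_add] at this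
      exact (mul_eq_zero.1 this).resolve_right hn
    rw [h2, zero_smul, add_zero] at hg
    obtain ⟨h0, h1⟩ := focus_linear_relation hβ huv hu hv hg
    intro i
    fin_cases i <;> assumption
  have hbasis : ∀ n : E, ℓ n ≠ 0 → ∃ B : Module.Basis (Fin 3) ℝ E,
      B 0 = u ∧ B 1 = v ∧ B 2 = n := by
    intro n hn
    refine ⟨basisOfLinearIndependentOfCardEqFinrank (hind n hn) (by simp [hdim]), ?_, ?_, ?_⟩ <;>
      simp
  obtain ⟨B, hB0, hB1, hB2⟩ := hbasis m₀ hm₀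
  have hAm := B.sum_repr (A m₀)
  rw [Fin.sum_univ_three, hB0, hB1, hB2] at hAm
  have h2 : B.repr (A m₀) 2 = 0 := by
    have := congrArg ℓ hAm
    simp only [map_add, map_smul, hℓu, hℓv, hℓA, smul_eq_mul, mul_zero, zero_add] at this
    exact (mul_eq_zero.1 this).resolve_right hm₀
  rw [h2, zero_smul, add_zero] at hAm
  set x := B.repr (A m₀) 0
  set y := B.repr (A m₀) 1
  -- A maps into ker ℓ and is invertible on that plane, with determinant a² + β². So A m₀ = A k for
  -- some tangent k, and m₀ - k, rescaled, is the required kernel vector transverse to the plane.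
  have hD : a ^ 2 + β ^ 2 ≠ 0 := by positivity
  obtain ⟨p, q, e1, e2⟩ : ∃ p q : ℝ, p * a + q * β = x ∧ -(p * β) + q * a = y :=
    ⟨(a * x - β * y) / (a ^ 2 + β ^ 2), (β * x + a * y) / (a ^ 2 + β ^ 2),
      by field_simp; ring, by field_simp; ring⟩
  let k : E := p • u + q • v
  have hk : A k = A m₀ := by
    rw [← hAm, ← e1, ← e2]
    simp only [k, map_add, map_smul, hu, hv]
    module
  have hℓk : ℓ k = 0 := by simp [k, hℓu, hℓv]
  obtain ⟨B', h0, h1, h2'⟩ := hbasis ((ℓ m₀)⁻¹ • (m₀ - k)) (by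
    rw [map_smul, map_sub, hℓk, sub_zero, smul_eq_mul, inv_mul_cancel₀ hm₀]; exact one_ne_zero)
  refine ⟨_, B', ?_, ?_, h0, h1, h2'⟩
  · rw [map_smul, map_sub, hℓk, sub_zero, smul_eq_mul, inv_mul_cancel₀ hm₀]
  · rw [map_smul, map_sub, hk, sub_self, smul_zero]

/-- Adding `ℓ x • n` to a linear map with an unstable focus on `ker ℓ` yields a map which expands
a suitable Euclidean norm. -/
theorem exists_expanding_norm (hdim : Module.finrank ℝ E = 3) {A : E →L[ℝ] E} {ℓ : E →L[ℝ] ℝ}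
    (hℓA : ∀ x, ℓ (A x) = 0) (hℓ : ℓ ≠ 0) {u v : E} {a β : ℝ} (ha : 0 < a) (hβ : β ≠ 0)
    (hℓu : ℓ u = 0) (hℓv : ℓ v = 0)
    (huv : u ≠ 0 ∨ v ≠ 0) (hu : A u = a • u - β • v) (hv : A v = β • u + a • v) :
    ∃ (n : E) (P : E ≃L[ℝ] EuclideanSpace ℝ (Fin 3)) (c : ℝ), ℓ n = 1 ∧ A n = 0 ∧ 0 < c ∧
      ∀ x, c * ‖P x‖ ^ 2 ≤ inner ℝ (P (A x + ℓ x • n)) (P x) := by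
  have : FiniteDimensional ℝ E := FiniteDimensional.of_finrank_pos (by omega)
  obtain ⟨n, B, hn, hAn, h0, h1, h2⟩ := exists_focus_basis hdim hℓA hℓ ha hβ hℓu hℓv huv hu hv
  -- In the coordinates u, v, n the map is a scaled rotation block with symmetric part a times the
  -- identity, next to the entry 1 on n; hence the rate min a 1.
  refine ⟨n, B.equivFunL.trans (EuclideanSpace.equiv (Fin 3) ℝ).symm, min a 1, hn, hAn,
    by positivity, fun x => ?_⟩
  have hx := B.sum_repr x
  rw [Fin.sum_univ_three, h0, h1, h2] at hx
  set x0 := B.repr x 0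
  set x1 := B.repr x 1
  set x2 := B.repr x 2
  have hℓx : ℓ x = x2 := by
    rw [← hx]; simp [hℓu, hℓv, hn]
  have hAx : A x + ℓ x • n = (a * x0 + β * x1) • B 0 + (-(β * x0) + a * x1) • B 1 + x2 • B 2 := by
    rw [hℓx, h0, h1, h2, ← hx]
    simp only [map_add, map_smul, hu, hv, hAn]
    module
  have hr : ∀ i, (B.repr (A x + ℓ x • n)) i = ![a * x0 + β * x1, -(β * x0) + a * x1, x2] i := by
    intro i
    rw [hAx]
    fin_cases i <;> simp
  have e1 : ∀ (y : E) (i : Fin 3),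
      (B.equivFunL.trans (EuclideanSpace.equiv (Fin 3) ℝ).symm) y i = B.repr y i := fun y i => rfl
  rw [EuclideanSpace.norm_sq_eq, PiLp.inner_apply]
  simp only [e1, hr, Fin.sum_univ_three, Real.norm_eq_abs, sq_abs, RCLike.inner_apply, conj_trivial,
    Matrix.cons_val_zero, Matrix.cons_val_one, Matrix.cons_val]
  change min a 1 * (x0 ^ 2 + x1 ^ 2 + x2 ^ 2) ≤ x0 * (a * x0 + β * x1) + x1 * (-(β * x0) + a * x1)
    + x2 * x2
  have m1 : min a 1 ≤ a := min_le_left _ _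
  have m2 : min a 1 ≤ 1 := min_le_right _ _
  nlinarith [sq_nonneg x0, sq_nonneg x1, sq_nonneg x2, mul_le_mul_of_nonneg_right m1 (sq_nonneg x0),
    mul_le_mul_of_nonneg_right m1 (sq_nonneg x1), mul_le_mul_of_nonneg_right m2 (sq_nonneg x2)]

/-- Existence of an unstable focus in the plane `ker ℓ` persists under small perturbations. -/
theorem eventually_exists_focus (hdim : Module.finrank ℝ E = 3) {A : E →L[ℝ] E} {ℓ : E →L[ℝ] ℝ}
    (hℓA : ∀ x, ℓ (A x) = 0) (hℓ : ℓ ≠ 0) {u v : E} {a β : ℝ} (ha : 0 < a) (hβ : β ≠ 0)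
    (hℓu : ℓ u = 0) (hℓv : ℓ v = 0)
    (huv : u ≠ 0 ∨ v ≠ 0) (hu : A u = a • u - β • v) (hv : A v = β • u + a • v) :
    ∀ᶠ z : (E →L[ℝ] E) × (E →L[ℝ] ℝ) in 𝓝 (A, ℓ), (∀ x, z.2 (z.1 x) = 0) →
      ∃ lam : ℂ, lam.im ≠ 0 ∧ 0 < lam.re ∧ ∃ u v : E, z.2 u = 0 ∧ z.2 v = 0 ∧ (u ≠ 0 ∨ v ≠ 0) ∧
        z.1 u = lam.re • u - lam.im • v ∧ z.1 v = lam.im • u + lam.re • v := by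
  have : FiniteDimensional ℝ E := FiniteDimensional.of_finrank_pos (by omega)
  have : CompleteSpace E := FiniteDimensional.complete ℝ E
  obtain ⟨n, B, hn, hAn, h0, h1, h2⟩ := exists_focus_basis hdim hℓA hℓ ha hβ hℓu hℓv huv hu hv
  -- `U z` projects u to the perturbed plane along n. As u, A u, n are independent, `Q z` stays
  -- invertible nearby and expresses the square of the perturbed map on `U z` as Y₁ U + Y₂ A U. So
  -- λ² - Y₂ λ - Y₁ is the characteristic polynomial on the plane, and its coefficients vary
  -- continuously from Y₁ = -(a² + β²), Y₂ = 2a.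
  let U : (E →L[ℝ] E) × (E →L[ℝ] ℝ) → E := fun z => u - (z.2 u / z.2 n) • n
  let Q : (E →L[ℝ] E) × (E →L[ℝ] ℝ) → ((ℝ × ℝ × ℝ) →L[ℝ] E) := fun z =>
    (ContinuousLinearMap.fst ℝ ℝ (ℝ × ℝ)).smulRight (U z) +
    ((ContinuousLinearMap.fst ℝ ℝ ℝ).comp (ContinuousLinearMap.snd ℝ ℝ (ℝ × ℝ))).smulRight
      (z.1 (U z)) +
    ((ContinuousLinearMap.snd ℝ ℝ ℝ).comp (ContinuousLinearMap.snd ℝ ℝ (ℝ × ℝ))).smulRight n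
  have hQ : ∀ z x, Q z x = x.1 • U z + x.2.1 • z.1 (U z) + x.2.2 • n := fun z x => rfl
  have hU0 : U (A, ℓ) = u := by simp [U, hℓu]
  have hUc : ContinuousAt U (A, ℓ) := by
    have c1 : Continuous fun z : (E →L[ℝ] E) × (E →L[ℝ] ℝ) => z.2 u := by fun_prop
    have c2 : Continuous fun z : (E →L[ℝ] E) × (E →L[ℝ] ℝ) => z.2 n := by fun_prop
    exact continuousAt_const.sub ((c1.continuousAt.div c2.continuousAt
      (by simp [hn])).smul continuousAt_const)
  have hQc : ContinuousAt Q (A, ℓ) := by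
    have c1 : ContinuousAt (fun z : (E →L[ℝ] E) × (E →L[ℝ] ℝ) => z.1 (U z)) (A, ℓ) :=
      continuousAt_fst.clm_apply hUc
    have key : ∀ (L : (ℝ × ℝ × ℝ) →L[ℝ] ℝ) {f : (E →L[ℝ] E) × (E →L[ℝ] ℝ) → E},
        ContinuousAt f (A, ℓ) → ContinuousAt (fun z => L.smulRight (f z)) (A, ℓ) :=
      fun L f hf => (ContinuousLinearMap.smulRightL ℝ (ℝ × ℝ × ℝ) E L).continuous.continuousAt.comp
        hf
    exact ((key _ hUc).add (key _ c1)).add continuousAt_const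
  have hinv : (Q (A, ℓ)).IsInvertible := by
    have hinj : Function.Injective (Q (A, ℓ) : (ℝ × ℝ × ℝ) →ₗ[ℝ] E) := by
      rw [injective_iff_map_eq_zero]
      rintro ⟨x, y, t⟩ hx
      change Q (A, ℓ) (x, y, t) = 0 at hx
      rw [hQ, hU0] at hx
      simp only [hu] at hx
      have ht : t = 0 := by
        have := congrArg ℓ hx
        simpa [hℓu, hℓv, hn] using this
      subst ht
      have h3 : (x + y * a) • u + (-(y * β)) • v = 0 := by
        rw [← hx]; module
      obtain ⟨e1, e2⟩ := focus_linear_relation hβ huv hu hv h3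
      have hy : y = 0 := by
        rcases mul_eq_zero.1 (neg_eq_zero.1 e2) with h | h
        · exact h
        · exact absurd h hβ
      subst hy
      have hx0 : x = 0 := by simpa using e1
      subst hx0
      rfl
    refine ⟨(LinearEquiv.ofInjectiveOfFinrankEq (Q (A, ℓ) : (ℝ × ℝ × ℝ) →ₗ[ℝ] E) hinj
      (by simp [hdim])).toContinuousLinearEquiv, ?_⟩
    ext <;> rfl
  have hYc : ContinuousAt (fun z : (E →L[ℝ] E) × (E →L[ℝ] ℝ) =>
      (Q z).inverse (z.1 (z.1 (U z)))) (A, ℓ) := by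
    have c1 : ContinuousAt (fun z => (Q z).inverse) (A, ℓ) :=
      ContinuousAt.comp (g := ContinuousLinearMap.inverse)
        (hinv.contDiffAt_map_inverse (n := 0)).continuousAt hQc
    exact c1.clm_apply (continuousAt_fst.clm_apply (continuousAt_fst.clm_apply hUc))
  have hY0 : (Q (A, ℓ)).inverse (A (A (U (A, ℓ)))) = (-(a ^ 2 + β ^ 2), 2 * a, 0) := by
    rw [hinv.inverse_apply_eq, hQ, hU0]
    simp only [hu, map_sub, map_smul, hv]
    module
  have hQinv : ∀ᶠ z in 𝓝 (A, ℓ), (Q z).IsInvertible := by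
    obtain ⟨e, he⟩ := hinv
    have := e.nhds
    rw [he] at this
    filter_upwards [hQc this] with z hz
    obtain ⟨e', he'⟩ := hz
    exact ⟨e', he'⟩
  have hre : ∀ᶠ z in 𝓝 (A, ℓ), 0 < ((Q z).inverse (z.1 (z.1 (U z)))).2.1 := by
    have := hYc.snd.fst
    refine continuousAt_const.eventually_lt this ?_
    simp only [hY0]; linarith
  have hdisc : ∀ᶠ z in 𝓝 (A, ℓ), 0 < -((Q z).inverse (z.1 (z.1 (U z)))).1 -
      (((Q z).inverse (z.1 (z.1 (U z)))).2.1 / 2) ^ 2 := by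
    refine continuousAt_const.eventually_lt (hYc.fst.neg.sub ((hYc.snd.fst.div_const 2).pow 2)) ?_
    simp only [hY0]
    have : 0 < β ^ 2 := by positivity
    nlinarith
  have hne : ∀ᶠ z : (E →L[ℝ] E) × (E →L[ℝ] ℝ) in 𝓝 (A, ℓ), z.2 n ≠ 0 := by
    have c2 : Continuous fun z : (E →L[ℝ] E) × (E →L[ℝ] ℝ) => z.2 n := by fun_prop
    exact c2.continuousAt.eventually_ne (by simp [hn])
  filter_upwards [hQinv, hre, hdisc, hne] with z hz hre hdisc hne hzA
  have hzU : z.2 (U z) = 0 := by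
    simp only [U, map_sub, map_smul, smul_eq_mul]
    field_simp
    ring
  have hYeq := hz.self_apply_inverse (z.1 (z.1 (U z)))
  set Y := (Q z).inverse (z.1 (z.1 (U z)))
  rw [hQ] at hYeq
  have hY2 : Y.2.2 = 0 := by
    have := congrArg z.2 hYeq
    simp only [map_add, map_smul, hzU, hzA, smul_eq_mul, mul_zero, zero_add] at this
    exact (mul_eq_zero.1 this).resolve_right hne
  rw [hY2, zero_smul, add_zero] at hYeq
  set μ := Real.sqrt (-Y.1 - (Y.2.1 / 2) ^ 2)
  have hμ : 0 < μ := Real.sqrt_pos.2 hdisc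
  have hμ2 : μ ^ 2 = -Y.1 - (Y.2.1 / 2) ^ 2 := Real.sq_sqrt hdisc.le
  have hUne : U z ≠ 0 := by
    intro h
    have h1 : Q z (1, 0, 0) = Q z 0 := by rw [hQ, h]; simp
    have := hz.injective h1
    simp at this
  -- These are the real and imaginary parts of (A - conj λ) U, which A - λ annihilates because the
  -- characteristic polynomial does.
  refine ⟨⟨Y.2.1 / 2, μ⟩, hμ.ne', by simpa using hre, z.1 (U z) - (Y.2.1 / 2) • U z, μ • U z,
    ?_, ?_,
    Or.inr (smul_ne_zero hμ.ne' hUne), ?_, ?_⟩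
  · rw [map_sub, map_smul, hzA, hzU]; simp
  · rw [map_smul, hzU]; simp
  · rw [map_sub, map_smul, ← hYeq]
    have : Y.1 = -μ ^ 2 - (Y.2.1 / 2) ^ 2 := by linarith
    rw [this]
    module
  · rw [map_smul]
    module

end Focus

/-! ### Uniform expansion and backward trapping -/

section Continuation

variable {B : Type*} [NormedAddCommGroup B] [NormedSpace ℝ B]
variable {E : Type*} [NormedAddCommGroup E] [NormedSpace ℝ E]

/-- A `C¹` family of maps whose derivative at `x₀` expands a Euclidean norm is uniformly expanding
near `x₀`. -/
theorem exists_uniformly_expanding {F : Type*} [NormedAddCommGroup F] [InnerProductSpace ℝ F]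
    {G : B × E → E} {b₀ : B} {x₀ : E} {G' : B × E →L[ℝ] E} (hG : HasStrictFDerivAt G G' (b₀, x₀))
    (P : E ≃L[ℝ] F) {c : ℝ} (hc : 0 < c)
    (hexp : ∀ x, c * ‖P x‖ ^ 2 ≤ inner ℝ (P (G' (0, x))) (P x)) :
    ∃ R > 0, ∀ᶠ b in 𝓝 b₀, ∀ x y, ‖P (x - x₀)‖ < R → ‖P (y - x₀)‖ < R →
      c / 2 * ‖P (x - y)‖ ^ 2 ≤ inner ℝ (P (G (b, x) - G (b, y))) (P (x - y)) := by
  -- A linearization error of c/(2M) in the original norm is at most c/2 in the norm of P, so half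
  -- of the expansion rate survives. The added 1 keeps M positive.
  set M : ℝ := ‖(P : E →L[ℝ] F)‖ * ‖(P.symm : F →L[ℝ] E)‖ + 1
  have hM : 0 < M := by positivity
  have h1 := hG.isLittleO.def (c := c / (2 * M)) (by positivity)
  rw [nhds_prod_eq] at h1
  obtain ⟨s, hs, t, ht, hst⟩ := Filter.mem_prod_iff.1 h1
  have hcap := inter_mem hs ht
  rw [nhds_prod_eq] at hcap
  obtain ⟨u, hu, v, hv, huv⟩ := Filter.mem_prod_iff.1 hcap
  have hcont : ContinuousAt (fun w : F => P.symm w + x₀) 0 := by fun_prop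
  have hv' : v ∈ 𝓝 (P.symm 0 + x₀) := by simpa using hv
  obtain ⟨R, hR, hRv⟩ := Metric.mem_nhds_iff.1 (hcont.preimage_mem_nhds hv')
  have hmem : ∀ x, ‖P (x - x₀)‖ < R → x ∈ v := by
    intro x hx
    have : P (x - x₀) ∈ Metric.ball (0 : F) R := by simpa using hx
    simpa using hRv this
  refine ⟨R, hR, ?_⟩
  filter_upwards [hu] with b hb x y hx hy
  have hx' := huv (mk_mem_prod hb (hmem x hx))
  have hy' := huv (mk_mem_prod hb (hmem y hy))
  have h2 : ‖G (b, x) - G (b, y) - G' ((b, x) - (b, y))‖ ≤ c / (2 * M) * ‖(b, x) - (b, y)‖ :=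
    hst (mk_mem_prod hx'.1 hy'.2)
  have h3 : ((b, x) : B × E) - (b, y) = (0, x - y) := by simp
  have h4 : ‖((0, x - y) : B × E)‖ = ‖x - y‖ := by simp [Prod.norm_def]
  rw [h3, h4] at h2
  have h5 : ‖x - y‖ ≤ ‖(P.symm : F →L[ℝ] E)‖ * ‖P (x - y)‖ := by
    have := (P.symm : F →L[ℝ] E).le_opNorm (P (x - y))
    simpa using this
  have h6 : ‖P (G (b, x) - G (b, y) - G' (0, x - y))‖ ≤ c / 2 * ‖P (x - y)‖ := by
    calc ‖P (G (b, x) - G (b, y) - G' (0, x - y))‖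
        ≤ ‖(P : E →L[ℝ] F)‖ * ‖G (b, x) - G (b, y) - G' (0, x - y)‖ :=
          (P : E →L[ℝ] F).le_opNorm _
      _ ≤ ‖(P : E →L[ℝ] F)‖ * (c / (2 * M) * (‖(P.symm : F →L[ℝ] E)‖ * ‖P (x - y)‖)) := by
          gcongr
          exact h2.trans (by gcongr)
      _ = c / 2 * ‖P (x - y)‖ * ((‖(P : E →L[ℝ] F)‖ * ‖(P.symm : F →L[ℝ] E)‖) / M) := by
          field_simp
      _ ≤ c / 2 * ‖P (x - y)‖ * 1 := by
          gcongr
          rw [div_le_one hM]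
          simp [M]
      _ = _ := mul_one _
  have h7 : P (G (b, x) - G (b, y)) = P (G' (0, x - y)) +
      P (G (b, x) - G (b, y) - G' (0, x - y)) := by
    rw [← map_add]; congr 1; abel
  rw [h7, inner_add_left]
  have h8 := hexp (x - y)
  have h9 := abs_real_inner_le_norm (P (G (b, x) - G (b, y) - G' (0, x - y))) (P (x - y))
  have h10 := neg_abs_le
    (inner ℝ (P (G (b, x) - G (b, y) - G' (0, x - y))) (P (x - y)))
  nlinarith [norm_nonneg (P (x - y))]

/-- Backward trapping near a uniformly expanding equilibrium. -/
theorem backward_trapping {F : Type*} [NormedAddCommGroup F] [InnerProductSpace ℝ F]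
    (P : E ≃L[ℝ] F) {V : E → E} {x₀ y : E} {c R : ℝ} (hc : 0 < c) (hR : 0 < R)
    (hy : ‖P (y - x₀)‖ < R / 4)
    {σ : ℝ → E} {s₀ : ℝ} (hσ : ∀ s, HasDerivAt σ (V (σ s)) s)
    (hexp : ∀ s ≤ s₀, ‖P (σ s - x₀)‖ < R →
      c / 2 * ‖P (σ s - y)‖ ^ 2 ≤ inner ℝ (P (V (σ s))) (P (σ s - y)))
    (h₀ : ‖P (σ s₀ - x₀)‖ < R / 4) :
    (∀ s ≤ s₀, ‖P (σ s - x₀)‖ < R) ∧ Tendsto σ atBot (𝓝 y) := by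
  have htri : ∀ z, ‖P (z - x₀)‖ ≤ ‖P (z - y)‖ + ‖P (y - x₀)‖ := by
    intro z
    have : P (z - x₀) = P (z - y) + P (y - x₀) := by rw [← map_add]; congr 1; abel
    rw [this]; exact norm_add_le _ _
  have htri' : ∀ z, ‖P (z - y)‖ ≤ ‖P (z - x₀)‖ + ‖P (y - x₀)‖ := by
    intro z
    have : P (z - y) = P (z - x₀) - P (y - x₀) := by rw [← map_sub]; congr 1; abel
    rw [this]; exact norm_sub_le _ _
  have hder : ∀ τ : ℝ, HasDerivAt (fun τ => ‖P (σ (s₀ - τ) - y)‖ ^ 2)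
      (-(2 * inner ℝ (P (V (σ (s₀ - τ)))) (P (σ (s₀ - τ) - y)))) τ := by
    intro τ
    have h1 : HasDerivAt (fun τ => σ (s₀ - τ)) (-V (σ (s₀ - τ))) τ :=
      (hσ (s₀ - τ)).comp_const_sub s₀ τ
    have h2 : HasDerivAt (fun τ => P (σ (s₀ - τ) - y)) (P (-V (σ (s₀ - τ)))) τ :=
      (P : E →L[ℝ] F).hasFDerivAt.comp_hasDerivAt τ (h1.sub_const y)
    have h3 := h2.norm_sq
    rw [map_neg, inner_neg_right, real_inner_comm, mul_neg] at h3
    exact h3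
  -- Barrier for the squared distance to y in reversed time. At a contact point the distance is at
  -- most R/2, hence less than R from x₀, so the expansion applies and the squared distance decays
  -- at rate at least c, strictly faster than the barrier's c/2. The two bounds R/4 place the
  -- starting point within R/2 of y.
  set Bd : ℝ → ℝ := fun τ => (R / 2) ^ 2 * Real.exp (-(c / 2) * τ)
  have hBd : ∀ τ, HasDerivAt Bd (-(c / 2) * Bd τ) τ := by
    intro τ
    have := (((hasDerivAt_id τ).const_mul (-(c / 2))).exp).const_mul ((R / 2) ^ 2)
    refine this.congr_deriv ?_
    change _ = -(c / 2) * ((R / 2) ^ 2 * Real.exp (-(c / 2) * τ))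
    simp only [id]
    ring
  have hBdpos : ∀ τ, 0 < Bd τ := fun τ => by positivity
  have hbound : ∀ τ, 0 ≤ τ → ‖P (σ (s₀ - τ) - y)‖ ^ 2 ≤ Bd τ := by
    intro T hT
    refine image_le_of_deriv_right_lt_deriv_boundary (a := 0) (b := T)
      (fun τ _ => (hder τ).continuousAt.continuousWithinAt)
      (fun τ _ => (hder τ).hasDerivWithinAt) ?_ hBd ?_ ⟨hT, le_rfl⟩
    · simp only [Bd, sub_zero, mul_zero, Real.exp_zero, mul_one]
      have := htri' (σ s₀)
      exact pow_le_pow_left₀ (norm_nonneg _) (by linarith) 2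
    · intro τ hτ hEq
      have hle : Bd τ ≤ (R / 2) ^ 2 := by
        refine mul_le_of_le_one_right (by positivity) (Real.exp_le_one_iff.2 ?_)
        nlinarith [hτ.1]
      have h1 : ‖P (σ (s₀ - τ) - y)‖ ≤ R / 2 := by
        rw [← hEq] at hle
        exact le_of_sq_le_sq hle (by positivity)
      have h2 : ‖P (σ (s₀ - τ) - x₀)‖ < R := by linarith [htri (σ (s₀ - τ))]
      have h3 := hexp (s₀ - τ) (by linarith [hτ.1]) h2
      rw [hEq] at h3
      nlinarith [hBdpos τ]
  have hbound' : ∀ s ≤ s₀, ‖P (σ s - y)‖ ^ 2 ≤ Bd (s₀ - s) := fun s hs => by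
    simpa using hbound (s₀ - s) (by linarith)
  constructor
  · intro s hs
    have hle : Bd (s₀ - s) ≤ (R / 2) ^ 2 := by
      refine mul_le_of_le_one_right (by positivity) (Real.exp_le_one_iff.2 ?_)
      nlinarith
    have h1 : ‖P (σ s - y)‖ ≤ R / 2 :=
      le_of_sq_le_sq ((hbound' s hs).trans hle) (by positivity)
    linarith [htri (σ s)]
  · have hlim : Tendsto (fun s => Bd (s₀ - s)) atBot (𝓝 0) := by
      have h1 : Tendsto (fun s : ℝ => -(c / 2) * (s₀ - s)) atBot atBot := by
        have h2 : Tendsto (fun s : ℝ => s₀ - s) atBot atTop :=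
          tendsto_atTop_add_const_left _ s₀ tendsto_neg_atBot_atTop
        exact h2.const_mul_atTop_of_neg (by linarith)
      have h3 := (Real.tendsto_exp_atBot.comp h1).const_mul ((R / 2) ^ 2)
      simpa [Bd, Function.comp_def] using h3
    have hsq : Tendsto (fun s => ‖P (σ s - y)‖ ^ 2) atBot (𝓝 0) :=
      squeeze_zero' (Eventually.of_forall fun s => by positivity)
        ((eventually_le_atBot s₀).mono fun s hs => hbound' s hs) hlim
    have hn : Tendsto (fun s => ‖P (σ s - y)‖) atBot (𝓝 0) := by
      have := (Real.continuous_sqrt.tendsto 0).comp hsq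
      simpa [Function.comp_def, Real.sqrt_sq (norm_nonneg _)] using this
    have hP : Tendsto (fun s => P (σ s - y)) atBot (𝓝 0) := tendsto_zero_iff_norm_tendsto_zero.2 hn
    have := (P.symm.continuous.tendsto 0).comp hP
    have h4 : Tendsto (fun s => σ s - y) atBot (𝓝 0) := by
      simpa [Function.comp_def] using this
    simpa using h4.add_const y

end Continuation

/-! ### Continuation of the focus of a tangent field -/

section FocusContinuation

theorem finrank_E3 : Module.finrank ℝ E3 = 3 := by simp

/-- A vector field tangent to the level sets of `H` has, at an equilibrium, a derivative with values
in the tangent plane. -/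
theorem fderiv_apply_fderiv_eq_zero {H : E3 → ℝ} (hH : ContDiff ℝ 2 H) {V : E3 → E3}
    (hHV : ∀ x, fderiv ℝ H x (V x) = 0) {x : E3} (hV : DifferentiableAt ℝ V x) (hx : V x = 0)
    (w : E3) : fderiv ℝ H x (fderiv ℝ V x w) = 0 := by
  have hdH : ContDiff ℝ 1 (fderiv ℝ H) := hH.fderiv_right (by norm_num)
  have h1 := ((hdH.differentiable one_ne_zero x).hasFDerivAt).clm_apply hV.hasFDerivAt
  have h2 : (fun y => fderiv ℝ H y (V y)) = fun _ => (0 : ℝ) := funext hHV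
  rw [h2] at h1
  have h3 := congrArg (fun L => L w) (h1.unique (hasFDerivAt_const (0 : ℝ) x))
  simpa [hx] using h3

theorem level_constant {H : E3 → ℝ} (hH : ContDiff ℝ 2 H) {V : E3 → E3}
    (hHV : ∀ x, fderiv ℝ H x (V x) = 0) {σ : ℝ → E3} (hσ : ∀ s, HasDerivAt σ (V (σ s)) s)
    (s t : ℝ) : H (σ s) = H (σ t) := by
  have hder : ∀ s, HasDerivAt (fun s => H (σ s)) 0 s := by
    intro s
    have := ((hH.differentiable two_ne_zero (σ s)).hasFDerivAt).comp_hasDerivAt s (hσ s)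
    rw [hHV] at this
    exact this
  exact is_const_of_deriv_eq_zero (fun s => (hder s).differentiableAt) (fun s => (hder s).deriv) s t

theorem exists_expanding_of_focus {H : E3 → ℝ} (hH : ContDiff ℝ 2 H) {V : E3 → E3}
    (hHV : ∀ x, fderiv ℝ H x (V x) = 0) {x₀ : E3} (hV : DifferentiableAt ℝ V x₀)
    (hd : fderiv ℝ H x₀ ≠ 0) (hf : IsUnstableFocus H V x₀) :
    ∃ (n : E3) (P : E3 ≃L[ℝ] EuclideanSpace ℝ (Fin 3)) (c : ℝ), fderiv ℝ H x₀ n = 1 ∧ 0 < c ∧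
      ∀ x, c * ‖P x‖ ^ 2 ≤ inner ℝ (P (fderiv ℝ V x₀ x + fderiv ℝ H x₀ x • n)) (P x) := by
  obtain ⟨hx, lam, him, hre, u, v, hu, hv, huv, hAu, hAv⟩ := hf
  obtain ⟨n, P, c, hn, -, hc, hexp⟩ := exists_expanding_norm finrank_E3
    (fderiv_apply_fderiv_eq_zero hH hHV hV hx) hd hre him hu hv huv hAu hAv
  exact ⟨n, P, c, hn, hc, hexp⟩

/-- On tangent vectors the normal correction vanishes, so the expansion inequality alone forces
injectivity of the linearization on the tangent plane. -/
theorem eq_zero_of_focus {H : E3 → ℝ} (hH : ContDiff ℝ 2 H) {V : E3 → E3}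
    (hHV : ∀ x, fderiv ℝ H x (V x) = 0) {x₀ : E3} (hV : DifferentiableAt ℝ V x₀)
    (hd : fderiv ℝ H x₀ ≠ 0) (hf : IsUnstableFocus H V x₀) {w : E3} (hw : fderiv ℝ H x₀ w = 0)
    (hVw : fderiv ℝ V x₀ w = 0) : w = 0 := by
  obtain ⟨n, P, c, -, hc, hexp⟩ := exists_expanding_of_focus hH hHV hV hd hf
  have h1 := hexp w
  rw [hw, hVw] at h1
  simp only [zero_smul, add_zero, map_zero, inner_zero_left] at h1
  have h2 : ‖P w‖ = 0 := by
    have : ‖P w‖ ^ 2 = 0 := le_antisymm (by nlinarith [sq_nonneg ‖P w‖]) (by positivity)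
    exact pow_eq_zero_iff two_ne_zero |>.1 this
  simpa using h2

variable {B : Type*} [NormedAddCommGroup B] [NormedSpace ℝ B]

theorem fderiv_slice {S : B × E3 → E3} (hS : ContDiff ℝ 1 S) (b : B) (x : E3) :
    fderiv ℝ (fun y => S (b, y)) x = fderiv ℝ S (b, x) ∘L .inr ℝ B E3 :=
  ((hS.differentiable one_ne_zero (b, x)).hasFDerivAt.comp x
    (hasFDerivAt_prodMk_right b x)).fderiv

/-- Continuation of an unstable focus: it depends in a `C¹` way on parameters, is locally unique
and remains a focus, and orbits starting in a uniform neighbourhood converge to it backward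
in time. -/
theorem focus_continuation [CompleteSpace B] {H : E3 → ℝ} (hH : ContDiff ℝ 2 H)
    {S : B × E3 → E3} (hS : ContDiff ℝ 1 S) (hHS : ∀ b x, fderiv ℝ H x (S (b, x)) = 0)
    {b₀ : B} {x₀ : E3} (hx₀ : H x₀ = 0) (hd : fderiv ℝ H x₀ ≠ 0)
    (hf : IsUnstableFocus H (fun x => S (b₀, x)) x₀) :
    ∃ p : B → E3, ContDiffAt ℝ 1 p b₀ ∧ p b₀ = x₀ ∧
      (∀ᶠ b in 𝓝 b₀, H (p b) = 0 ∧ IsUnstableFocus H (fun x => S (b, x)) (p b)) ∧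
      (∃ N ∈ 𝓝 x₀, ∀ᶠ b in 𝓝 b₀, ∀ x ∈ N, H x = 0 → S (b, x) = 0 → x = p b) ∧
      ∀ O ∈ 𝓝 x₀, ∃ O' ∈ 𝓝 x₀, ∀ᶠ b in 𝓝 b₀, ∀ (σ : ℝ → E3) (s₀ : ℝ),
        (∀ s, HasDerivAt σ (S (b, σ s)) s) → H (σ s₀) = 0 → σ s₀ ∈ O' →
          (∀ s ≤ s₀, σ s ∈ O) ∧ Tendsto σ atBot (𝓝 (p b)) := by
  have hdiff : ∀ b x, DifferentiableAt ℝ (fun y => S (b, y)) x := fun b x =>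
    (hS.differentiable one_ne_zero (b, x)).comp x (by fun_prop)
  have hdH : ContDiff ℝ 1 (fderiv ℝ H) := hH.fderiv_right (by norm_num)
  obtain ⟨n, P, c, hn, hc, hexp⟩ :=
    exists_expanding_of_focus hH (hHS b₀) (hdiff b₀ x₀) hd hf
  -- At the equilibrium the derivative of S takes values in the tangent plane only, so S itself
  -- cannot be fed to the implicit function theorem. The term H n supplies the missing normal
  -- direction, and G = S on the surface H = 0.
  let G : B × E3 → E3 := fun z => S z + H z.2 • n
  have hG : ContDiff ℝ 1 G :=
    hS.add (((hH.of_le (by norm_num)).comp contDiff_snd).smul contDiff_const)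
  have hG₀ : G (b₀, x₀) = 0 := by simp [G, hx₀, hf.1]
  have hG2 : fderiv ℝ G (b₀, x₀) ∘L .inr ℝ B E3 =
      fderiv ℝ (fun y => S (b₀, y)) x₀ + (fderiv ℝ H x₀).smulRight n :=
    fderiv_comp_inr_eq (hG.differentiable one_ne_zero _)
      ((hdiff b₀ x₀).hasFDerivAt.add
        ((hH.differentiable two_ne_zero x₀).hasFDerivAt.smul_const n))
  have hexp' : ∀ x, c * ‖P x‖ ^ 2 ≤ inner ℝ (P (fderiv ℝ G (b₀, x₀) (0, x))) (P x) := by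
    intro x
    have : fderiv ℝ G (b₀, x₀) (0, x) = (fderiv ℝ G (b₀, x₀) ∘L .inr ℝ B E3) x := rfl
    rw [this, hG2]
    exact hexp x
  have hinv : (fderiv ℝ G (b₀, x₀) ∘L .inr ℝ B E3).IsInvertible := by
    have hinj : Function.Injective
        ((fderiv ℝ G (b₀, x₀) ∘L .inr ℝ B E3 : E3 →L[ℝ] E3) : E3 →ₗ[ℝ] E3) := by
      rw [injective_iff_map_eq_zero]
      intro x hx
      have h1 := hexp' x
      have h2 : fderiv ℝ G (b₀, x₀) (0, x) = 0 := hx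
      rw [h2, map_zero, inner_zero_left] at h1
      have : ‖P x‖ ^ 2 = 0 := le_antisymm (by nlinarith [sq_nonneg ‖P x‖]) (by positivity)
      have h3 : ‖P x‖ = 0 := pow_eq_zero_iff two_ne_zero |>.1 this
      simpa using h3
    refine ⟨(LinearEquiv.ofInjectiveEndo _ hinj).toContinuousLinearEquiv, ?_⟩
    ext x : 1
    rfl
  have hGat : ContDiffAt ℝ 1 G (b₀, x₀) := hG.contDiffAt
  let p := hGat.implicitFunction one_ne_zero hinv
  have hp1 : ContDiffAt ℝ 1 p b₀ := hGat.contDiffAt_implicitFunction one_ne_zero hinv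
  have hp0 : p b₀ = x₀ := hGat.implicitFunction_apply_self one_ne_zero hinv
  have hpG : ∀ᶠ b in 𝓝 b₀, G (b, p b) = 0 := by
    filter_upwards [hGat.eventually_apply_implicitFunction one_ne_zero hinv] with b hb
    rw [hb, hG₀]
  have hpc : ContinuousAt p b₀ := hp1.continuousAt
  have hdn : ∀ᶠ b in 𝓝 b₀, fderiv ℝ H (p b) n ≠ 0 := by
    have h1 : ContinuousAt (fun b => fderiv ℝ H (p b) n) b₀ :=
      (hdH.continuous.continuousAt.comp hpc).clm_apply continuousAt_const
    exact h1.eventually_ne (by simp [hp0, hn])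
  have hpHS : ∀ᶠ b in 𝓝 b₀, H (p b) = 0 ∧ S (b, p b) = 0 := by
    -- Applying dH to G = 0 removes S and leaves H(p) dH(n) = 0 with dH(n) ≠ 0: zeros of G near x₀
    -- lie on the surface and are equilibria of S.
    filter_upwards [hpG, hdn] with b hb hbn
    have h1 := congrArg (fderiv ℝ H (p b)) hb
    simp only [G, map_add, map_smul, hHS, map_zero, zero_add, smul_eq_mul] at h1
    have h2 : H (p b) = 0 := (mul_eq_zero.1 h1).resolve_right hbn
    refine ⟨h2, ?_⟩
    simpa [G, h2] using hb
  obtain ⟨R, hR, hRexp⟩ := exists_uniformly_expanding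
    (hGat.hasStrictFDerivAt one_ne_zero) P hc hexp'
  have hnear : ∀ r > 0, ∀ᶠ b in 𝓝 b₀, ‖P (p b - x₀)‖ < r := by
    intro r hr
    have h1 : ContinuousAt (fun b => ‖P (p b - x₀)‖) b₀ :=
      (P.continuous.continuousAt.comp (hpc.sub continuousAt_const)).norm
    exact h1.eventually_lt continuousAt_const (by simpa [hp0] using hr)
  refine ⟨p, hp1, hp0, ?_, ?_, ?_⟩
  · obtain ⟨-, lam, him, hre, u, v, hu, hv, huv, hAu, hAv⟩ := id hf
    have hev := eventually_exists_focus finrank_E3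
      (fderiv_apply_fderiv_eq_zero hH (hHS b₀) (hdiff b₀ x₀) hf.1) hd hre him hu hv huv hAu hAv
    have hcont : ContinuousAt (fun b => ((fderiv ℝ (fun y => S (b, y)) (p b) : E3 →L[ℝ] E3),
        fderiv ℝ H (p b))) b₀ := by
      have h1 : ContinuousAt (fun b => fderiv ℝ S (b, p b) ∘L .inr ℝ B E3) b₀ :=
        ((hS.continuous_fderiv one_ne_zero).continuousAt.comp
          (continuousAt_id.prodMk hpc)).clm_comp continuousAt_const
      have h2 : (fun b => fderiv ℝ (fun y => S (b, y)) (p b)) =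
          fun b => fderiv ℝ S (b, p b) ∘L .inr ℝ B E3 := funext fun b => fderiv_slice hS b _
      refine ContinuousAt.prodMk ?_ (hdH.continuous.continuousAt.comp hpc)
      rw [h2]; exact h1
    have hev' := hcont.eventually (by simpa only [hp0] using hev)
    filter_upwards [hpHS, hev'] with b hb hb'
    refine ⟨hb.1, hb.2, ?_⟩
    obtain ⟨mu, h1, h2, h3⟩ :=
      hb' (fderiv_apply_fderiv_eq_zero hH (hHS b) (hdiff b (p b)) hb.2)
    exact ⟨mu, h1, h2, h3⟩
  · refine ⟨{x | ‖P (x - x₀)‖ < R}, ?_, ?_⟩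
    · have h1 : ContinuousAt (fun x => ‖P (x - x₀)‖) x₀ := by fun_prop
      exact h1.eventually_lt continuousAt_const (by simpa using hR)
    · filter_upwards [hRexp, hnear R hR, hpHS] with b hb hbR hbS x hx hHx hSx
      have h1 := hb x (p b) hx hbR
      simp only [G, hSx, hHx, hbS.1, hbS.2, zero_smul, add_zero, sub_zero, map_zero,
        inner_zero_left] at h1
      have : ‖P (x - p b)‖ ^ 2 = 0 :=
        le_antisymm (by nlinarith [sq_nonneg ‖P (x - p b)‖]) (by positivity)
      have h3 : ‖P (x - p b)‖ = 0 := pow_eq_zero_iff two_ne_zero |>.1 this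
      have h4 : x - p b = 0 := P.map_eq_zero_iff.1 (norm_eq_zero.1 h3)
      exact sub_eq_zero.1 h4
  · intro O hO
    have hcont : ContinuousAt (fun w => P.symm w + x₀) 0 := by fun_prop
    have hO' : O ∈ 𝓝 (P.symm 0 + x₀) := by simpa using hO
    obtain ⟨r, hr, hrO⟩ := Metric.mem_nhds_iff.1 (hcont.preimage_mem_nhds hO')
    set R' := min R r
    have hR' : 0 < R' := lt_min hR hr
    have hmem : ∀ x, ‖P (x - x₀)‖ < R' → x ∈ O := by
      intro x hx
      have h1 : P (x - x₀) ∈ Metric.ball 0 r := by simpa using hx.trans_le (min_le_right _ _)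
      simpa using hrO h1
    refine ⟨{x | ‖P (x - x₀)‖ < R' / 4}, ?_, ?_⟩
    · have h1 : ContinuousAt (fun x => ‖P (x - x₀)‖) x₀ := by fun_prop
      exact h1.eventually_lt continuousAt_const (by simpa using hR')
    · filter_upwards [hRexp, hnear (R' / 4) (by positivity), hpHS] with b hb hbR hbS σ s₀ hσ hHσ h0
      have hlev : ∀ s, H (σ s) = 0 := fun s =>
        (level_constant hH (hHS b) hσ s s₀).trans hHσ
      obtain ⟨h1, h2⟩ := backward_trapping (V := fun x => S (b, x)) P hc hR' hbR hσ
        (fun s _ hs => by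
        have h3 := hb (σ s) (p b) (hs.trans_le (min_le_left _ _))
          (hbR.trans_le ((by linarith : R' / 4 ≤ R').trans (min_le_left _ _)))
        simpa [G, hlev, hbS.1, hbS.2] using h3) h0
      exact ⟨fun s hs => hmem _ (h1 s hs), h2⟩

end FocusContinuation

/-! ### Compactness tools and the regularized reciprocal -/

section Families

theorem IsCompact.eventually_forall_mem {B Y T : Type*} [TopologicalSpace B] [TopologicalSpace Y]
    [TopologicalSpace T] {I : Set T} (hI : IsCompact I) {φ : B × T → Y} {b₀ : B}
    (hφ : ∀ t ∈ I, ContinuousAt φ (b₀, t)) {O : Set Y} (hO : ∀ t ∈ I, O ∈ 𝓝 (φ (b₀, t))) :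
    ∀ᶠ b in 𝓝 b₀, ∀ t ∈ I, φ (b, t) ∈ O := by
  refine hI.eventually_forall_of_forall_eventually fun t ht => ?_
  exact hφ t ht (hO t ht)

theorem IsCompact.exists_bound_of_eq_zero {B E F : Type*} [TopologicalSpace B]
    [TopologicalSpace E] [NormedAddCommGroup F] {φ : B × E → F} (hφ : Continuous φ) {K : Set E}
    (hK : IsCompact K) (hφK : ∀ p x, x ∉ K → φ (p, x) = 0) (p : B) :
    ∃ C, ∀ x, ‖φ (p, x)‖ ≤ C := by
  obtain ⟨C, hC⟩ := hK.exists_bound_of_continuousOn (f := fun x => φ (p, x))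
    (hφ.comp (Continuous.prodMk_right p)).continuousOn
  refine ⟨max C 0, fun x => ?_⟩
  by_cases hx : x ∈ K
  · exact (hC x hx).trans (le_max_left _ _)
  · rw [hφK p x hx, norm_zero]; exact le_max_right _ _

theorem IsCompact.eventually_norm_sub_le {B E F : Type*} [TopologicalSpace B]
    [TopologicalSpace E] [NormedAddCommGroup F] {φ : B × E → F} (hφ : Continuous φ) {K : Set E}
    (hK : IsCompact K) (hφK : ∀ p x, x ∉ K → φ (p, x) = 0) (p₀ : B) {ε : ℝ} (hε : 0 < ε) :
    ∀ᶠ p in 𝓝 p₀, ∀ x, ‖φ (p, x) - φ (p₀, x)‖ ≤ ε := by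
  have hc : Continuous fun z : B × E => φ z - φ (p₀, z.2) :=
    hφ.sub (hφ.comp (continuous_const.prodMk continuous_snd))
  have := IsCompact.eventually_forall_mem hK (b₀ := p₀) (fun t _ => hc.continuousAt)
    (O := Metric.closedBall 0 ε)
    (fun t _ => by simpa using Metric.closedBall_mem_nhds (0 : F) hε)
  filter_upwards [this] with p hp x
  by_cases hx : x ∈ K
  · simpa using hp x hx
  · rw [hφK _ x hx, hφK _ x hx]; simpa using hε.le

/-- A `C¹` family of fields with a common compact support is a continuous family of bounded `C¹`
fields. -/
theorem exists_continuous_family {B E : Type*} [NormedAddCommGroup B] [NormedSpace ℝ B]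
    [NormedAddCommGroup E] [NormedSpace ℝ E] {f : B × E → E} (hf : ContDiff ℝ 1 f) {K : Set E}
    (hK : IsCompact K) (hfK : ∀ p x, x ∉ K → f (p, x) = 0) :
    ∃ S : B → BddC1 E, Continuous S ∧ ∀ p x, (S p).fld x = f (p, x) := by
  let d : B × E → E →L[ℝ] E := fun z => fderiv ℝ f z ∘L .inr ℝ B E
  have hd : Continuous d := (hf.continuous_fderiv one_ne_zero).clm_comp continuous_const
  have hder : ∀ p x, HasFDerivAt (fun y => f (p, y)) (d (p, x)) x := fun p x =>
    HasFDerivAt.comp (g := f) x (hf.differentiable one_ne_zero (p, x)).hasFDerivAt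
      (hasFDerivAt_prodMk_right p x)
  have hdK : ∀ p x, x ∉ K → d (p, x) = 0 := by
    intro p x hx
    have h1 : (fun y => f (p, y)) =ᶠ[𝓝 x] fun _ => 0 := by
      filter_upwards [hK.isClosed.isOpen_compl.mem_nhds hx] with y hy using hfK p y hy
    exact (hder p x).unique ((hasFDerivAt_const (0 : E) x).congr_of_eventuallyEq h1)
  have hS : ∀ p, ∃ c : BddC1 E, (∀ x, c.fld x = f (p, x)) ∧ ∀ x, c.der x = d (p, x) := by
    intro p
    obtain ⟨C₁, hC₁⟩ := IsCompact.exists_bound_of_eq_zero hf.continuous hK hfK p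
    obtain ⟨C₂, hC₂⟩ := IsCompact.exists_bound_of_eq_zero hd hK hdK p
    exact ⟨⟨(ofNormedAddCommGroup (fun x => f (p, x))
      (hf.continuous.comp (Continuous.prodMk_right p)) C₁ hC₁,
      ofNormedAddCommGroup (fun x => d (p, x)) (hd.comp (Continuous.prodMk_right p)) C₂ hC₂),
      hder p⟩, fun _ => rfl, fun _ => rfl⟩
  choose S hSf hSd using hS
  refine ⟨S, ?_, hSf⟩
  rw [Metric.continuous_iff']
  intro p₀ ε hε
  filter_upwards [IsCompact.eventually_norm_sub_le hf.continuous hK hfK p₀ (half_pos hε),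
    IsCompact.eventually_norm_sub_le hd hK hdK p₀ (half_pos hε)] with p h1 h2
  rw [dist_eq_norm]
  refine (BddC1.norm_le_of (half_pos hε).le (fun x => ?_) fun x => ?_).trans_lt (half_lt_self hε)
  · rw [BddC1.fld_sub, hSf, hSf]; exact h1 x
  · rw [BddC1.der_sub, hSd, hSd]; exact h2 x

/-- The transition factor vanishes for s ≤ c/2 and is 1 for s ≥ c. With ρ in place of the
reciprocal, the sliding field is defined and C¹ on the whole space. -/
theorem exists_contDiff_eq_inv {c : ℝ} (hc : 0 < c) :
    ∃ ρ : ℝ → ℝ, ContDiff ℝ 1 ρ ∧ ∀ s, c ≤ s → ρ s = s⁻¹ := by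
  refine ⟨fun s => Real.smoothTransition (2 * s / c - 1) * s⁻¹, ?_, fun s hs => ?_⟩
  · rw [contDiff_iff_contDiffAt]
    intro s
    by_cases h0 : s = 0
    · have : (fun s => Real.smoothTransition (2 * s / c - 1) * s⁻¹) =ᶠ[𝓝 s] fun _ => 0 := by
        have : ∀ᶠ t in 𝓝 s, t < c / 2 := eventually_lt_nhds (by rw [h0]; positivity)
        filter_upwards [this] with t ht
        rw [Real.smoothTransition.zero_of_nonpos, zero_mul]
        rw [sub_nonpos, div_le_one hc]
        linarith
      exact contDiffAt_const.congr_of_eventuallyEq this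
    · refine ContDiffAt.mul ?_ (contDiffAt_id.inv h0)
      exact (Real.smoothTransition.contDiff (n := 1)).contDiffAt.comp s (by fun_prop)
  · simp only
    rw [Real.smoothTransition.one_of_one_le, one_mul]
    rw [le_sub_iff_add_le, le_div_iff₀ hc]
    linarith

end Families

/-! ### The regularized sliding field as a family of complete fields -/

section SlidingFamily

/-- The sliding field with the inverse of the denominator replaced by the function `ρ`, as a
function of the pair of fields and of the point. -/
def slide (ρ : ℝ → ℝ) (H : E3 → ℝ) (z : (BddC1 E3 × BddC1 E3) × E3) : E3 :=
  ρ (lieD z.1.2.fld H z.2 - lieD z.1.1.fld H z.2) •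
    (lieD z.1.2.fld H z.2 • z.1.1.fld z.2 - lieD z.1.1.fld H z.2 • z.1.2.fld z.2)

variable {H : E3 → ℝ}

theorem contDiff_lieD (hH : ContDiff ℝ 2 H) :
    ContDiff ℝ 1 fun z : BddC1 E3 × E3 => lieD z.1.fld H z.2 := by
  have hdH : ContDiff ℝ 1 (fderiv ℝ H) := hH.fderiv_right (by norm_num)
  exact (hdH.comp contDiff_snd).clm_apply BddC1.contDiff_eval

theorem contDiff_lieD_fst (hH : ContDiff ℝ 2 H) :
    ContDiff ℝ 1 fun z : (BddC1 E3 × BddC1 E3) × E3 => lieD z.1.1.fld H z.2 :=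
  (contDiff_lieD hH).comp ((contDiff_fst.comp contDiff_fst).prodMk contDiff_snd)

theorem contDiff_lieD_snd (hH : ContDiff ℝ 2 H) :
    ContDiff ℝ 1 fun z : (BddC1 E3 × BddC1 E3) × E3 => lieD z.1.2.fld H z.2 :=
  (contDiff_lieD hH).comp ((contDiff_snd.comp contDiff_fst).prodMk contDiff_snd)

theorem contDiff_slide (hH : ContDiff ℝ 2 H) {ρ : ℝ → ℝ} (hρ : ContDiff ℝ 1 ρ) :
    ContDiff ℝ 1 (slide ρ H) := by
  have hX : ContDiff ℝ 1 fun z : (BddC1 E3 × BddC1 E3) × E3 => z.1.1.fld z.2 :=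
    BddC1.contDiff_eval.comp ((contDiff_fst.comp contDiff_fst).prodMk contDiff_snd)
  have hY : ContDiff ℝ 1 fun z : (BddC1 E3 × BddC1 E3) × E3 => z.1.2.fld z.2 :=
    BddC1.contDiff_eval.comp ((contDiff_snd.comp contDiff_fst).prodMk contDiff_snd)
  exact (hρ.comp ((contDiff_lieD_snd hH).sub (contDiff_lieD_fst hH))).smul
    (((contDiff_lieD_snd hH).smul hX).sub ((contDiff_lieD_fst hH).smul hY))

/-- Tangency comes from the combination Yh X - Xh Y and survives any scalar factor, so the
regularized field preserves every level of H, even where ρ is not the reciprocal. -/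
theorem fderiv_slide (ρ : ℝ → ℝ) (b : BddC1 E3 × BddC1 E3) (x : E3) :
    fderiv ℝ H x (slide ρ H (b, x)) = 0 := by
  simp only [slide, map_smul, map_sub, lieD, smul_eq_mul]
  ring

theorem slide_eq_slidingField {ρ : ℝ → ℝ} {c : ℝ} (hρ : ∀ s, c ≤ s → ρ s = s⁻¹)
    {b : BddC1 E3 × BddC1 E3} {x : E3} (hx : c ≤ lieD b.2.fld H x - lieD b.1.fld H x) :
    slide ρ H (b, x) = slidingField H b.1.fld b.2.fld x := by
  simp only [slide, slidingField, hρ _ hx]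

/-- Outside the support of H both Lie derivatives vanish, and with them the sliding field; the
common compact support gives continuity of the family in the `BddC1` norm. -/
theorem exists_slide_family (hH : ContDiff ℝ 2 H) (hHc : HasCompactSupport H) {ρ : ℝ → ℝ}
    (hρ : ContDiff ℝ 1 ρ) :
    ∃ S : BddC1 E3 × BddC1 E3 → BddC1 E3, Continuous S ∧
      ∀ b x, (S b).fld x = slide ρ H (b, x) := by
  refine exists_continuous_family (contDiff_slide hH hρ) (K := tsupport H) hHc fun b x hx => ?_
  have h1 : fderiv ℝ H x = 0 := by
    have h2 := tsupport_fderiv_subset ℝ (f := H)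
    exact image_eq_zero_of_notMem_tsupport fun h => hx (h2 h)
  simp [slide, lieD, h1]

theorem eventually_lieD_close (hH : ContDiff ℝ 2 H) (hHc : HasCompactSupport H) (b₀ : BddC1 E3)
    {ε : ℝ} (hε : 0 < ε) : ∀ᶠ b in 𝓝 b₀, ∀ x, |lieD b.fld H x - lieD b₀.fld H x| < ε := by
  have hdH : Continuous (fderiv ℝ H) := hH.continuous_fderiv two_ne_zero
  obtain ⟨C, hC⟩ := (hHc.fderiv ℝ).exists_bound_of_continuous hdH
  have hC0 : 0 ≤ C := (norm_nonneg _).trans (hC 0)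
  have h1 : ∀ᶠ b in 𝓝 b₀, C * ‖b - b₀‖ < ε := by
    have hc : Continuous fun b => C * ‖b - b₀‖ := by fun_prop
    exact hc.continuousAt.eventually_lt continuousAt_const (by simpa using hε)
  filter_upwards [h1] with b hb x
  have h2 : lieD b.fld H x - lieD b₀.fld H x = fderiv ℝ H x ((b - b₀).fld x) := by
    simp [lieD]
  rw [h2, ← Real.norm_eq_abs]
  calc ‖fderiv ℝ H x ((b - b₀).fld x)‖ ≤ ‖fderiv ℝ H x‖ * ‖(b - b₀).fld x‖ :=
        ContinuousLinearMap.le_opNorm _ _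
    _ ≤ C * ‖b - b₀‖ := by
        gcongr
        · exact hC x
        · exact BddC1.norm_fld_le _ _
    _ < ε := hb

end SlidingFamily

/-! ### The turning time -/

section TurningTime

/-- The turning time of a family of functions `f (b, ·)` with derivative `-k (b, ·)`, near a
nondegenerate minimum `T₀` of `f (b₀, ·)`. -/
theorem exists_turning_time {B : Type*} [NormedAddCommGroup B] [NormedSpace ℝ B] [CompleteSpace B]
    {f k : B × ℝ → ℝ} {b₀ : B} {T₀ : ℝ} (hT₀ : 0 < T₀)
    (hf : ∀ b t, HasDerivAt (fun t => f (b, t)) (-k (b, t)) t)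
    (hfc : ∀ t, ContinuousAt f (b₀, t)) (hkc : ∀ t, ContinuousAt k (b₀, t))
    (hk : ContDiffAt ℝ 1 k (b₀, T₀)) (hkT : k (b₀, T₀) = 0)
    (hk' : fderiv ℝ k (b₀, T₀) (0, 1) < 0)
    (hf0 : ∀ᶠ b in 𝓝 b₀, f (b, 0) = 0) (hk0 : k (b₀, 0) < 0)
    (hpos : ∀ t ∈ Ioo 0 T₀, 0 < f (b₀, t)) {δ₁ : ℝ} (hδ₁ : 0 < δ₁) :
    ∃ τ : B → ℝ, ContDiffAt ℝ 1 τ b₀ ∧ τ b₀ = T₀ ∧ ∃ δ, 0 < δ ∧ δ ≤ δ₁ ∧ δ < T₀ ∧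
      ∀ᶠ b in 𝓝 b₀, k (b, τ b) = 0 ∧ 0 < τ b ∧
        (∀ t ∈ Icc (T₀ - δ) (T₀ + δ), k (b, t) = 0 → t = τ b) ∧
        (∀ t, 0 < t → t < T₀ - δ → 0 < f (b, t)) ∧
        (f (b, τ b) = 0 → ∀ t ∈ Ioo 0 (τ b), 0 < f (b, t)) := by
  have hinv : (fderiv ℝ k (b₀, T₀) ∘L .inr ℝ B ℝ).IsInvertible := by
    set m := fderiv ℝ k (b₀, T₀) (0, 1)
    refine ⟨ContinuousLinearEquiv.unitsEquivAut ℝ (Units.mk0 m hk'.ne), ?_⟩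
    ext
    simp [m]
  let τ := hk.implicitFunction one_ne_zero hinv
  have hτ1 : ContDiffAt ℝ 1 τ b₀ := hk.contDiffAt_implicitFunction one_ne_zero hinv
  have hτ0 : τ b₀ = T₀ := hk.implicitFunction_apply_self one_ne_zero hinv
  have hτk : ∀ᶠ b in 𝓝 b₀, k (b, τ b) = 0 := by
    filter_upwards [hk.eventually_apply_implicitFunction one_ne_zero hinv] with b hb
    rw [hb, hkT]
  have hev : ∀ᶠ z in 𝓝 (b₀, T₀), ContDiffAt ℝ 1 k z ∧ fderiv ℝ k z (0, 1) < 0 := by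
    refine (hk.eventually (by simp)).and ?_
    have hc : ContinuousAt (fun z => fderiv ℝ k z (0, 1)) (b₀, T₀) :=
      (hk.fderiv_right (m := 0) (by norm_num)).continuousAt.clm_apply continuousAt_const
    exact hc.eventually_lt continuousAt_const hk'
  rw [nhds_prod_eq] at hev
  obtain ⟨u, hu, v, hv, huv⟩ := Filter.mem_prod_iff.1 hev
  obtain ⟨r, hr, hrv⟩ := Metric.mem_nhds_iff.1 hv
  obtain ⟨δ, hδ0, hδr, hδ1, hδT⟩ : ∃ δ, 0 < δ ∧ δ < r ∧ δ ≤ δ₁ ∧ δ < T₀ := by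
    refine ⟨min (min (r / 2) δ₁) (T₀ / 2), by positivity, ?_, ?_, ?_⟩
    · exact ((min_le_left _ _).trans (min_le_left _ _)).trans_lt (by linarith)
    · exact (min_le_left _ _).trans (min_le_right _ _)
    · exact (min_le_right _ _).trans_lt (by linarith)
  have hanti : ∀ b ∈ u, StrictAntiOn (fun t => k (b, t)) (Icc (T₀ - δ) (T₀ + δ)) := by
    intro b hb
    have hd : ∀ t ∈ Icc (T₀ - δ) (T₀ + δ),
        HasDerivAt (fun t => k (b, t)) (fderiv ℝ k (b, t) (0, 1)) t ∧
          fderiv ℝ k (b, t) (0, 1) < 0 := by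
      intro t ht
      have htv : t ∈ v := hrv (by
        rw [Real.ball_eq_Ioo]; exact ⟨by linarith [ht.1], by linarith [ht.2]⟩)
      obtain ⟨h1, h2⟩ := huv (mk_mem_prod hb htv)
      refine ⟨?_, h2⟩
      exact HasFDerivAt.comp_hasDerivAt (l := k) t
        (h1.differentiableAt one_ne_zero).hasFDerivAt
        ((hasDerivAt_const t b).prodMk (hasDerivAt_id t))
    refine strictAntiOn_of_deriv_neg (convex_Icc _ _)
      (fun t ht => (hd t ht).1.continuousAt.continuousWithinAt) fun t ht => ?_
    rw [interior_Icc] at ht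
    rw [(hd t (Ioo_subset_Icc_self ht)).1.deriv]
    exact (hd t (Ioo_subset_Icc_self ht)).2
  have hτnear : ∀ᶠ b in 𝓝 b₀, τ b ∈ Ioo (T₀ - δ) (T₀ + δ) := by
    refine hτ1.continuousAt.eventually_mem ?_
    rw [hτ0]
    exact Ioo_mem_nhds (by linarith) (by linarith)
  -- Positivity of f needs three arguments: f starts at 0 and increases on [0, ε]; compactness
  -- handles [ε, T₀ - δ]; between T₀ - δ and τ the function k is positive, so f decreases to its
  -- value 0 at τ.
  obtain ⟨ε, hε, hεk⟩ : ∃ ε > 0, ∀ᶠ b in 𝓝 b₀, ∀ t ∈ Icc 0 ε, k (b, t) < 0 := by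
    have h1 : ∀ᶠ z in 𝓝 (b₀, (0 : ℝ)), k z < 0 := (hkc 0).eventually_lt continuousAt_const hk0
    rw [nhds_prod_eq] at h1
    obtain ⟨u', hu', v', hv', huv'⟩ := Filter.mem_prod_iff.1 h1
    obtain ⟨r', hr', hrv'⟩ := Metric.mem_nhds_iff.1 hv'
    refine ⟨r' / 2, by positivity, ?_⟩
    filter_upwards [hu'] with b hb t ht
    refine huv' (mk_mem_prod hb (hrv' ?_))
    rw [Real.ball_eq_Ioo]
    exact ⟨by linarith [ht.1], by linarith [ht.2]⟩
  have hmid : ∀ᶠ b in 𝓝 b₀, ∀ t ∈ Icc ε (T₀ - δ), f (b, t) ∈ Ioi (0 : ℝ) :=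
    IsCompact.eventually_forall_mem isCompact_Icc (fun t _ => hfc t) fun t ht =>
      Ioi_mem_nhds (hpos t ⟨hε.trans_le ht.1, by linarith [ht.2]⟩)
  refine ⟨τ, hτ1, hτ0, δ, hδ0, hδ1, hδT, ?_⟩
  filter_upwards [hτk, hu, hτnear, hεk, hmid, hf0] with b h1 hb h3 h4 h5 h6
  have hlow : ∀ t, 0 < t → t ≤ T₀ - δ → 0 < f (b, t) := by
    intro t ht0 ht
    rcases le_total t ε with h | h
    · have hmono : StrictMonoOn (fun t => f (b, t)) (Icc 0 ε) := by
        refine strictMonoOn_of_deriv_pos (convex_Icc _ _)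
          (fun t _ => (hf b t).continuousAt.continuousWithinAt) fun s hs => ?_
        rw [interior_Icc] at hs
        rw [(hf b s).deriv]
        linarith [h4 s (Ioo_subset_Icc_self hs)]
      have := hmono (left_mem_Icc.2 hε.le) ⟨ht0.le, h⟩ ht0
      simpa [h6] using this
    · exact h5 t ⟨h, ht⟩
  refine ⟨h1, by linarith [h3.1], ?_, fun t ht0 ht => hlow t ht0 ht.le, ?_⟩
  · intro t ht hkt
    exact (hanti b hb).injOn ht (Ioo_subset_Icc_self h3) (hkt.trans h1.symm)
  · intro hfτ t ht
    rcases le_total t (T₀ - δ) with h | h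
    · exact hlow t ht.1 h
    · have hmono : StrictAntiOn (fun t => f (b, t)) (Icc (T₀ - δ) (τ b)) := by
        refine strictAntiOn_of_deriv_neg (convex_Icc _ _)
          (fun t _ => (hf b t).continuousAt.continuousWithinAt) fun s hs => ?_
        rw [interior_Icc] at hs
        rw [(hf b s).deriv]
        have := hanti b hb ⟨hs.1.le, by linarith [hs.2, h3.2]⟩ (Ioo_subset_Icc_self h3) hs.2
        simp only [h1] at this
        linarith
      have := hmono ⟨h, ht.2.le⟩ (right_mem_Icc.2 h3.1.le) ht.2
      simpa [hfτ] using this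

end TurningTime

/-- After the reparametrization s ↦ -|s| the arc is a continuous map on all of ℝ with a limit along
`cocompact ℝ`, and its range together with the limit is compact. -/
theorem isCompact_insert_image_Iic {E : Type*} [TopologicalSpace E] {c : ℝ → E}
    {p : E} (hc : ContinuousOn c (Iic 0)) (hlim : Tendsto c atBot (𝓝 p)) :
    IsCompact ({p} ∪ c '' Iic 0) := by
  have hneg : ∀ s : ℝ, -|s| ∈ Iic (0 : ℝ) := fun s => by simp
  have h1 : Continuous fun s : ℝ => c (-|s|) :=
    hc.comp_continuous (by fun_prop) hneg
  have h2 : Tendsto (fun s : ℝ => c (-|s|)) (cocompact ℝ) (𝓝 p) := by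
    refine hlim.comp (tendsto_neg_atTop_atBot.comp ?_)
    exact tendsto_norm_cocompact_atTop (E := ℝ)
  have h3 := h2.isCompact_insert_range_of_cocompact h1
  convert h3 using 1
  ext x
  simp only [mem_union, mem_singleton_iff, mem_image, mem_insert_iff, mem_range]
  refine or_congr Iff.rfl ⟨?_, ?_⟩
  · rintro ⟨s, hs, rfl⟩
    exact ⟨s, by rw [abs_of_nonpos hs, neg_neg]⟩
  · rintro ⟨s, rfl⟩
    exact ⟨_, hneg s, rfl⟩

/-! ### Persistence of the sliding arc and transversality -/

section Arcs

variable {H : E3 → ℝ}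

/-- H is only C², so Xh is C¹ and X²h merely continuous. This joint continuity in field and point is
what keeps folds visible under perturbation. -/
theorem continuous_fderiv_lieD (hH : ContDiff ℝ 2 H) :
    Continuous fun z : (BddC1 E3 × BddC1 E3) × E3 => fderiv ℝ (lieD z.1.1.fld H) z.2 := by
  have h1 : (fun z : (BddC1 E3 × BddC1 E3) × E3 => fderiv ℝ (lieD z.1.1.fld H) z.2) =
      fun z => fderiv ℝ (fun z : (BddC1 E3 × BddC1 E3) × E3 => lieD z.1.1.fld H z.2) z ∘L
        .inr ℝ _ _ := by
    funext z
    exact (fderiv_comp_inr_eq ((contDiff_lieD_fst hH).differentiable one_ne_zero z)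
      (((contDiff_lieD hH).comp (contDiff_prodMk_right z.1.1)).differentiable one_ne_zero
        z.2).hasFDerivAt).symm
  rw [h1]
  exact ((contDiff_lieD_fst hH).continuous_fderiv one_ne_zero).clm_comp continuous_const

theorem differentiable_lieD (hH : ContDiff ℝ 2 H) (X : BddC1 E3) :
    Differentiable ℝ (lieD X.fld H) :=
  ((contDiff_lieD hH).comp (contDiff_prodMk_right X)).differentiable one_ne_zero

/-- Persistence of the sliding arc of a sliding Shilnikov orbit. -/
theorem eventually_sliding_arc (hH : ContDiff ℝ 2 H) {ρ : ℝ → ℝ} (hρ : ContDiff ℝ 1 ρ)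
    {S : BddC1 E3 × BddC1 E3 → BddC1 E3} (hS : Continuous S)
    (hSf : ∀ b x, (S b).fld x = slide ρ H (b, x)) {b₀ : BddC1 E3 × BddC1 E3}
    {p₀ q₀ : E3} {p q : BddC1 E3 × BddC1 E3 → E3} (hq : ContinuousAt q b₀) (hq₀ : q b₀ = q₀)
    {O : Set E3} (hO : IsOpen O) (hp₀O : p₀ ∈ O) (hcO : ∀ s ≤ 0, (S b₀).flow s q₀ ∈ O)
    (hp₀ : lieD b₀.1.fld H p₀ < 0) (hneg : ∀ s < 0, lieD b₀.1.fld H ((S b₀).flow s q₀) < 0)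
    (hlim : Tendsto (fun s => (S b₀).flow s q₀) atBot (𝓝 p₀))
    (hfold : 0 < fderiv ℝ (lieD b₀.1.fld H) q₀ ((S b₀).fld q₀))
    (hattr : ∀ O ∈ 𝓝 p₀, ∃ O' ∈ 𝓝 p₀, ∀ᶠ b in 𝓝 b₀, ∀ (σ : ℝ → E3) (s₀ : ℝ),
        (∀ s, HasDerivAt σ (slide ρ H (b, σ s)) s) → H (σ s₀) = 0 → σ s₀ ∈ O' →
          (∀ s ≤ s₀, σ s ∈ O) ∧ Tendsto σ atBot (𝓝 (p b))) :
    ∀ᶠ b in 𝓝 b₀, H (q b) = 0 → lieD b.1.fld H (q b) = 0 →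
      (∀ s ≤ 0, (S b).flow s (q b) ∈ O) ∧ (∀ s < 0, lieD b.1.fld H ((S b).flow s (q b)) < 0) ∧
        Tendsto (fun s => (S b).flow s (q b)) atBot (𝓝 (p b)) := by
  have hL : Continuous fun z : (BddC1 E3 × BddC1 E3) × E3 => lieD z.1.1.fld H z.2 :=
    (contDiff_lieD_fst hH).continuous
  have hflow : ∀ s, ContinuousAt
      (fun z : (BddC1 E3 × BddC1 E3) × ℝ => (S z.1).flow z.2 (q z.1)) (b₀, s) := by
    intro s
    have h1 : ContinuousAt (fun z : (BddC1 E3 × BddC1 E3) × ℝ => (S z.1, z.2, q z.1)) (b₀, s) :=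
      (hS.comp continuous_fst).continuousAt.prodMk
        (continuousAt_snd.prodMk (hq.comp continuousAt_fst))
    exact BddC1.continuous_flow.continuousAt.comp h1
  have hLflow : ∀ s, ContinuousAt
      (fun z : (BddC1 E3 × BddC1 E3) × ℝ => lieD z.1.1.fld H ((S z.1).flow z.2 (q z.1)))
      (b₀, s) := fun s =>
    ContinuousAt.comp (g := fun z : (BddC1 E3 × BddC1 E3) × E3 => lieD z.1.1.fld H z.2)
      hL.continuousAt (continuousAt_fst.prodMk (hflow s))
  -- the region near the focus
  have hO3 : ∀ᶠ z in 𝓝 (b₀, p₀), lieD z.1.1.fld H z.2 < 0 ∧ z.2 ∈ O :=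
    (hL.continuousAt.eventually_lt continuousAt_const hp₀).and
      (continuousAt_snd.eventually_mem (hO.mem_nhds hp₀O))
  rw [nhds_prod_eq] at hO3
  obtain ⟨u, hu, v, hv, huv⟩ := Filter.mem_prod_iff.1 hO3
  obtain ⟨O', hO', hattr'⟩ := hattr v hv
  -- The sign of Xh is controlled up to time T₁ by trapping near the focus, on [T₁, -r/2] by
  -- compactness, and on [-r/2, 0) by monotonicity, since Xh vanishes at the endpoint s = 0.
  obtain ⟨T₁, hT₁, hT₁0⟩ : ∃ T₁ : ℝ, (S b₀).flow T₁ q₀ ∈ interior O' ∧ T₁ < 0 :=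
    ((hlim.eventually_mem (interior_mem_nhds.2 hO')).and (eventually_lt_atBot 0)).exists
  have hstart : ∀ᶠ b in 𝓝 b₀, (S b).flow T₁ (q b) ∈ O' := by
    have h1 : ContinuousAt (fun b => (S b).flow T₁ (q b)) b₀ :=
      ContinuousAt.comp (g := fun z : (BddC1 E3 × BddC1 E3) × ℝ => (S z.1).flow z.2 (q z.1))
        (f := fun b => (b, T₁)) (hflow T₁) (continuousAt_id.prodMk continuousAt_const)
    have h2 : O' ∈ 𝓝 ((S b₀).flow T₁ (q b₀)) := by
      rw [hq₀]; exact mem_interior_iff_mem_nhds.1 hT₁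
    exact h1.eventually_mem h2
  -- the arc near the fold
  have hm : ContinuousAt (fun z : (BddC1 E3 × BddC1 E3) × ℝ =>
      fderiv ℝ (lieD z.1.1.fld H) ((S z.1).flow z.2 (q z.1))
        (slide ρ H (z.1, (S z.1).flow z.2 (q z.1)))) (b₀, 0) := by
    have h1 : ContinuousAt (fun z : (BddC1 E3 × BddC1 E3) × ℝ =>
      (z.1, (S z.1).flow z.2 (q z.1))) (b₀, 0) := continuousAt_fst.prodMk (hflow 0)
    exact (ContinuousAt.comp (g := fun z : (BddC1 E3 × BddC1 E3) × E3 =>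
      fderiv ℝ (lieD z.1.1.fld H) z.2) (continuous_fderiv_lieD hH).continuousAt h1).clm_apply
      (ContinuousAt.comp (g := slide ρ H) (contDiff_slide hH hρ).continuous.continuousAt h1)
  have hfold' : ∀ᶠ z in 𝓝 (b₀, (0 : ℝ)), 0 < fderiv ℝ (lieD z.1.1.fld H)
      ((S z.1).flow z.2 (q z.1)) (slide ρ H (z.1, (S z.1).flow z.2 (q z.1))) := by
    refine continuousAt_const.eventually_lt hm ?_
    simpa [hq₀, hSf] using hfold
  rw [nhds_prod_eq] at hfold'
  obtain ⟨u', hu', v', hv', huv'⟩ := Filter.mem_prod_iff.1 hfold'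
  obtain ⟨r, hr, hrv⟩ := Metric.mem_nhds_iff.1 hv'
  have hmid : ∀ᶠ b in 𝓝 b₀, ∀ s ∈ Icc T₁ (-(r / 2)),
      lieD b.1.fld H ((S b).flow s (q b)) ∈ Iio (0 : ℝ) :=
    IsCompact.eventually_forall_mem isCompact_Icc (fun s _ => hLflow s) fun s hs => by
      refine Iio_mem_nhds ?_
      simp only [hq₀]
      exact hneg s (by linarith [hs.2])
  have hOmid : ∀ᶠ b in 𝓝 b₀, ∀ s ∈ Icc T₁ 0, (S b).flow s (q b) ∈ O :=
    IsCompact.eventually_forall_mem isCompact_Icc (fun s _ => hflow s) fun s hs => by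
      refine hO.mem_nhds ?_
      simp only [hq₀]
      exact hcO s hs.2
  filter_upwards [hu, hattr', hstart, hu', hmid, hOmid] with b hb hbattr hb0 hb' hbmid hbO hHq hXq
  have hder : ∀ s, HasDerivAt (fun s => (S b).flow s (q b))
      (slide ρ H (b, (S b).flow s (q b))) s := fun s => by
    rw [← hSf]; exact (S b).hasDerivAt_flow (q b) s
  have hlev : H ((S b).flow T₁ (q b)) = 0 := by
    have := level_constant hH (V := fun x => slide ρ H (b, x)) (fun x => fderiv_slide ρ b x)
      hder T₁ 0
    simpa [hHq] using this
  obtain ⟨h1, h2⟩ := hbattr (fun s => (S b).flow s (q b)) T₁ hder hlev hb0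
  refine ⟨fun s hs => ?_, fun s hs => ?_, h2⟩
  · rcases le_total s T₁ with h | h
    · exact (huv (mk_mem_prod hb (h1 s h))).2
    · exact hbO s ⟨h, hs⟩
  · rcases le_total s T₁ with h | h
    · exact (huv (mk_mem_prod hb (h1 s h))).1
    · rcases le_total s (-(r / 2)) with h' | h'
      · exact hbmid s ⟨h, h'⟩
      · have hd : ∀ s, HasDerivAt (fun s => lieD b.1.fld H ((S b).flow s (q b)))
            (fderiv ℝ (lieD b.1.fld H) ((S b).flow s (q b))
              (slide ρ H (b, (S b).flow s (q b)))) s := fun s =>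
          HasFDerivAt.comp_hasDerivAt (l := lieD b.1.fld H) s
            (differentiable_lieD hH b.1 _).hasFDerivAt (hder s)
        have hmono : StrictMonoOn (fun s => lieD b.1.fld H ((S b).flow s (q b)))
            (Icc (-(r / 2)) 0) := by
          refine strictMonoOn_of_deriv_pos (convex_Icc _ _)
            (fun t _ => (hd t).continuousAt.continuousWithinAt) fun t ht => ?_
          rw [interior_Icc] at ht
          rw [(hd t).deriv]
          refine huv' (mk_mem_prod hb' (hrv ?_))
          rw [Real.ball_eq_Ioo]
          exact ⟨by linarith [ht.1], by linarith [ht.2]⟩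
        have := hmono ⟨h', hs.le⟩ (right_mem_Icc.2 (by linarith)) hs
        simpa [hXq] using this

/-- The return map function is not stationary: its derivative in the direction of a suitable
constant perturbation of the second field does not vanish. -/
theorem exists_transversal_direction (hH : ContDiff ℝ 2 H) {ρ : ℝ → ℝ} (hρ : ContDiff ℝ 1 ρ)
    {b₀ : BddC1 E3 × BddC1 E3} {p₀ q₀ : E3} {T₀ : ℝ} (hpq : b₀.1.flow (-T₀) p₀ = q₀)
    (hXq : lieD b₀.1.fld H q₀ = 0) (hYq : lieD b₀.2.fld H q₀ ≠ 0) (hXp : lieD b₀.1.fld H p₀ < 0)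
    (hρp : 0 < ρ (lieD b₀.2.fld H p₀ - lieD b₀.1.fld H p₀))
    (hfocus : IsUnstableFocus H (fun x => slide ρ H (b₀, x)) p₀)
    {p : BddC1 E3 × BddC1 E3 → E3} (hp : DifferentiableAt ℝ p b₀) (hp₀ : p b₀ = p₀)
    (hpev : ∀ᶠ b in 𝓝 b₀, H (p b) = 0 ∧ slide ρ H (b, p b) = 0)
    {τ : BddC1 E3 × BddC1 E3 → ℝ} (hτ : DifferentiableAt ℝ τ b₀) (hτ₀ : τ b₀ = T₀) :
    ∃ w : E3, ∀ η : BddC1 E3, η.fld p₀ = w →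
      fderiv ℝ (fun b : BddC1 E3 × BddC1 E3 => H (b.1.flow (-τ b) (p b))) b₀ (0, η) ≠ 0 := by
  have hHd : ∀ x, HasFDerivAt H (fderiv ℝ H x) x := fun x =>
    (hH.differentiable two_ne_zero x).hasFDerivAt
  have hSl : ContDiff ℝ 1 (slide ρ H) := contDiff_slide hH hρ
  set F : BddC1 E3 × ℝ × E3 → E3 := fun z => z.1.flow z.2.1 z.2.2
  have hF : ∀ z, HasFDerivAt F (fderiv ℝ F z) z := fun z =>
    (BddC1.contDiff_flow.differentiable one_ne_zero z).hasFDerivAt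
  set DF := fderiv ℝ F (b₀.1, -T₀, p₀)
  -- the derivative of the flow in the initial point
  have hFslice : ∀ t x, HasFDerivAt (fun x => b₀.1.flow t x)
      (fderiv ℝ F (b₀.1, t, x) ∘L .inr ℝ (BddC1 E3) (ℝ × E3) ∘L .inr ℝ ℝ E3) x := by
    intro t x
    have h1 : HasFDerivAt (fun y : E3 => ((b₀.1, t, y) : BddC1 E3 × ℝ × E3))
        (.inr ℝ (BddC1 E3) (ℝ × E3) ∘L .inr ℝ ℝ E3) x :=
      HasFDerivAt.comp (g := fun z : ℝ × E3 => (b₀.1, z)) x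
        (hasFDerivAt_prodMk_right b₀.1 (t, x)) (hasFDerivAt_prodMk_right t x)
    exact HasFDerivAt.comp (g := F) x (hF (b₀.1, t, x)) h1
  have hFx := hFslice (-T₀) p₀
  have hFt : DF (0, 1, 0) = b₀.1.fld q₀ := by
    have h1 : HasDerivAt (fun t => b₀.1.flow t p₀) (DF (0, 1, 0)) (-T₀) :=
      HasFDerivAt.comp_hasDerivAt (l := F) (-T₀) (hF (b₀.1, -T₀, p₀))
        ((hasDerivAt_const _ b₀.1).prodMk ((hasDerivAt_id _).prodMk (hasDerivAt_const _ p₀)))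
    have h2 := b₀.1.hasDerivAt_flow p₀ (-T₀)
    rw [hpq] at h2
    exact h1.unique h2
  have hFX : DF (0, 0, b₀.1.fld p₀) = b₀.1.fld q₀ := by
    have h1 : HasDerivAt (fun s => b₀.1.flow s p₀) (b₀.1.fld p₀) 0 := by
      simpa using b₀.1.hasDerivAt_flow p₀ 0
    have h2 : HasFDerivAt (fun x => b₀.1.flow (-T₀) x)
      (DF ∘L .inr ℝ (BddC1 E3) (ℝ × E3) ∘L .inr ℝ ℝ E3) (b₀.1.flow 0 p₀) := by simpa using hFx
    have h3 := HasFDerivAt.comp_hasDerivAt (l := fun x => b₀.1.flow (-T₀) x)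
      (f := fun s => b₀.1.flow s p₀) (0 : ℝ) h2 h1
    have h4 : ((fun x => b₀.1.flow (-T₀) x) ∘ fun s => b₀.1.flow s p₀) =
        fun s => b₀.1.flow s q₀ := by
      funext s
      simp only [Function.comp]
      rw [← hpq, ← BddC1.flow_add, ← BddC1.flow_add, add_comm]
    rw [h4] at h3
    have h5 : HasDerivAt (fun s => b₀.1.flow s q₀) (b₀.1.fld q₀) 0 := by
      simpa using b₀.1.hasDerivAt_flow q₀ 0
    exact h3.unique h5
  have hsurj : ∀ v, ∃ d, DF (0, 0, d) = v := by
    intro v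
    have hqp : b₀.1.flow T₀ q₀ = p₀ := by rw [← hpq, BddC1.flow_flow_neg]
    have h1 := hFslice T₀ q₀
    have h2 : HasFDerivAt (fun x => b₀.1.flow (-T₀) x)
      (DF ∘L .inr ℝ (BddC1 E3) (ℝ × E3) ∘L .inr ℝ ℝ E3) (b₀.1.flow T₀ q₀) := by rwa [hqp]
    have h3 := h2.comp q₀ h1
    have h4 : ((fun x => b₀.1.flow (-T₀) x) ∘ fun x => b₀.1.flow T₀ x) = id := by
      funext x
      simp [BddC1.flow_neg_flow]
    rw [h4] at h3
    exact ⟨_, congrArg (fun L => L v) (h3.unique (hasFDerivAt_id q₀))⟩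
  -- a tangent direction along which the defect changes
  obtain ⟨d, hd, hdℓ⟩ : ∃ d, fderiv ℝ H p₀ d = 0 ∧ fderiv ℝ H q₀ (DF (0, 0, d)) ≠ 0 := by
    obtain ⟨d₁, hd₁⟩ := hsurj (b₀.2.fld q₀)
    -- d₁ is the preimage of Y(q₀), which is transverse at q₀. Subtracting a multiple of X(p₀),
    -- which is transverse at p₀, makes it tangent there; the flow carries X(p₀) to X(q₀), tangent
    -- at q₀, so the image under dH is unchanged.
    set r := fderiv ℝ H p₀ d₁ / lieD b₀.1.fld H p₀
    refine ⟨d₁ - r • b₀.1.fld p₀, ?_, ?_⟩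
    · rw [map_sub, map_smul, smul_eq_mul]
      change _ - r * lieD b₀.1.fld H p₀ = 0
      simp only [r]
      rw [div_mul_cancel₀ _ hXp.ne, sub_self]
    · have h1 : ((0, 0, d₁ - r • b₀.1.fld p₀) : BddC1 E3 × ℝ × E3) =
          (0, 0, d₁) - r • (0, 0, b₀.1.fld p₀) := by simp
      rw [h1, map_sub, map_smul, hd₁, hFX, map_sub, map_smul]
      change lieD b₀.2.fld H q₀ - r • lieD b₀.1.fld H q₀ ≠ 0
      rwa [hXq, smul_zero, sub_zero]
  set A := fderiv ℝ (fun x => slide ρ H (b₀, x)) p₀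
  have hAd : DifferentiableAt ℝ (fun x => slide ρ H (b₀, x)) p₀ :=
    (hSl.comp (contDiff_prodMk_right b₀)).differentiable one_ne_zero p₀
  have hdH : fderiv ℝ H p₀ ≠ 0 := by
    intro h
    rw [lieD, h] at hXp
    simp at hXp
  set r := ρ (lieD b₀.2.fld H p₀ - lieD b₀.1.fld H p₀)
  have hα : -(r * lieD b₀.1.fld H p₀) ≠ 0 := by
    have := mul_neg_of_pos_of_neg hρp hXp
    linarith
  set α := -(r * lieD b₀.1.fld H p₀)
  -- A perturbation η of Y tangent at p₀ fixes both Lie derivatives there and changes the sliding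
  -- field by α η(p₀). Differentiating the equilibrium equation gives α η(p₀) + A d' = 0 for the
  -- velocity d' of the focus; this choice of η(p₀) yields A d' = A d, hence d' = d by injectivity
  -- of A on tangent vectors.
  refine ⟨-(α⁻¹ • A d), fun η hη => ?_⟩
  have hw : fderiv ℝ H p₀ (η.fld p₀) = 0 := by
    rw [hη, map_neg, map_smul,
      fderiv_apply_fderiv_eq_zero hH (fun x => fderiv_slide ρ b₀ x) hAd hfocus.1]
    simp
  have hpd : HasFDerivAt p (fderiv ℝ p b₀) b₀ := hp.hasFDerivAt
  set d' := fderiv ℝ p b₀ (0, η)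
  have hd'1 : fderiv ℝ H p₀ d' = 0 := by
    have h0 : HasFDerivAt H (fderiv ℝ H p₀) (p b₀) := by rw [hp₀]; exact hHd p₀
    have h1 := h0.comp b₀ hpd
    have h2 : H ∘ p =ᶠ[𝓝 b₀] fun _ => 0 := hpev.mono fun b hb => hb.1
    exact congrArg (fun L => L (0, η))
      (h1.unique ((hasFDerivAt_const (0 : ℝ) b₀).congr_of_eventuallyEq h2))
  have hSd : HasFDerivAt (slide ρ H) (fderiv ℝ (slide ρ H) (b₀, p₀)) (b₀, p₀) :=
    (hSl.differentiable one_ne_zero _).hasFDerivAt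
  have hSη : fderiv ℝ (slide ρ H) (b₀, p₀) ((0, η), 0) = α • η.fld p₀ := by
    have hline : HasDerivAt (fun ε : ℝ => ((b₀ + ε • ((0, η) : BddC1 E3 × BddC1 E3)), p₀))
        (((0, η) : BddC1 E3 × BddC1 E3), (0 : E3)) 0 := by
      have h := ((hasDerivAt_id (0 : ℝ)).smul_const ((0, η) : BddC1 E3 × BddC1 E3)).const_add b₀
      rw [one_smul] at h
      exact h.prodMk (hasDerivAt_const _ p₀)
    have hSd' : HasFDerivAt (slide ρ H) (fderiv ℝ (slide ρ H) (b₀, p₀))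
        ((b₀ + (0 : ℝ) • ((0, η) : BddC1 E3 × BddC1 E3)), p₀) := by
      rw [zero_smul, add_zero]; exact hSd
    have h1 := HasFDerivAt.comp_hasDerivAt (l := slide ρ H) (0 : ℝ) hSd' hline
    have h2 : (slide ρ H ∘ fun ε : ℝ => ((b₀ + ε • ((0, η) : BddC1 E3 × BddC1 E3)), p₀)) =
        fun ε : ℝ => slide ρ H (b₀, p₀) + ε • (α • η.fld p₀) := by
      funext ε
      have e1 : lieD (b₀ + ε • ((0, η) : BddC1 E3 × BddC1 E3)).1.fld H p₀ =
          lieD b₀.1.fld H p₀ := by simp [lieD]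
      have e2 : lieD (b₀ + ε • ((0, η) : BddC1 E3 × BddC1 E3)).2.fld H p₀ =
          lieD b₀.2.fld H p₀ := by simp [lieD, hw]
      simp only [Function.comp, slide, e1, e2]
      have e3 : (b₀ + ε • ((0, η) : BddC1 E3 × BddC1 E3)).1.fld p₀ = b₀.1.fld p₀ := by simp
      have e4 : (b₀ + ε • ((0, η) : BddC1 E3 × BddC1 E3)).2.fld p₀ =
          b₀.2.fld p₀ + ε • η.fld p₀ := by simp
      rw [e3, e4]
      change r • _ = r • _ + _
      simp only [α]
      module
    rw [h2] at h1
    have h3 : HasDerivAt (fun ε : ℝ => slide ρ H (b₀, p₀) + ε • (α • η.fld p₀))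
        (α • η.fld p₀) 0 := by
      have h := ((hasDerivAt_id (0 : ℝ)).smul_const (α • η.fld p₀)).const_add
        (slide ρ H (b₀, p₀))
      rw [one_smul] at h
      exact h
    exact h1.unique h3
  have hd'2 : α • η.fld p₀ + A d' = 0 := by
    have h0 : HasFDerivAt (slide ρ H) (fderiv ℝ (slide ρ H) (b₀, p₀)) (b₀, p b₀) := by
      rw [hp₀]; exact hSd
    have h1 := HasFDerivAt.comp (g := slide ρ H) b₀ h0 ((hasFDerivAt_id b₀).prodMk hpd)
    have h2 : (slide ρ H ∘ fun b => (id b, p b)) =ᶠ[𝓝 b₀] fun _ => 0 :=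
      hpev.mono fun b hb => hb.2
    have h3 := congrArg (fun L => L (0, η))
      (h1.unique ((hasFDerivAt_const (0 : E3) b₀).congr_of_eventuallyEq h2))
    have h4 : fderiv ℝ (slide ρ H) (b₀, p₀) ((0, η), d') = 0 := h3
    have h5 : (((0, η), d') : (BddC1 E3 × BddC1 E3) × E3) = ((0, η), 0) + (0, d') := by simp
    rw [h5, map_add, hSη] at h4
    have h6 : A d' = fderiv ℝ (slide ρ H) (b₀, p₀) (0, d') := by
      simp only [A]
      rw [fderiv_slice hSl]
      rfl
    rw [h6]; exact h4
  have hdd' : d' = d := by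
    rw [hη, smul_neg, smul_inv_smul₀ hα] at hd'2
    have h1 : A (d' - d) = 0 := by
      rw [map_sub]
      rw [neg_add_eq_zero] at hd'2
      rw [hd'2, sub_self]
    have h2 := eq_zero_of_focus hH (fun x => fderiv_slide ρ b₀ x) hAd hdH hfocus
      (w := d' - d) (by rw [map_sub, hd'1, hd, sub_self]) h1
    exact sub_eq_zero.1 h2
  -- chain rule
  have hΨ : HasFDerivAt (fun b : BddC1 E3 × BddC1 E3 => b.1.flow (-τ b) (p b))
      (DF ∘L (ContinuousLinearMap.fst ℝ _ _).prod ((-fderiv ℝ τ b₀).prod (fderiv ℝ p b₀))) b₀ := by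
    have h0 : HasFDerivAt F DF (b₀.1, -τ b₀, p b₀) := by
      rw [hp₀, hτ₀]; exact hF _
    exact HasFDerivAt.comp (g := F) b₀ h0
      (hasFDerivAt_fst.prodMk (hτ.hasFDerivAt.neg.prodMk hpd))
  have hg : HasFDerivAt (fun b : BddC1 E3 × BddC1 E3 => H (b.1.flow (-τ b) (p b)))
      (fderiv ℝ H q₀ ∘L (DF ∘L (ContinuousLinearMap.fst ℝ _ _).prod
        ((-fderiv ℝ τ b₀).prod (fderiv ℝ p b₀)))) b₀ := by
    have h0 : HasFDerivAt H (fderiv ℝ H q₀) (b₀.1.flow (-τ b₀) (p b₀)) := by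
      rw [hp₀, hτ₀, hpq]; exact hHd q₀
    exact HasFDerivAt.comp (g := H) b₀ h0 hΨ
  -- The variation of τ enters multiplied by dH(X(q₀)) = Xh(q₀) = 0, so only the displacement d of
  -- the focus remains.
  rw [hg.fderiv]
  change fderiv ℝ H q₀ (DF (0, -(fderiv ℝ τ b₀ (0, η)), d')) ≠ 0
  have h5 : ((0, -(fderiv ℝ τ b₀ (0, η)), d') : BddC1 E3 × ℝ × E3) =
      (-(fderiv ℝ τ b₀ (0, η))) • (0, 1, 0) + (0, 0, d') := by simp
  rw [h5, map_add, map_smul, hFt, map_add, map_smul]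
  change (-(fderiv ℝ τ b₀ (0, η))) • lieD b₀.1.fld H q₀ + _ ≠ 0
  rw [hXq, smul_zero, zero_add, hdd']
  exact hdℓ

end Arcs

/-! ### Recognizing and assembling a sliding Shilnikov orbit -/

section Core

variable {H : E3 → ℝ}

theorem IsUnstableFocus.congr {V V' : E3 → E3} {p : E3} (h : IsUnstableFocus H V p)
    (hV : V =ᶠ[𝓝 p] V') : IsUnstableFocus H V' p := by
  obtain ⟨h0, lam, h1, h2, u, v, h3, h4, h5, h6, h7⟩ := h
  refine ⟨hV.eq_of_nhds ▸ h0, lam, h1, h2, u, v, h3, h4, h5, ?_, ?_⟩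
  · rw [← hV.fderiv_eq]; exact h6
  · rw [← hV.fderiv_eq]; exact h7

/-- Just before a visible fold the orbit lies on the side `H > 0`. -/
theorem exists_pos_before_fold (hH : ContDiff ℝ 2 H) {X : BddC1 E3} {q : E3} (hHq : H q = 0)
    (hXq : lieD X.fld H q = 0) (hXXq : 0 < lieD X.fld (lieD X.fld H) q) :
    ∃ δ > 0, ∀ s ∈ Ico (-δ) 0, 0 < H (X.flow s q) := by
  have hd2 : ∀ s, HasDerivAt (fun s => lieD X.fld H (X.flow s q))
      (lieD X.fld (lieD X.fld H) (X.flow s q)) s := fun s =>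
    HasFDerivAt.comp_hasDerivAt (l := lieD X.fld H) s
      (differentiable_lieD hH X _).hasFDerivAt (X.hasDerivAt_flow q s)
  have hd1 : ∀ s, HasDerivAt (fun s => H (X.flow s q)) (lieD X.fld H (X.flow s q)) s := fun s =>
    HasFDerivAt.comp_hasDerivAt (l := H) s
      (hH.differentiable two_ne_zero _).hasFDerivAt (X.hasDerivAt_flow q s)
  have hc : Continuous (lieD X.fld (lieD X.fld H)) :=
    ((continuous_fderiv_lieD hH).comp (Continuous.prodMk_right (X, X))).clm_apply X.continuous_fld
  have hev : ∀ᶠ s in 𝓝 (0 : ℝ), 0 < lieD X.fld (lieD X.fld H) (X.flow s q) := by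
    refine continuousAt_const.eventually_lt
      (hc.comp (X.continuous_flow_time q)).continuousAt ?_
    simpa using hXXq
  obtain ⟨r, hr, hrv⟩ := Metric.mem_nhds_iff.1 hev
  refine ⟨r / 2, half_pos hr, fun s hs => ?_⟩
  have hmono : StrictMonoOn (fun s => lieD X.fld H (X.flow s q)) (Icc (-(r / 2)) 0) := by
    refine strictMonoOn_of_deriv_pos (convex_Icc _ _)
      (fun t _ => (hd2 t).continuousAt.continuousWithinAt) fun t ht => ?_
    rw [interior_Icc] at ht
    rw [(hd2 t).deriv]
    refine hrv ?_
    rw [Real.ball_eq_Ioo]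
    exact ⟨by linarith [ht.1], by linarith [ht.2]⟩
  have hanti : StrictAntiOn (fun s => H (X.flow s q)) (Icc (-(r / 2)) 0) := by
    refine strictAntiOn_of_deriv_neg (convex_Icc _ _)
      (fun t _ => (hd1 t).continuousAt.continuousWithinAt) fun t ht => ?_
    rw [interior_Icc] at ht
    rw [(hd1 t).deriv]
    have := hmono (Ioo_subset_Icc_self ht) (right_mem_Icc.2 (by linarith)) ht.2
    simpa [hXq] using this
  have := hanti ⟨hs.1, hs.2.le⟩ (right_mem_Icc.2 (by linarith)) hs.2
  simpa [hHq] using this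

/-- A sliding Shilnikov orbit through a given focus determines the turning time of the backward
orbit of the focus. -/
theorem return_eq_zero_of_orbit {X : BddC1 E3} {p q : E3} {t' T₀ δ τ : ℝ} {x : ℝ → E3}
    (ht' : 0 < t') (hx0 : x 0 = q) (hxt : x t' = p) (hx : IsTrajectory X.fld x (Icc 0 t'))
    (hHq : H q = 0) (hXq : lieD X.fld H q = 0) (hδ : 0 < T₀ + δ)
    (hout : ∀ t ∈ Icc 0 t', x t ≠ X.flow (-(T₀ + δ)) p)
    (huniq : ∀ t ∈ Icc (T₀ - δ) (T₀ + δ), lieD X.fld H (X.flow (-t) p) = 0 → t = τ)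
    (hpos : ∀ t, 0 < t → t < T₀ - δ → 0 < H (X.flow (-t) p)) :
    H (X.flow (-τ) p) = 0 := by
  have hflow := BddC1.flow_eq_of_Icc hx
  rw [hx0] at hflow
  have hp : p = X.flow t' q := by rw [← hxt]; exact hflow t' (right_mem_Icc.2 ht'.le)
  have hq : X.flow (-t') p = q := by rw [hp, BddC1.flow_neg_flow]
  -- A flight time above T₀ + δ would make the orbit pass through the excluded point, and one below
  -- T₀ - δ would put q where H > 0. In the remaining window Xh(q) = 0 identifies t' with τ.
  rcases lt_or_ge (T₀ + δ) t' with h | h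
  · refine absurd ?_ (hout (t' - (T₀ + δ)) ⟨by linarith, by linarith⟩)
    rw [hflow _ ⟨by linarith, by linarith⟩, hp, ← BddC1.flow_add]
    congr 1
    ring
  · rcases lt_or_ge t' (T₀ - δ) with h' | h'
    · have := hpos t' ht' h'
      rw [hq, hHq] at this
      exact absurd this (lt_irrefl _)
    · have := huniq t' ⟨h', h⟩ (by rw [hq, hXq])
      rw [← this, hq, hHq]

/-- Construction of a sliding Shilnikov orbit from its two arcs. -/
theorem isShilnikovSliding_of_arcs (hH : ContDiff ℝ 2 H) {ρ : ℝ → ℝ} {c : ℝ}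
    (hc : 0 < c) (hρ : ∀ s, c ≤ s → ρ s = s⁻¹) {b : BddC1 E3 × BddC1 E3} {S : BddC1 E3}
    (hS : ∀ x, S.fld x = slide ρ H (b, x)) {p : E3} {τ : ℝ} (hτ : 0 < τ)
    (hHp : H p = 0) (hXp : lieD b.1.fld H p < 0) (hYp : 0 < lieD b.2.fld H p)
    (hcp : c < lieD b.2.fld H p - lieD b.1.fld H p)
    (hfoc : IsUnstableFocus H (fun x => slide ρ H (b, x)) p) {q : E3}
    (hq : b.1.flow (-τ) p = q) (hHq : H q = 0) (hXq : lieD b.1.fld H q = 0)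
    (hXXq : 0 < lieD b.1.fld (lieD b.1.fld H) q)
    (hneg : ∀ s < 0, lieD b.1.fld H (S.flow s q) < 0)
    (hY : ∀ s ≤ 0, 0 < lieD b.2.fld H (S.flow s q))
    (hYX : ∀ s ≤ 0, c ≤ lieD b.2.fld H (S.flow s q) - lieD b.1.fld H (S.flow s q))
    (hlim : Tendsto (fun s => S.flow s q) atBot (𝓝 p))
    (hpos : ∀ t ∈ Ioo 0 τ, 0 < H (b.1.flow (-t) p)) :
    IsShilnikovSliding ⊤ H b.1.fld b.2.fld
      ({p} ∪ (fun s => S.flow s q) '' Iic 0 ∪ (fun t => b.1.flow t q) '' Icc 0 τ) := by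
  have hder : ∀ s, HasDerivAt (fun s => S.flow s q) (slide ρ H (b, S.flow s q)) s := fun s => by
    rw [← hS]; exact S.hasDerivAt_flow q s
  have hlev : ∀ s, H (S.flow s q) = 0 := by
    intro s
    have := level_constant hH (V := fun x => slide ρ H (b, x)) (fun x => fderiv_slide ρ b x)
      hder s 0
    simpa [hHq] using this
  have hreg : ∀ s < 0, S.flow s q ∈ slidingRegion ⊤ H b.1.fld b.2.fld := fun s hs =>
    ⟨trivial, hlev s, hneg s hs, hY s hs.le⟩
  have hp : b.1.flow τ q = p := by rw [← hq, BddC1.flow_flow_neg]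
  have hq0 : S.flow 0 q = q := S.flow_zero q
  have hYq := hYX 0 le_rfl
  rw [hq0] at hYq
  refine ⟨p, q, τ, fun s => S.flow s q, fun t => b.1.flow t q, ⟨trivial, hHp, hXp, hYp⟩, ?_,
    ⟨?_, ?_⟩, ⟨trivial, hHq, hXq, hXXq, (hc.trans_le hYq).ne'⟩, ⟨hq0, ?_, hreg, hlim⟩,
    ⟨hτ, b.1.flow_zero q, hp, fun t _ => (b.1.hasDerivAt_flow q t).hasDerivWithinAt, ?_⟩, rfl⟩
  · refine hfoc.congr ?_
    have hcont : Continuous fun x => lieD b.2.fld H x - lieD b.1.fld H x :=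
      (differentiable_lieD hH b.2).continuous.sub (differentiable_lieD hH b.1).continuous
    filter_upwards [continuousAt_const.eventually_lt hcont.continuousAt hcp] with x hx
    exact slide_eq_slidingField hρ hx.le
  · have h1 : Tendsto (fun s => S.flow s q) (𝓝[<] 0) (𝓝 q) := by
      have h2 := (S.continuous_flow_time q).tendsto 0
      rw [hq0] at h2
      exact h2.mono_left nhdsWithin_le_nhds
    exact mem_closure_of_tendsto h1 (eventually_mem_nhdsWithin.mono fun s hs => hreg s hs)
  · rintro ⟨-, -, h, -⟩
    exact absurd hXq h.ne
  · intro s hs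
    have := (hder s).hasDerivWithinAt (s := Iic 0)
    rwa [slide_eq_slidingField hρ (hYX s hs)] at this
  · intro t ht
    refine ⟨trivial, ?_⟩
    have := hpos (τ - t) ⟨by linarith [ht.2], by linarith [ht.1]⟩
    rw [← hp, ← BddC1.flow_add] at this
    simpa using this

end Core

/-! ### Normal form of an orbit as two arcs of complete flows -/

section Arcs

variable {H : E3 → ℝ}

/-- The two arcs of a sliding Shilnikov orbit, described by complete flows: `S` is a vector field
on the whole space which agrees with the sliding field near the sliding arc. -/
structure ShilnikovArcs (H : E3 → ℝ) (ρ : ℝ → ℝ) (c : ℝ) (b : BddC1 E3 × BddC1 E3)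
    (S : BddC1 E3) (p q : E3) (T : ℝ) : Prop where
  pos : 0 < c
  inv : ∀ s, c ≤ s → ρ s = s⁻¹
  fld_eq : ∀ x, S.fld x = slide ρ H (b, x)
  time_pos : 0 < T
  flow_eq : b.1.flow T q = p
  level_p : H p = 0
  level_q : H q = 0
  lieX_p : lieD b.1.fld H p < 0
  lieX_q : lieD b.1.fld H q = 0
  fold : 0 < lieD b.1.fld (lieD b.1.fld H) q
  focus : IsUnstableFocus H (fun x => slide ρ H (b, x)) p
  lieX_neg : ∀ s < 0, lieD b.1.fld H (S.flow s q) < 0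
  tendsto : Tendsto (fun s => S.flow s q) atBot (𝓝 p)
  lie_gt : ∀ z ∈ {p} ∪ (fun s => S.flow s q) '' Iic 0,
    c < lieD b.2.fld H z ∧ 2 * c < lieD b.2.fld H z - lieD b.1.fld H z
  level_pos : ∀ t ∈ Ioo 0 T, 0 < H (b.1.flow t q)

theorem continuous_lieD (hH : ContDiff ℝ 2 H) (X : BddC1 E3) : Continuous (lieD X.fld H) :=
  (contDiff_lieD hH).continuous.comp (Continuous.prodMk_right X)

/-- Every sliding Shilnikov orbit consists of two arcs of complete flows. -/
theorem exists_shilnikovArcs (hH : ContDiff ℝ 2 H) (hHc : HasCompactSupport H)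
    {b : BddC1 E3 × BddC1 E3} {Γ : Set E3} (hΓ : IsShilnikovSliding ⊤ H b.1.fld b.2.fld Γ) :
    ∃ (ρ : ℝ → ℝ) (c : ℝ) (S : BddC1 E3 × BddC1 E3 → BddC1 E3) (p q : E3) (T : ℝ),
      ContDiff ℝ 1 ρ ∧ Continuous S ∧ (∀ b x, (S b).fld x = slide ρ H (b, x)) ∧
      ShilnikovArcs H ρ c b (S b) p q T ∧
      Γ = {p} ∪ (fun s => (S b).flow s q) '' Iic 0 ∪ (fun t => b.1.flow t q) '' Icc 0 T := by
  obtain ⟨p, q, T, c, x, hp, hfoc, hq, ⟨-, hHq, hXq, hXXq, hYXq⟩, ⟨hc0, hc, hcs, hclim⟩,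
    ⟨hT, hx0, hxT, hx, hxpos⟩, hΓ⟩ := hΓ
  have hLX := continuous_lieD hH b.1
  have hLY := continuous_lieD hH b.2
  have hYq : 0 < lieD b.2.fld H q := by
    -- Membership of q in the closure of the sliding region gives only Yh(q) ≥ 0; the condition Yh ≠
    -- Xh at the fold makes it strict.
    have h1 : 0 ≤ lieD b.2.fld H q := by
      refine closure_minimal (fun z hz => ?_) (isClosed_le continuous_const hLY) hq.1
      exact hz.2.2.2.le
    rw [hXq, sub_zero] at hYXq
    exact lt_of_le_of_ne h1 hYXq.symm
  have hcc : ContinuousOn c (Iic 0) := fun t ht => (hc t ht).continuousWithinAt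
  have hK := isCompact_insert_image_Iic hcc hclim
  have hpos : ∀ z ∈ {p} ∪ c '' Iic 0,
      0 < min (lieD b.2.fld H z) ((lieD b.2.fld H z - lieD b.1.fld H z) / 2) := by
    rintro z (rfl | ⟨s, hs, rfl⟩)
    · exact lt_min hp.2.2.2 (by linarith [hp.2.2.1, hp.2.2.2])
    · rcases (mem_Iic.1 hs).lt_or_eq with hs | rfl
      · have := hcs s hs
        exact lt_min this.2.2.2 (by linarith [this.2.2.1, this.2.2.2])
      · rw [hc0, hXq]
        exact lt_min hYq (by linarith)
  obtain ⟨a, ha, hlow⟩ := hK.exists_forall_le'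
    (hLY.min ((hLY.sub hLX).div_const 2)).continuousOn hpos
  -- With c = a/2 the bound Yh - Xh > 2c leaves room: if Xh and Yh each change by less than c/2, the
  -- difference still exceeds c, where ρ is the true reciprocal.
  have hlow' : ∀ z ∈ {p} ∪ c '' Iic 0,
      a / 2 < lieD b.2.fld H z ∧ 2 * (a / 2) < lieD b.2.fld H z - lieD b.1.fld H z := by
    intro z hz
    have h1 := (hlow z hz).trans (min_le_left _ _)
    have h2 : a ≤ (lieD b.2.fld H z - lieD b.1.fld H z) / 2 :=
      (hlow z hz).trans (min_le_right _ _)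
    constructor <;> linarith
  obtain ⟨ρ, hρ, hρi⟩ := exists_contDiff_eq_inv (half_pos ha)
  obtain ⟨S, hS, hSf⟩ := exists_slide_family hH hHc hρ
  have hcflow : ∀ s ∈ Iic (0 : ℝ), c s = (S b).flow s q := by
    rw [← hc0]
    refine BddC1.flow_eq_of_Iic fun s hs => ?_
    have h1 := (hlow' (c s) (Or.inr ⟨s, hs, rfl⟩)).2
    rw [hSf, slide_eq_slidingField hρi (by linarith)]
    exact hc s hs
  have himg : (fun s => (S b).flow s q) '' Iic 0 = c '' Iic 0 :=
    image_congr fun s hs => (hcflow s hs).symm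
  have hxflow : ∀ t ∈ Icc 0 T, x t = b.1.flow t q := by
    rw [← hx0]
    exact BddC1.flow_eq_of_Icc hx
  refine ⟨ρ, a / 2, S, p, q, T, hρ, hS, hSf, ?_, ?_⟩
  · refine ⟨half_pos ha, hρi, hSf b, hT, ?_, hp.2.1, hHq, hp.2.2.1, hXq, hXXq, ?_, ?_, ?_, ?_, ?_⟩
    · rw [← hxflow T (right_mem_Icc.2 hT.le), hxT]
    · refine hfoc.congr ?_
      have hev : ∀ᶠ z in 𝓝 p, a / 2 < lieD b.2.fld H z - lieD b.1.fld H z :=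
        continuousAt_const.eventually_lt (hLY.sub hLX).continuousAt
          (by linarith [(hlow' p (Or.inl rfl)).2])
      filter_upwards [hev] with z hz
      exact (slide_eq_slidingField hρi hz.le).symm
    · intro s hs
      rw [← hcflow s hs.le]
      exact (hcs s hs).2.2.1
    · refine hclim.congr' ?_
      filter_upwards [Iic_mem_atBot (0 : ℝ)] with s hs using hcflow s hs
    · rw [himg]
      exact hlow'
    · intro t ht
      rw [← hxflow t (Ioo_subset_Icc_self ht)]
      exact (hxpos t ht).2
  · rw [hΓ, himg]
    congr 1
    exact image_congr hxflow

namespace ShilnikovArcs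

variable {ρ : ℝ → ℝ} {c : ℝ} {b : BddC1 E3 × BddC1 E3} {S : BddC1 E3} {p q : E3} {T : ℝ}

theorem level_flow (hH : ContDiff ℝ 2 H) (h : ShilnikovArcs H ρ c b S p q T) (s : ℝ) :
    H (S.flow s q) = 0 := by
  have := level_constant hH (V := fun x => slide ρ H (b, x)) (fun x => fderiv_slide ρ b x)
    (σ := fun s => S.flow s q) (fun s => by rw [← h.fld_eq]; exact S.hasDerivAt_flow q s) s 0
  simpa [h.level_q] using this

theorem isCompact_sliding (h : ShilnikovArcs H ρ c b S p q T) :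
    IsCompact ({p} ∪ (fun s => S.flow s q) '' Iic 0) :=
  isCompact_insert_image_Iic (S.continuous_flow_time q).continuousOn h.tendsto

theorem flow_neg (h : ShilnikovArcs H ρ c b S p q T) (t : ℝ) :
    b.1.flow (-t) p = b.1.flow (T - t) q := by
  rw [← h.flow_eq, ← BddC1.flow_add]
  congr 1
  ring

theorem level_sliding (hH : ContDiff ℝ 2 H) (h : ShilnikovArcs H ρ c b S p q T) :
    ∀ z ∈ {p} ∪ (fun s => S.flow s q) '' Iic 0, H z = 0 := by
  rintro z (rfl | ⟨s, -, rfl⟩)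
  · exact h.level_p
  · exact h.level_flow hH s

theorem ne (h : ShilnikovArcs H ρ c b S p q T) : p ≠ q := by
  rintro rfl
  exact h.lieX_p.ne h.lieX_q

theorem lie_gt_q (h : ShilnikovArcs H ρ c b S p q T) :
    c < lieD b.2.fld H q ∧ 2 * c < lieD b.2.fld H q - lieD b.1.fld H q :=
  h.lie_gt q (Or.inr ⟨0, self_mem_Iic, S.flow_zero q⟩)

/-- At a fold point of `X` the sliding field is `X`. -/
theorem slide_q (h : ShilnikovArcs H ρ c b S p q T) : slide ρ H (b, q) = b.1.fld q := by
  have h1 := h.lie_gt_q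
  have h0 := h.pos
  rw [slide_eq_slidingField h.inv (by linarith), slidingField, h.lieX_q]
  rw [sub_zero, zero_smul, sub_zero, smul_smul, inv_mul_cancel₀ (h0.trans h1.1).ne', one_smul]

/-- The sliding arc contains no equilibrium away from the focus. -/
theorem exists_norm_slide_gt (hH : ContDiff ℝ 2 H) (hρ : ContDiff ℝ 1 ρ)
    (h : ShilnikovArcs H ρ c b S p q T) {N : Set E3} (hN : IsOpen N) (hpN : p ∈ N) :
    ∃ ν > 0, ∀ z ∈ {p} ∪ (fun s => S.flow s q) '' Iic 0, z ∉ N → ν < ‖slide ρ H (b, z)‖ := by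
  have hc : Continuous fun z => ‖slide ρ H (b, z)‖ :=
    ((contDiff_slide hH hρ).continuous.comp (Continuous.prodMk_right b)).norm
  obtain ⟨a, ha, hle⟩ := (h.isCompact_sliding.diff hN).exists_forall_le' (a := 0)
    hc.continuousOn (by
      rintro z ⟨rfl | ⟨s, hs, rfl⟩, hz⟩
      · exact absurd hpN hz
      · refine norm_pos_iff.2 fun h0 => ?_
        have hconst : ∀ t, (fun _ : ℝ => S.flow s q) t = S.flow t (S.flow s q) :=
          BddC1.eq_flow (fun t => by
            have : S.fld (S.flow s q) = 0 := by rw [h.fld_eq]; exact h0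
            simpa [this] using hasDerivAt_const t (S.flow s q))
        have h1 : S.flow s q = q := by
          rw [show S.flow s q = S.flow (-s) (S.flow s q) from hconst (-s), BddC1.flow_neg_flow]
        simp only [h1] at h0
        rw [h.slide_q] at h0
        have := h.fold
        simp [lieD, h0] at this)
  refine ⟨a / 2, half_pos ha, fun z hz hzN => ?_⟩
  linarith [hle z ⟨hz, hzN⟩]

/-- Points of the orbit of `X` shortly before the fold do not lie on the sliding Shilnikov
orbit. -/
theorem exists_flow_neg_notMem (hH : ContDiff ℝ 2 H) (h : ShilnikovArcs H ρ c b S p q T) :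
    ∃ δ₁ > 0, ∀ δ, 0 < δ → δ ≤ δ₁ → b.1.flow (-δ) q ∉
      {p} ∪ (fun s => S.flow s q) '' Iic 0 ∪ (fun t => b.1.flow t q) '' Icc 0 T := by
  obtain ⟨δ₁, hδ₁, hpos⟩ := exists_pos_before_fold hH h.level_q h.lieX_q h.fold
  have hev : ∀ᶠ s in 𝓝 (0 : ℝ), lieD b.1.fld H (b.1.flow s p) < 0 :=
    ((continuous_lieD hH b.1).comp (b.1.continuous_flow_time p)).continuousAt.eventually_lt
      continuousAt_const (by simpa using h.lieX_p)
  obtain ⟨r, hr, hrv⟩ := Metric.mem_nhds_iff.1 hev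
  refine ⟨min δ₁ (r / 2), lt_min hδ₁ (half_pos hr), fun δ hδ hδm => ?_⟩
  rintro (hK | ⟨t, ht, hty⟩)
  · have h1 := hpos (-δ) ⟨by linarith [hδm.trans (min_le_left _ _)], by linarith⟩
    rw [h.level_sliding hH _ hK] at h1
    exact lt_irrefl _ h1
  · have hq : q = b.1.flow (δ + t) q := by
      rw [BddC1.flow_add]
      have : b.1.flow t q = b.1.flow (-δ) q := hty
      rw [this, BddC1.flow_flow_neg]
    rcases lt_trichotomy (δ + t) T with hlt | heq | hgt
    · have := h.level_pos (δ + t) ⟨by linarith [ht.1], hlt⟩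
      rw [← hq, h.level_q] at this
      exact lt_irrefl _ this
    · rw [heq, h.flow_eq] at hq
      exact h.ne hq.symm
    · have h2 : q = b.1.flow (δ + t - T) p := by
        rw [← h.flow_eq, ← BddC1.flow_add]
        rw [sub_add_cancel]
        exact hq
      have h3 : lieD b.1.fld H (b.1.flow (δ + t - T) p) < 0 := hrv (by
        rw [Real.ball_eq_Ioo]
        have := hδm.trans (min_le_right _ _)
        exact ⟨by linarith, by linarith [ht.2]⟩)
      rw [← h2, h.lieX_q] at h3
      exact lt_irrefl _ h3

end ShilnikovArcs

end Arcs

/-! ### Zeros of the splitting function correspond to orbits -/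

section Core

variable {H : E3 → ℝ} {ρ : ℝ → ℝ} {c : ℝ} {b₀ : BddC1 E3 × BddC1 E3} {p₀ q₀ : E3} {T : ℝ}

/-- The general turning-time result is applied to H and Xh along the backward X-orbit of the
continued focus; the nondegeneracy it requires is X²h(q₀) > 0, the visibility of the fold. -/
theorem ShilnikovArcs.exists_turning_time {S : BddC1 E3} (hH : ContDiff ℝ 2 H)
    (h : ShilnikovArcs H ρ c b₀ S p₀ q₀ T) {p : BddC1 E3 × BddC1 E3 → E3}
    (hp : ContDiffAt ℝ 1 p b₀) (hp₀ : p b₀ = p₀) (hpev : ∀ᶠ b in 𝓝 b₀, H (p b) = 0)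
    {δ₁ : ℝ} (hδ₁ : 0 < δ₁) :
    ∃ τ : BddC1 E3 × BddC1 E3 → ℝ, ContDiffAt ℝ 1 τ b₀ ∧ τ b₀ = T ∧
      ∃ δ, 0 < δ ∧ δ ≤ δ₁ ∧ δ < T ∧ ∀ᶠ b in 𝓝 b₀,
        lieD b.1.fld H (b.1.flow (-τ b) (p b)) = 0 ∧ 0 < τ b ∧
        (∀ t ∈ Icc (T - δ) (T + δ), lieD b.1.fld H (b.1.flow (-t) (p b)) = 0 → t = τ b) ∧
        (∀ t, 0 < t → t < T - δ → 0 < H (b.1.flow (-t) (p b))) ∧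
        (H (b.1.flow (-τ b) (p b)) = 0 → ∀ t ∈ Ioo 0 (τ b), 0 < H (b.1.flow (-t) (p b))) := by
  have hΨ : ∀ t, ContDiffAt ℝ 1 (fun z : (BddC1 E3 × BddC1 E3) × ℝ =>
      z.1.1.flow (-z.2) (p z.1)) (b₀, t) := fun t =>
    BddC1.contDiff_flow.contDiffAt.comp (b₀, t)
      (contDiff_fst.fst.contDiffAt.prodMk (contDiff_snd.neg.contDiffAt.prodMk
        (ContDiffAt.comp (b₀, t) hp contDiffAt_fst)))
  have hf : ∀ t, ContDiffAt ℝ 1 (fun z : (BddC1 E3 × BddC1 E3) × ℝ =>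
      H (z.1.1.flow (-z.2) (p z.1))) (b₀, t) := fun t =>
    (hH.of_le (by norm_num)).contDiffAt.comp (b₀, t) (hΨ t)
  have hk : ∀ t, ContDiffAt ℝ 1 (fun z : (BddC1 E3 × BddC1 E3) × ℝ =>
      lieD z.1.1.fld H (z.1.1.flow (-z.2) (p z.1))) (b₀, t) := fun t =>
    (contDiff_lieD hH).contDiffAt.comp (b₀, t) (contDiff_fst.fst.contDiffAt.prodMk (hΨ t))
  have hflow : ∀ (b : BddC1 E3 × BddC1 E3) t, HasDerivAt (fun t => b.1.flow (-t) (p b))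
      (-b.1.fld (b.1.flow (-t) (p b))) t := fun b t => by
    have := (b.1.hasDerivAt_flow (p b) (-t)).scomp t (hasDerivAt_neg t)
    rw [neg_one_smul] at this
    exact this
  have hT : b₀.1.flow (-T) p₀ = q₀ := by rw [h.flow_neg, sub_self, BddC1.flow_zero]
  refine SlidingShilnikov.exists_turning_time
    (f := fun z : (BddC1 E3 × BddC1 E3) × ℝ => H (z.1.1.flow (-z.2) (p z.1)))
    (k := fun z : (BddC1 E3 × BddC1 E3) × ℝ => lieD z.1.1.fld H (z.1.1.flow (-z.2) (p z.1)))
    h.time_pos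
    (fun b t => ?_) (fun t => (hf t).continuousAt) (fun t => (hk t).continuousAt) (hk T) ?_ ?_ ?_
    ?_ ?_ hδ₁
  · have := HasFDerivAt.comp_hasDerivAt (l := H) t
      (hH.differentiable two_ne_zero (b.1.flow (-t) (p b))).hasFDerivAt (hflow b t)
    rwa [map_neg] at this
  · simp only [hp₀, hT, h.lieX_q]
  · have h1 := HasFDerivAt.comp_hasDerivAt (l := lieD b₀.1.fld H) T
      (differentiable_lieD hH b₀.1 (b₀.1.flow (-T) (p b₀))).hasFDerivAt (hflow b₀ T)
    have h2 := ((hk T).differentiableAt one_ne_zero).hasFDerivAt.comp_hasDerivAt T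
      ((hasDerivAt_const T b₀).prodMk (hasDerivAt_id T))
    rw [h2.unique h1, map_neg, hp₀, hT, neg_lt_zero]
    exact h.fold
  · simpa using hpev
  · simpa [hp₀] using h.lieX_p
  · intro t ht
    simp only [hp₀, h.flow_neg]
    exact h.level_pos _ ⟨by linarith [ht.2], by linarith [ht.1]⟩

/-- On the surface inside V, outside N, the unperturbed sliding field is longer than ν, so a
perturbation smaller than ν has no equilibrium there and the focus of any orbit in V must be `p b`.
The flight time is then forced as well. Escaping orbits are impossible because Yh stays positive on
this part of the surface. -/
theorem eventually_return_eq_zero (hH : ContDiff ℝ 2 H) (hHc : HasCompactSupport H)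
    {S : BddC1 E3 × BddC1 E3 → BddC1 E3} (hS : Continuous S)
    (hSf : ∀ b x, (S b).fld x = slide ρ H (b, x)) (hc : 0 < c) (hinv : ∀ s, c ≤ s → ρ s = s⁻¹)
    {p : BddC1 E3 × BddC1 E3 → E3} {τ : BddC1 E3 × BddC1 E3 → ℝ} {δ ν : ℝ} (hδ : 0 < T + δ)
    (hν : 0 < ν) {N V : Set E3}
    (hV : ∀ x ∈ V, H x = 0 → c < lieD b₀.2.fld H x ∧
      2 * c < lieD b₀.2.fld H x - lieD b₀.1.fld H x ∧ (x ∈ N ∨ ν < ‖slide ρ H (b₀, x)‖))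
    (hN : ∀ᶠ b in 𝓝 b₀, ∀ x ∈ N, H x = 0 → slide ρ H (b, x) = 0 → x = p b)
    (hout : ∀ᶠ b in 𝓝 b₀, b.1.flow (-(T + δ)) (p b) ∉ V)
    (hτ : ∀ᶠ b in 𝓝 b₀,
      (∀ t ∈ Icc (T - δ) (T + δ), lieD b.1.fld H (b.1.flow (-t) (p b)) = 0 → t = τ b) ∧
      ∀ t, 0 < t → t < T - δ → 0 < H (b.1.flow (-t) (p b))) :
    ∀ᶠ b in 𝓝 b₀, ∀ Γ ⊆ V,
      (IsShilnikovSliding ⊤ H b.1.fld b.2.fld Γ → H (b.1.flow (-τ b) (p b)) = 0) ∧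
      ¬ IsShilnikovEscaping ⊤ H b.1.fld b.2.fld Γ := by
  have hSν : ∀ᶠ b in 𝓝 b₀, ‖S b - S b₀‖ < ν := by
    have := (hS.tendsto b₀).sub_const (S b₀)
    rw [sub_self] at this
    simpa using this.norm.eventually_lt_const (by simpa using hν)
  filter_upwards [hN, hout, hτ, hSν,
    (continuous_fst.tendsto b₀).eventually (eventually_lieD_close hH hHc b₀.1 (half_pos hc)),
    (continuous_snd.tendsto b₀).eventually (eventually_lieD_close hH hHc b₀.2 (half_pos hc))]
    with b hN hout hτ hSν hX hY Γ hΓV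
  constructor
  · rintro ⟨p', q', t', c', x', hp', hfoc, -, ⟨-, hHq, hXq, -, -⟩, -,
      ⟨ht', hx0, hxt, hx, -⟩, hΓ⟩
    have hp'V : p' ∈ V := hΓV (by rw [hΓ]; exact Or.inl (Or.inl rfl))
    obtain ⟨-, h2, h3⟩ := hV p' hp'V hp'.2.1
    have hXp := abs_lt.1 (hX p')
    have hYp := abs_lt.1 (hY p')
    have hsl : slide ρ H (b, p') = 0 := by
      rw [slide_eq_slidingField hinv (by linarith)]
      exact hfoc.1
    have hpb : p' = p b := by
      refine hN p' (h3.resolve_right fun h3 => ?_) hp'.2.1 hsl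
      have h4 := BddC1.norm_fld_le (S b - S b₀) p'
      rw [BddC1.fld_sub, hSf, hSf, hsl, zero_sub, norm_neg] at h4
      linarith
    rw [← hpb] at hout hτ ⊢
    refine return_eq_zero_of_orbit ht' hx0 hxt hx hHq hXq hδ (fun t ht hxy => hout ?_) hτ.1 hτ.2
    rw [← hxy]
    exact hΓV (by rw [hΓ]; exact Or.inr ⟨t, ht, rfl⟩)
  · rintro ⟨p', q', t', c', x', hp', -, -, -, -, -, hΓ⟩
    have hp'V : p' ∈ V := hΓV (by rw [hΓ]; exact Or.inl (Or.inl rfl))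
    have h1 := (hV p' hp'V hp'.2.1).1
    have := abs_lt.1 (hY p')
    linarith [hp'.2.2.2]

/-- When g = 0 the turning point lies on the surface with Xh = 0, and it is close to q₀, so X²h > 0
persists. The X-arc is near the old one by continuity on a compact time interval, and the sliding
arc by `eventually_sliding_arc`. -/
theorem eventually_exists_orbit (hH : ContDiff ℝ 2 H) (hHc : HasCompactSupport H)
    (hρ : ContDiff ℝ 1 ρ) {S : BddC1 E3 × BddC1 E3 → BddC1 E3} (hS : Continuous S)
    (hSf : ∀ b x, (S b).fld x = slide ρ H (b, x)) (h : ShilnikovArcs H ρ c b₀ (S b₀) p₀ q₀ T)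
    {p : BddC1 E3 × BddC1 E3 → E3} (hp : ContinuousAt p b₀) (hp₀ : p b₀ = p₀)
    (hpev : ∀ᶠ b in 𝓝 b₀, H (p b) = 0 ∧ IsUnstableFocus H (fun x => slide ρ H (b, x)) (p b))
    (hattr : ∀ O ∈ 𝓝 p₀, ∃ O' ∈ 𝓝 p₀, ∀ᶠ b in 𝓝 b₀, ∀ (σ : ℝ → E3) (s₀ : ℝ),
        (∀ s, HasDerivAt σ (slide ρ H (b, σ s)) s) → H (σ s₀) = 0 → σ s₀ ∈ O' →
          (∀ s ≤ s₀, σ s ∈ O) ∧ Tendsto σ atBot (𝓝 (p b)))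
    {τ : BddC1 E3 × BddC1 E3 → ℝ} (hτ : ContinuousAt τ b₀) (hτ₀ : τ b₀ = T)
    (hτev : ∀ᶠ b in 𝓝 b₀, lieD b.1.fld H (b.1.flow (-τ b) (p b)) = 0 ∧ 0 < τ b ∧
        (H (b.1.flow (-τ b) (p b)) = 0 → ∀ t ∈ Ioo 0 (τ b), 0 < H (b.1.flow (-t) (p b))))
    {V : Set E3} (hV : IsOpen V) (hΓV : {p₀} ∪ (fun s => (S b₀).flow s q₀) '' Iic 0 ∪
      (fun t => b₀.1.flow t q₀) '' Icc 0 T ⊆ V) :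
    ∀ᶠ b in 𝓝 b₀, H (b.1.flow (-τ b) (p b)) = 0 →
      ∃ Γ ⊆ V, IsShilnikovSliding ⊤ H b.1.fld b.2.fld Γ := by
  have hLX := continuous_lieD hH b₀.1
  have hLY := continuous_lieD hH b₀.2
  have hT : b₀.1.flow (-T) p₀ = q₀ := by rw [h.flow_neg, sub_self, BddC1.flow_zero]
  have hq : ContinuousAt (fun b : BddC1 E3 × BddC1 E3 => b.1.flow (-τ b) (p b)) b₀ :=
    BddC1.continuous_flow.continuousAt.comp
      (continuousAt_fst.prodMk (hτ.neg.prodMk hp))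
  have hq₀ : b₀.1.flow (-τ b₀) (p b₀) = q₀ := by rw [hτ₀, hp₀, hT]
  have hO : IsOpen (V ∩ {x | c < lieD b₀.2.fld H x ∧
      2 * c < lieD b₀.2.fld H x - lieD b₀.1.fld H x}) :=
    hV.inter ((isOpen_lt continuous_const hLY).inter
      (isOpen_lt continuous_const (hLY.sub hLX)))
  have hKO : ∀ z ∈ {p₀} ∪ (fun s => (S b₀).flow s q₀) '' Iic 0,
      z ∈ V ∩ {x | c < lieD b₀.2.fld H x ∧
        2 * c < lieD b₀.2.fld H x - lieD b₀.1.fld H x} := fun z hz =>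
    ⟨hΓV (Or.inl hz), h.lie_gt z hz⟩
  have harc := eventually_sliding_arc hH hρ hS hSf hq hq₀ hO (hKO _ (Or.inl rfl))
    (fun s hs => hKO _ (Or.inr ⟨s, hs, rfl⟩)) h.lieX_p h.lieX_neg h.tendsto
    (by rw [hSf, h.slide_q]; exact h.fold) hattr
  -- Time is measured as a fraction of the flight time, so that the compact parameter interval does
  -- not depend on b.
  have hflowV : ∀ᶠ b in 𝓝 b₀, ∀ r ∈ Icc (0 : ℝ) 1, b.1.flow (-(r * τ b)) (p b) ∈ V := by
    refine IsCompact.eventually_forall_mem (isCompact_Icc (a := (0 : ℝ)) (b := 1))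
      (φ := fun z : (BddC1 E3 × BddC1 E3) × ℝ => z.1.1.flow (-(z.2 * τ z.1)) (p z.1))
      (fun r _ => ?_) fun r hr => hV.mem_nhds (hΓV (Or.inr ⟨T - r * T, ?_, ?_⟩))
    · have h1 : ContinuousAt (fun z : (BddC1 E3 × BddC1 E3) × ℝ => τ z.1) (b₀, r) :=
        ContinuousAt.comp (x := (b₀, r)) hτ continuousAt_fst
      have h2 : ContinuousAt (fun z : (BddC1 E3 × BddC1 E3) × ℝ => p z.1) (b₀, r) :=
        ContinuousAt.comp (x := (b₀, r)) hp continuousAt_fst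
      exact BddC1.continuous_flow.continuousAt.comp
        (continuous_fst.fst.continuousAt.prodMk ((continuousAt_snd.mul h1).neg.prodMk h2))
    · have := h.time_pos
      constructor <;> nlinarith [hr.1, hr.2]
    · simp only [hτ₀, hp₀, h.flow_neg]
  have hpO : ∀ᶠ b in 𝓝 b₀, c < lieD b₀.2.fld H (p b) ∧
      2 * c < lieD b₀.2.fld H (p b) - lieD b₀.1.fld H (p b) := by
    have := hp.eventually_mem (hO.mem_nhds (by rw [hp₀]; exact hKO _ (Or.inl rfl)))
    filter_upwards [this] with b hb using hb.2
  have hXp : ∀ᶠ b in 𝓝 b₀, lieD b.1.fld H (p b) < 0 := by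
    have h1 : ContinuousAt (fun b : BddC1 E3 × BddC1 E3 => lieD b.1.fld H (p b)) b₀ :=
      (contDiff_lieD hH).continuous.continuousAt.comp (continuousAt_fst.prodMk hp)
    exact h1.eventually_lt continuousAt_const (by rw [hp₀]; exact h.lieX_p)
  have hXX : ∀ᶠ b in 𝓝 b₀, 0 < lieD b.1.fld (lieD b.1.fld H) (b.1.flow (-τ b) (p b)) := by
    have h1 : Continuous fun z : (BddC1 E3 × BddC1 E3) × E3 =>
        lieD z.1.1.fld (lieD z.1.1.fld H) z.2 :=
      (continuous_fderiv_lieD hH).clm_apply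
        (BddC1.contDiff_eval.continuous.comp (continuous_fst.fst.prodMk continuous_snd))
    have h2 : ContinuousAt (fun b : BddC1 E3 × BddC1 E3 =>
        lieD b.1.fld (lieD b.1.fld H) (b.1.flow (-τ b) (p b))) b₀ :=
      h1.continuousAt.comp (continuousAt_id.prodMk hq)
    exact continuousAt_const.eventually_lt h2 (by rw [hq₀]; exact h.fold)
  have hc := h.pos
  filter_upwards [hpev, hτev, harc, hflowV, hpO, hXp, hXX,
    (continuous_fst.tendsto b₀).eventually (eventually_lieD_close hH hHc b₀.1 (half_pos hc)),
    (continuous_snd.tendsto b₀).eventually (eventually_lieD_close hH hHc b₀.2 (half_pos hc))]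
    with b hpev hτev harc hflowV hpO hXp hXX hX hY hg
  obtain ⟨ha1, ha2, ha3⟩ := harc hg hτev.1
  have hYX : ∀ x, c < lieD b₀.2.fld H x ∧ 2 * c < lieD b₀.2.fld H x - lieD b₀.1.fld H x →
      0 < lieD b.2.fld H x ∧ c < lieD b.2.fld H x - lieD b.1.fld H x := fun x hx => by
    have h1 := abs_lt.1 (hX x)
    have h2 := abs_lt.1 (hY x)
    constructor <;> linarith [hx.1, hx.2]
  have hp' := hYX _ hpO
  refine ⟨_, ?_, isShilnikovSliding_of_arcs hH hc h.inv (hSf b) hτev.2.1 hpev.1 hXp hp'.1 hp'.2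
    hpev.2 rfl hg hτev.1 hXX ha2 (fun s hs => (hYX _ (ha1 s hs).2).1)
    (fun s hs => (hYX _ (ha1 s hs).2).2.le) ha3 (hτev.2.2 hg)⟩
  rintro z ((rfl | ⟨s, hs, rfl⟩) | ⟨t, ht, rfl⟩)
  · simpa using hflowV 0 (left_mem_Icc.2 zero_le_one)
  · exact (ha1 s hs).1
  · have h1 := hflowV ((τ b - t) / τ b) ⟨div_nonneg (by linarith [ht.2]) hτev.2.1.le,
      (div_le_one hτev.2.1).2 (by linarith [ht.1])⟩
    rw [div_mul_cancel₀ _ hτev.2.1.ne'] at h1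
    change b.1.flow t (b.1.flow (-τ b) (p b)) ∈ V
    rw [← BddC1.flow_add]
    convert h1 using 2
    ring

end Core

/-! ### The splitting function -/

/-- The codimension one statement for compactly supported switching functions and bounded fields
on the whole space. -/
theorem exists_splitting_function {H : E3 → ℝ} (hH : ContDiff ℝ 2 H) (hHc : HasCompactSupport H)
    {b₀ : BddC1 E3 × BddC1 E3} {Γ₀ : Set E3}
    (hΓ₀ : IsShilnikovSliding ⊤ H b₀.1.fld b₀.2.fld Γ₀) :
    ∃ (V₀ : Set E3) (g : BddC1 E3 × BddC1 E3 → ℝ) (p₀ w : E3), IsOpen V₀ ∧ Γ₀ ⊆ V₀ ∧ p₀ ∈ Γ₀ ∧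
      ContDiffAt ℝ 1 g b₀ ∧ (∀ η : BddC1 E3, η.fld p₀ = w → fderiv ℝ g b₀ (0, η) ≠ 0) ∧
      ∀ V, IsOpen V → Γ₀ ⊆ V → V ⊆ V₀ → ∀ᶠ b in 𝓝 b₀,
        ((∃ Γ ⊆ V, IsShilnikovSliding ⊤ H b.1.fld b.2.fld Γ) ↔ g b = 0) ∧
        ¬ ∃ Γ ⊆ V, IsShilnikovEscaping ⊤ H b.1.fld b.2.fld Γ := by
  obtain ⟨ρ, c, S, p₀, q₀, T, hρ, hS, hSf, h, rfl⟩ := exists_shilnikovArcs hH hHc hΓ₀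
  have hc := h.pos
  have hLX := continuous_lieD hH b₀.1
  have hLY := continuous_lieD hH b₀.2
  have hd : fderiv ℝ H p₀ ≠ 0 := fun h0 => by
    have := h.lieX_p
    simp [lieD, h0] at this
  obtain ⟨p, hp, hp₀, hpev, ⟨N, hN, hNev⟩, hattr⟩ := focus_continuation hH (contDiff_slide hH hρ)
    (fun b x => fderiv_slide ρ b x) h.level_p hd h.focus
  obtain ⟨δ₁, hδ₁, hδout⟩ := h.exists_flow_neg_notMem hH
  obtain ⟨τ, hτ, hτ₀, δ, hδ, hδδ₁, hδT, hτev⟩ :=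
    h.exists_turning_time hH hp hp₀ (hpev.mono fun b hb => hb.1) hδ₁
  obtain ⟨ν, hν, hνK⟩ := h.exists_norm_slide_gt hH hρ isOpen_interior
    (mem_interior_iff_mem_nhds.2 hN)
  have hT : b₀.1.flow (-T) p₀ = q₀ := by rw [h.flow_neg, sub_self, BddC1.flow_zero]
  have hΓc : IsCompact ({p₀} ∪ (fun s => (S b₀).flow s q₀) '' Iic 0 ∪
      (fun t => b₀.1.flow t q₀) '' Icc 0 T) :=
    h.isCompact_sliding.union (isCompact_Icc.image (b₀.1.continuous_flow_time q₀))
  have hy := hδout δ hδ hδδ₁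
  obtain ⟨η, hη, hηΓ⟩ := Metric.nhds_basis_closedBall.mem_iff.1
    (hΓc.isClosed.isOpen_compl.mem_nhds hy)
  have hO : IsOpen ({x | c < lieD b₀.2.fld H x} ∩
      {x | 2 * c < lieD b₀.2.fld H x - lieD b₀.1.fld H x} ∩
      (interior N ∪ {x | ν < ‖slide ρ H (b₀, x)‖})) := by
    refine ((isOpen_lt continuous_const hLY).inter (isOpen_lt continuous_const
      (hLY.sub hLX))).inter (isOpen_interior.union (isOpen_lt continuous_const ?_))
    exact ((contDiff_slide hH hρ).continuous.comp (Continuous.prodMk_right b₀)).norm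
  obtain ⟨w, hw⟩ := exists_transversal_direction hH hρ hT h.lieX_q (hc.trans h.lie_gt_q.1).ne'
    h.lieX_p (by
      have h1 := (h.lie_gt p₀ (Or.inl rfl)).2
      rw [h.inv _ (by linarith)]
      exact inv_pos.2 (by linarith)) h.focus
    (hp.differentiableAt one_ne_zero) hp₀ (hpev.mono fun b hb => ⟨hb.1, hb.2.1⟩)
    (hτ.differentiableAt one_ne_zero) hτ₀
  -- The sign, margin and equilibrium conditions matter only on the surface, so {H ≠ 0} is added to
  -- contain the interior of the X-arc. The removed ball surrounds a point of the X-orbit shortly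
  -- before the fold, off Γ₀: an orbit in V cannot follow X backward past it, which rules out flight
  -- times above T + δ.
  refine ⟨(({x | c < lieD b₀.2.fld H x} ∩
      {x | 2 * c < lieD b₀.2.fld H x - lieD b₀.1.fld H x} ∩
      (interior N ∪ {x | ν < ‖slide ρ H (b₀, x)‖})) ∪ {x | H x ≠ 0}) \
        Metric.closedBall (b₀.1.flow (-δ) q₀) η,
    fun b => H (b.1.flow (-τ b) (p b)), p₀, w, ?_, ?_, Or.inl (Or.inl rfl), ?_, hw, ?_⟩
  · exact (hO.union (isOpen_ne_fun hH.continuous continuous_const)).sdiff Metric.isClosed_closedBall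
  · intro z hz
    refine ⟨?_, fun hzη => hηΓ hzη hz⟩
    have hK : ∀ z ∈ {p₀} ∪ (fun s => (S b₀).flow s q₀) '' Iic 0,
        z ∈ ({x | c < lieD b₀.2.fld H x} ∩
          {x | 2 * c < lieD b₀.2.fld H x - lieD b₀.1.fld H x} ∩
          (interior N ∪ {x | ν < ‖slide ρ H (b₀, x)‖})) := fun z hz =>
      ⟨h.lie_gt z hz, or_iff_not_imp_left.2 (hνK z hz)⟩
    rcases hz with hz | ⟨t, ht, rfl⟩
    · exact Or.inl (hK z hz)
    · rcases ht.1.eq_or_lt with rfl | h0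
      · exact Or.inl (hK _ (Or.inr ⟨0, self_mem_Iic, by simp⟩))
      · rcases ht.2.eq_or_lt with rfl | h1
        · exact Or.inl (hK _ (Or.inl h.flow_eq))
        · exact Or.inr (h.level_pos t ⟨h0, h1⟩).ne'
  · exact (hH.of_le (by norm_num)).contDiffAt.comp b₀ (BddC1.contDiff_flow.contDiffAt.comp b₀
      (contDiff_fst.contDiffAt.prodMk (hτ.neg.prodMk hp)))
  · intro V hV hΓV hVV₀
    have hout : ∀ᶠ b in 𝓝 b₀, b.1.flow (-(T + δ)) (p b) ∉ V := by
      have h1 : ContinuousAt (fun b : BddC1 E3 × BddC1 E3 => b.1.flow (-(T + δ)) (p b)) b₀ :=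
        BddC1.continuous_flow.continuousAt.comp
          (continuousAt_fst.prodMk (continuousAt_const.prodMk hp.continuousAt))
      have h2 : b₀.1.flow (-(T + δ)) (p b₀) = b₀.1.flow (-δ) q₀ := by
        rw [hp₀, h.flow_neg, sub_add_cancel_left]
      filter_upwards [h1.eventually_mem (Metric.closedBall_mem_nhds _ hη)] with b hb hbV
      rw [h2] at hb
      exact (hVV₀ hbV).2 hb
    have honly := eventually_return_eq_zero (b₀ := b₀) (τ := τ) hH hHc hS hSf hc h.inv
      (add_pos h.time_pos hδ) hν
      (N := interior N) (V := V) (fun x hx hx0 => by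
        obtain ⟨⟨h1, h2⟩, h3⟩ := (hVV₀ hx).1.resolve_right fun hne => hne hx0
        exact ⟨h1, h2, h3⟩)
      (hNev.mono fun b hb x hx => hb x (interior_subset hx)) hout
      (hτev.mono fun b hb => ⟨hb.2.2.1, hb.2.2.2.1⟩)
    have hif := eventually_exists_orbit hH hHc hρ hS hSf h hp.continuousAt hp₀ hpev hattr
      hτ.continuousAt hτ₀ (hτev.mono fun b hb => ⟨hb.1, hb.2.1, hb.2.2.2.2⟩) hV hΓV
    filter_upwards [honly, hif] with b h1 h2
    exact ⟨⟨fun ⟨Γ, hΓ, hs⟩ => (h1 Γ hΓ).1 hs, h2⟩, fun ⟨Γ, hΓ, hs⟩ => (h1 Γ hΓ).2 hs⟩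

/-! ### Time reversal -/

section TimeReversal

variable {U : Opens E3} {h : E3 → ℝ} {X Y : E3 → E3}

theorem lieD_neg_left (X : E3 → E3) (h : E3 → ℝ) : lieD (-X) h = -lieD X h := by
  funext x
  simp [lieD]

theorem lieD_neg_right (X : E3 → E3) (h : E3 → ℝ) : lieD X (-h) = -lieD X h := by
  funext x
  simp [lieD, fderiv_neg]

theorem slidingField_neg (h : E3 → ℝ) (X Y : E3 → E3) :
    slidingField h (-X) (-Y) = -slidingField h X Y := by
  funext x
  simp only [slidingField, lieD_neg_left, Pi.neg_apply, smul_neg, neg_smul, neg_neg]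
  rw [← smul_neg, show -lieD Y h x - -lieD X h x = -(lieD Y h x - lieD X h x) by ring, inv_neg,
    neg_smul, smul_neg]

theorem slidingRegion_neg (U : Opens E3) (h : E3 → ℝ) (X Y : E3 → E3) :
    slidingRegion U h (-X) (-Y) = escapingRegion U h X Y := by
  ext x
  simp [slidingRegion, escapingRegion, lieD_neg_left]

theorem IsVisibleFold.neg {q : E3} (hq : IsVisibleFold U h X Y q) :
    IsVisibleFold U h (-X) (-Y) q := by
  obtain ⟨h1, h2, h3, h4, h5⟩ := hq
  refine ⟨h1, h2, ?_, ?_, ?_⟩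
  · rw [lieD_neg_left, Pi.neg_apply, h3, neg_zero]
  · rw [lieD_neg_left, lieD_neg_left, lieD_neg_right, neg_neg]
    exact h4
  · rw [lieD_neg_left, lieD_neg_left, Pi.neg_apply, Pi.neg_apply, neg_sub_neg]
    exact fun h0 => h5 (by linarith)

theorem IsTangentEigenvalue.neg {V : E3 → E3} {p : E3} {lam : ℂ}
    (hV : IsTangentEigenvalue h V p lam) : IsTangentEigenvalue h (-V) p (-lam) := by
  obtain ⟨u, v, hu, hv, huv, h1, h2⟩ := hV
  refine ⟨u, v, hu, hv, huv, ?_, ?_⟩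
  · rw [fderiv_neg, _root_.neg_apply, h1, Complex.neg_re, Complex.neg_im]
    module
  · rw [fderiv_neg, _root_.neg_apply, h2, Complex.neg_re, Complex.neg_im]
    module

theorem IsStableFocus.neg {V : E3 → E3} {p : E3} (hV : IsStableFocus h V p) :
    IsUnstableFocus h (-V) p := by
  obtain ⟨h0, lam, h1, h2, h3⟩ := hV
  exact ⟨by simp [h0], -lam, by simpa using h1, by simpa using h2, h3.neg⟩

theorem IsUnstableFocus.neg {V : E3 → E3} {p : E3} (hV : IsUnstableFocus h V p) :
    IsStableFocus h (-V) p := by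
  obtain ⟨h0, lam, h1, h2, h3⟩ := hV
  exact ⟨by simp [h0], -lam, by simpa using h1, by simpa using h2, h3.neg⟩

theorem IsTrajectory.reverse {V : E3 → E3} {c : ℝ → E3} {I J : Set ℝ} (hc : IsTrajectory V c I)
    (hJ : ∀ t ∈ J, -t ∈ I) : IsTrajectory (-V) (fun t => c (-t)) J := by
  intro t ht
  have := (hc (-t) (hJ t ht)).scomp t (hasDerivAt_neg t).hasDerivWithinAt hJ
  rw [neg_one_smul] at this
  exact this

theorem image_reverse (c : ℝ → E3) (I : Set ℝ) : (fun t => c (-t)) '' I = c '' (-I) := by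
  rw [show (fun t => c (-t)) = c ∘ Neg.neg from rfl, image_comp, image_neg_eq_neg]

theorem IsShilnikovEscaping.reverse {Γ : Set E3} (hΓ : IsShilnikovEscaping U h X Y Γ) :
    IsShilnikovSliding U h (-X) (-Y) Γ := by
  obtain ⟨p, q, T, c, x, hp, hfoc, hq, hfold, ⟨hc0, hc, hcs, hclim⟩, ⟨hT, hx0, hxT, hx, hpos⟩,
    rfl⟩ := hΓ
  refine ⟨p, q, -T, fun t => c (-t), fun t => x (-t), ?_, ?_, ?_, hfold.neg, ⟨?_, ?_, ?_, ?_⟩,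
    ⟨?_, ?_, ?_, ?_, ?_⟩, ?_⟩
  · rwa [slidingRegion_neg]
  · rw [slidingField_neg]
    exact hfoc.neg
  · rwa [slidingRegion_neg]
  · simpa using hc0
  · rw [slidingField_neg]
    exact hc.reverse fun t ht => mem_Ici.2 (by linarith [mem_Iic.1 ht])
  · intro t ht
    rw [slidingRegion_neg]
    exact hcs (-t) (by linarith)
  · exact hclim.comp tendsto_neg_atBot_atTop
  · linarith
  · simpa using hx0
  · simpa using hxT
  · exact hx.reverse fun t ht => ⟨by linarith [ht.2], by linarith [ht.1]⟩
  · exact fun t ht => hpos (-t) ⟨by linarith [ht.2], by linarith [ht.1]⟩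
  · rw [image_reverse, image_reverse, neg_Iic, neg_Icc, neg_zero, neg_neg]

theorem IsShilnikovSliding.reverse {Γ : Set E3} (hΓ : IsShilnikovSliding U h X Y Γ) :
    IsShilnikovEscaping U h (-X) (-Y) Γ := by
  obtain ⟨p, q, T, c, x, hp, hfoc, hq, hfold, ⟨hc0, hc, hcs, hclim⟩, ⟨hT, hx0, hxT, hx, hpos⟩,
    rfl⟩ := hΓ
  have hreg : escapingRegion U h (-X) (-Y) = slidingRegion U h X Y := by
    rw [← slidingRegion_neg, neg_neg, neg_neg]
  refine ⟨p, q, -T, fun t => c (-t), fun t => x (-t), ?_, ?_, ?_, hfold.neg, ⟨?_, ?_, ?_, ?_⟩,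
    ⟨?_, ?_, ?_, ?_, ?_⟩, ?_⟩
  · rwa [hreg]
  · rw [slidingField_neg]
    exact hfoc.neg
  · rwa [hreg]
  · simpa using hc0
  · rw [slidingField_neg]
    exact hc.reverse fun t ht => mem_Iic.2 (by linarith [mem_Ici.1 ht])
  · intro t ht
    rw [hreg]
    exact hcs (-t) (by linarith)
  · exact hclim.comp tendsto_neg_atTop_atBot
  · linarith
  · simpa using hx0
  · simpa using hxT
  · exact hx.reverse fun t ht => ⟨by linarith [ht.2], by linarith [ht.1]⟩
  · exact fun t ht => hpos (-t) ⟨by linarith [ht.2], by linarith [ht.1]⟩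
  · rw [image_reverse, image_reverse, neg_Ici, neg_Icc, neg_zero, neg_neg]

/-- Under (X, Y) ↦ (-X, -Y) the sliding field and the eigenvalues change sign and the two regions
are exchanged, while X²h, being quadratic in X, keeps its sign. -/
theorem isShilnikovEscaping_iff {Γ : Set E3} :
    IsShilnikovEscaping U h X Y Γ ↔ IsShilnikovSliding U h (-X) (-Y) Γ :=
  ⟨fun hΓ => hΓ.reverse, fun hΓ => by simpa using hΓ.reverse⟩

end TimeReversal

/-! ### Localization to a neighbourhood of the orbit -/

section Localization

variable {U U' : Opens E3} {h h' : E3 → ℝ} {X Y X' Y' : E3 → E3} {V Γ : Set E3}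

theorem lieD_eqOn (hV : IsOpen V) (hX : EqOn X X' V) (hh : EqOn h h' V) :
    EqOn (lieD X h) (lieD X' h') V := fun x hx => by
  rw [lieD, lieD, hX hx, (hh.eventuallyEq_of_mem (hV.mem_nhds hx)).fderiv_eq]

/-- Being a sliding Shilnikov orbit is a local property. -/
theorem IsShilnikovSliding.congr (hΓ : IsShilnikovSliding U h X Y Γ) (hV : IsOpen V)
    (hΓV : Γ ⊆ V) (hVU : V ⊆ U') (hX : EqOn X X' V) (hY : EqOn Y Y' V) (hh : EqOn h h' V) :
    IsShilnikovSliding U' h' X' Y' Γ := by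
  obtain ⟨p, q, T, c, x, hp, hfoc, hq, ⟨-, hq1, hq2, hq3, hq4⟩, ⟨hc0, hc, hcs, hclim⟩,
    ⟨hT, hx0, hxT, hx, hpos⟩, rfl⟩ := hΓ
  have hLX := lieD_eqOn hV hX hh
  have hLY := lieD_eqOn hV hY hh
  have hLXX := lieD_eqOn hV hX hLX
  have hS : EqOn (slidingField h X Y) (slidingField h' X' Y') V := fun z hz => by
    simp only [slidingField, hX hz, hY hz, hLX hz, hLY hz]
  have hreg : ∀ z ∈ V, z ∈ slidingRegion U h X Y → z ∈ slidingRegion U' h' X' Y' :=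
    fun z hz ⟨_, h2, h3, h4⟩ =>
      ⟨hVU hz, by rwa [← hh hz], by rwa [← hLX hz], by rwa [← hLY hz]⟩
  have hpV : p ∈ V := hΓV (Or.inl (Or.inl rfl))
  have hcV : ∀ t ∈ Iic (0 : ℝ), c t ∈ V := fun t ht => hΓV (Or.inl (Or.inr ⟨t, ht, rfl⟩))
  have hxV : ∀ t ∈ Icc 0 T, x t ∈ V := fun t ht => hΓV (Or.inr ⟨t, ht, rfl⟩)
  have hqV : q ∈ V := hc0 ▸ hcV 0 self_mem_Iic
  refine ⟨p, q, T, c, x, hreg p hpV hp, ?_, ⟨?_, ?_⟩, ?_, ⟨hc0, ?_, ?_, hclim⟩,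
    ⟨hT, hx0, hxT, ?_, ?_⟩, rfl⟩
  · have hev := hh.eventuallyEq_of_mem (hV.mem_nhds hpV)
    obtain ⟨h0, lam, h1, h2, u, v, h3, h4, h5, h6, h7⟩ :=
      hfoc.congr (hS.eventuallyEq_of_mem (hV.mem_nhds hpV))
    exact ⟨h0, lam, h1, h2, u, v, by rwa [← hev.fderiv_eq], by rwa [← hev.fderiv_eq], h5, h6, h7⟩
  · rw [mem_closure_iff]
    intro O hO hqO
    obtain ⟨z, hz, hzr⟩ := mem_closure_iff.1 hq.1 (O ∩ V) (hO.inter hV) ⟨hqO, hqV⟩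
    exact ⟨z, hz.1, hreg z hz.2 hzr⟩
  · rintro ⟨-, -, h3, -⟩
    rw [← hLX hqV, hq2] at h3
    exact lt_irrefl _ h3
  · exact ⟨hVU hqV, by rwa [← hh hqV], by rwa [← hLX hqV], by rwa [← hLXX hqV],
      by rwa [← hLX hqV, ← hLY hqV]⟩
  · intro t ht
    rw [← hS (hcV t ht)]
    exact hc t ht
  · exact fun t ht => hreg _ (hcV t ht.le) (hcs t ht)
  · intro t ht
    rw [← hX (hxV t ht)]
    exact hx t ht
  · intro t ht
    have := hxV t (Ioo_subset_Icc_self ht)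
    exact ⟨hVU this, by rw [← hh this]; exact (hpos t ht).2⟩

theorem isShilnikovSliding_congr (hV : IsOpen V) (hΓV : Γ ⊆ V) (hVU : V ⊆ U) (hVU' : V ⊆ U')
    (hX : EqOn X X' V) (hY : EqOn Y Y' V) (hh : EqOn h h' V) :
    IsShilnikovSliding U h X Y Γ ↔ IsShilnikovSliding U' h' X' Y' Γ :=
  ⟨fun H => H.congr hV hΓV hVU' hX hY hh, fun H => H.congr hV hΓV hVU hX.symm hY.symm hh.symm⟩

theorem isShilnikovEscaping_congr (hV : IsOpen V) (hΓV : Γ ⊆ V) (hVU : V ⊆ U) (hVU' : V ⊆ U')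
    (hX : EqOn X X' V) (hY : EqOn Y Y' V) (hh : EqOn h h' V) :
    IsShilnikovEscaping U h X Y Γ ↔ IsShilnikovEscaping U' h' X' Y' Γ := by
  rw [isShilnikovEscaping_iff, isShilnikovEscaping_iff]
  exact isShilnikovSliding_congr hV hΓV hVU hVU' (fun x hx => congrArg Neg.neg (hX hx))
    (fun x hx => congrArg Neg.neg (hY hx)) hh

theorem IsShilnikovSliding.isCompact (hΓ : IsShilnikovSliding U h X Y Γ) : IsCompact Γ := by
  obtain ⟨p, q, T, c, x, -, -, -, -, ⟨-, hc, -, hclim⟩, ⟨-, -, -, hx, -⟩, rfl⟩ := hΓ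
  exact (isCompact_insert_image_Iic (fun t ht => (hc t ht).continuousWithinAt) hclim).union
    (isCompact_Icc.image_of_continuousOn fun t ht => (hx t ht).continuousWithinAt)

theorem IsShilnikovSliding.subset (hΓ : IsShilnikovSliding U h X Y Γ) : Γ ⊆ U := by
  obtain ⟨p, q, T, c, x, hp, -, -, hq, ⟨hc0, -, hcs, -⟩, ⟨-, hx0, hxT, -, hpos⟩, rfl⟩ := hΓ
  rintro z ((rfl | ⟨t, ht, rfl⟩) | ⟨t, ht, rfl⟩)
  · exact hp.1
  · rcases (mem_Iic.1 ht).lt_or_eq with ht | rfl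
    · exact (hcs t ht).1
    · rw [hc0]; exact hq.1
  · rcases ht.1.eq_or_lt with rfl | h0
    · rw [hx0]; exact hq.1
    · rcases ht.2.eq_or_lt with rfl | h1
      · rw [hxT]; exact hp.1
      · exact (hpos t ⟨h0, h1⟩).1

end Localization

/-! ### Cutoffs and the passage to bounded fields on the whole space -/

section Cutoff

open scoped Manifold ContDiff

/-- A smooth compactly supported function on `U`, equal to `1` near a given compact set. -/
theorem exists_cutoff {K U : Set E3} (hK : IsCompact K) (hU : IsOpen U) (hKU : K ⊆ U) :
    ∃ (χ : E3 → ℝ) (V : Set E3), ContDiff ℝ ∞ χ ∧ HasCompactSupport χ ∧ tsupport χ ⊆ U ∧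
      IsOpen V ∧ K ⊆ V ∧ V ⊆ U ∧ EqOn χ 1 V := by
  obtain ⟨O, hO, hKO, hOU, hOc⟩ := exists_open_between_and_isCompact_closure hK hU hKU
  obtain ⟨f, hf1, hf0, -⟩ := exists_contMDiffMap_one_nhds_of_subset_interior (n := ⊤) 𝓘(ℝ, E3)
    hK.isClosed (t := O) (by rwa [hO.interior_eq])
  obtain ⟨V, hV, hKV, hVf⟩ := mem_nhdsSet_iff_exists.1 hf1
  have hsupp : Function.support f ⊆ O := fun x hx => by
    by_contra hxO
    exact hx (hf0 x hxO)
  have hts : tsupport f ⊆ closure O := closure_mono hsupp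
  refine ⟨f, V ∩ O, contMDiff_iff_contDiff.1 f.contMDiff, ?_, hts.trans hOU, hV.inter hO,
    subset_inter hKV hKO, inter_subset_right.trans (subset_closure.trans hOU), fun x hx => hVf hx.1⟩
  exact hOc.of_isClosed_subset (isClosed_tsupport f) hts

theorem contDiff_smul_of_tsupport {F : Type*} [NormedAddCommGroup F] [NormedSpace ℝ F]
    {U : Set E3} (hU : IsOpen U) {χ : E3 → ℝ} {n : WithTop ℕ∞} (hχ : ContDiff ℝ n χ)
    (hs : tsupport χ ⊆ U) {f : E3 → F} (hf : ContDiffOn ℝ n f U) :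
    ContDiff ℝ n fun x => χ x • f x := by
  rw [contDiff_iff_contDiffAt]
  intro x
  by_cases hx : x ∈ tsupport χ
  · exact hχ.contDiffAt.smul (hf.contDiffAt (hU.mem_nhds (hs hx)))
  · refine (contDiffAt_const (c := (0 : F))).congr_of_eventuallyEq ?_
    filter_upwards [(isClosed_tsupport χ).isOpen_compl.mem_nhds hx] with y hy
    rw [image_eq_zero_of_notMem_tsupport hy, zero_smul]

variable {U : Opens E3} {r : ℕ}

theorem norm_field_le (F : CrField U r) (x : E3) : ‖F.1.field x‖ ≤ ‖F‖ := by
  have h1 : ‖F.1 0‖ ≤ ‖F‖ := norm_le_pi_norm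
    (f := fun i : Fin (r + 1) => (F.1 i : closure (U : Set E3) →ᵇ (E3 [×(i : ℕ)]→L[ℝ] E3))) 0
  rw [PreJet.field]
  split_ifs with hx
  · have h2 : ‖F.1 0 ⟨x, hx⟩ 0‖ ≤ ‖F.1 0 ⟨x, hx⟩‖ := by
      refine ((F.1 0 ⟨x, hx⟩).le_opNorm 0).trans_eq ?_
      rw [show ∏ i : Fin ((0 : Fin (r + 1)) : ℕ), ‖(0 : Fin ((0 : Fin (r + 1)) : ℕ) → E3) i‖ = 1
        from Fin.prod_univ_zero _, mul_one]
    exact h2.trans (((F.1 0).norm_coe_le_norm _).trans h1)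
  · simp

theorem norm_fderiv_field_le (hr : 1 ≤ r) (F : CrField U r) {x : E3} (hx : x ∈ U) :
    ‖fderiv ℝ F.1.field x‖ ≤ ‖F‖ := by
  have h1 : ‖F.1 ⟨1, by omega⟩‖ ≤ ‖F‖ := norm_le_pi_norm
    (f := fun i : Fin (r + 1) => (F.1 i : closure (U : Set E3) →ᵇ (E3 [×(i : ℕ)]→L[ℝ] E3)))
      ⟨1, by omega⟩
  have h2 := F.2.2 ⟨1, by omega⟩ x hx
  rw [← norm_iteratedFDeriv_one, ← h2]
  exact ((F.1 ⟨1, by omega⟩).norm_coe_le_norm _).trans h1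

/-- Multiplication by a cutoff function makes a field on `U` a bounded field on the whole space,
in a continuous linear way. -/
theorem exists_cutoff_operator (hr : 1 ≤ r) {χ : E3 → ℝ} (hχ : ContDiff ℝ ∞ χ)
    (hχc : HasCompactSupport χ) (hs : tsupport χ ⊆ U) :
    ∃ L : CrField U r →L[ℝ] BddC1 E3, ∀ F x, (L F).fld x = χ x • F.1.field x := by
  obtain ⟨C₀, hC₀⟩ := hχ.continuous.bounded_above_of_compact_support hχc
  obtain ⟨C₁, hC₁⟩ := (hχ.continuous_fderiv (by simp)).bounded_above_of_compact_support
    (hχc.fderiv (𝕜 := ℝ))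
  have hC₀0 : 0 ≤ C₀ := (norm_nonneg _).trans (hC₀ 0)
  have hC₁0 : 0 ≤ C₁ := (norm_nonneg _).trans (hC₁ 0)
  have hχ1 : ContDiff ℝ 1 χ := hχ.of_le (by simp)
  have hF1 : ∀ F : CrField U r, ContDiffOn ℝ 1 F.1.field U := fun F =>
    F.2.1.of_le (by exact_mod_cast hr)
  have hsm : ∀ F : CrField U r, ContDiff ℝ 1 fun x => χ x • F.1.field x := fun F =>
    contDiff_smul_of_tsupport U.isOpen hχ1 hs (hF1 F)
  have hb0 : ∀ (F : CrField U r) x, ‖χ x • F.1.field x‖ ≤ (C₀ + C₁) * ‖F‖ := fun F x => by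
    rw [norm_smul]
    calc ‖χ x‖ * ‖F.1.field x‖ ≤ C₀ * ‖F‖ :=
          mul_le_mul (hC₀ x) (norm_field_le F x) (norm_nonneg _) hC₀0
      _ ≤ (C₀ + C₁) * ‖F‖ := by gcongr; linarith
  have hb1 : ∀ (F : CrField U r) x,
      ‖fderiv ℝ (fun x => χ x • F.1.field x) x‖ ≤ (C₀ + C₁) * ‖F‖ := fun F x => by
    by_cases hx : x ∈ tsupport χ
    · have hd : DifferentiableAt ℝ F.1.field x :=
        ((hF1 F).contDiffAt (U.isOpen.mem_nhds (hs hx))).differentiableAt one_ne_zero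
      rw [fderiv_fun_smul (hχ1.differentiable one_ne_zero x) hd]
      calc _ ≤ ‖χ x • fderiv ℝ F.1.field x‖ + ‖(fderiv ℝ χ x).smulRight (F.1.field x)‖ :=
            norm_add_le _ _
        _ ≤ C₀ * ‖F‖ + C₁ * ‖F‖ := by
            rw [norm_smul, ContinuousLinearMap.norm_smulRight_apply]
            exact add_le_add (mul_le_mul (hC₀ x) (norm_fderiv_field_le hr F (hs hx))
              (norm_nonneg _) hC₀0) (mul_le_mul (hC₁ x) (norm_field_le F x) (norm_nonneg _) hC₁0)
        _ = (C₀ + C₁) * ‖F‖ := by ring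
    · have : (fun x => χ x • F.1.field x) =ᶠ[𝓝 x] fun _ => 0 := by
        filter_upwards [(isClosed_tsupport χ).isOpen_compl.mem_nhds hx] with y hy
        rw [image_eq_zero_of_notMem_tsupport hy, zero_smul]
      rw [this.fderiv_eq, fderiv_fun_const, Pi.zero_apply, norm_zero]
      positivity
  let A : CrField U r → BddC1 E3 := fun F =>
    ⟨(ofNormedAddCommGroup _ (hsm F).continuous _ (hb0 F),
      ofNormedAddCommGroup _ ((hsm F).continuous_fderiv one_ne_zero) _ (hb1 F)),
      fun x => ((hsm F).differentiable one_ne_zero x).hasFDerivAt⟩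
  have hA : ∀ F x, (A F).fld x = χ x • F.1.field x := fun _ _ => rfl
  have hext : ∀ a b : BddC1 E3, (∀ x, a.fld x = b.fld x) → a = b := fun a b hab => by
    have h1 : a.fld = b.fld := funext hab
    refine sub_eq_zero.1 (norm_le_zero_iff.1 (BddC1.norm_le_of le_rfl (fun x => ?_) fun x => ?_))
    · rw [BddC1.fld_sub, hab, sub_self, norm_zero]
    · rw [BddC1.der_sub, ← (a.hasFDerivAt x).fderiv, ← (b.hasFDerivAt x).fderiv, h1, sub_self,
        norm_zero]
  let L : CrField U r →ₗ[ℝ] BddC1 E3 :=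
    { toFun := A
      map_add' := fun F G => hext _ _ fun x => by
        rw [BddC1.fld_add, hA, hA, hA, ← smul_add]
        congr 1
        exact congrFun (PreJet.field_add F.1 G.1) x
      map_smul' := fun c F => hext _ _ fun x => by
        rw [RingHom.id_apply, BddC1.fld_smul, hA, hA, smul_comm c]
        congr 1
        exact congrFun (PreJet.field_smul c F.1) x }
  exact ⟨L.mkContinuous (C₀ + C₁) fun F => BddC1.norm_le_of (by positivity) (hb0 F) (hb1 F), hA⟩

/-- Constant vector fields belong to `CrField U r`. -/
theorem exists_const_field (U : Opens E3) (r : ℕ) (w : E3) :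
    ∃ F : CrField U r, ∀ x ∈ U, F.1.field x = w := by
  -- The derivatives of a constant map do not depend on the base point, so evaluating them at 0
  -- gives the whole jet.
  let F : PreJet U r := fun i => BoundedContinuousFunction.const _
    (iteratedFDeriv ℝ i (fun _ : E3 => w) 0)
  have hF : EqOn F.field (fun _ => w) U := fun x hx => by
    have : F.field x = F 0 ⟨x, subset_closure hx⟩ 0 := dif_pos (subset_closure hx)
    rw [this]
    exact iteratedFDeriv_zero_apply _
  refine ⟨⟨F, contDiffOn_const.congr hF, fun i x hx => ?_⟩, hF⟩
  rw [((hF.eventuallyEq_of_mem (U.isOpen.mem_nhds hx)).iteratedFDeriv ℝ i).eq_of_nhds]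
  change iteratedFDeriv ℝ i (fun _ : E3 => w) 0 = _
  cases (i : ℕ) with
  | zero =>
    ext m
    simp
  | succ n => rw [iteratedFDeriv_succ_const, Pi.zero_apply, Pi.zero_apply]

end Cutoff

/-! ### Transfer to Ω^r and conclusion -/

section Main

variable {U : Opens E3} {r : ℕ} {h : E3 → ℝ}

theorem Omega.X_neg (Z : Omega U r) : Omega.X (-Z) = -Omega.X Z := by
  have := PreJet.field_smul (-1) Z.1.1
  rw [neg_one_smul, neg_one_smul] at this
  exact this

theorem Omega.Y_neg (Z : Omega U r) : Omega.Y (-Z) = -Omega.Y Z := by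
  have := PreJet.field_smul (-1) Z.2.1
  rw [neg_one_smul, neg_one_smul] at this
  exact this

theorem isSlidingShilnikovOrbit_neg {Z : Omega U r} {Γ : Set E3} :
    IsSlidingShilnikovOrbit h (-Z) Γ ↔ IsSlidingShilnikovOrbit h Z Γ := by
  rw [IsSlidingShilnikovOrbit, IsSlidingShilnikovOrbit, isShilnikovEscaping_iff,
    isShilnikovEscaping_iff, Omega.X_neg, Omega.Y_neg, neg_neg, neg_neg, or_comm]

theorem surjective_fderiv_comp_neg {B : Type*} [NormedAddCommGroup B] [NormedSpace ℝ B]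
    {g : B → ℝ} {z : B} (hg : Function.Surjective (fderiv ℝ g (-z))) :
    Function.Surjective (fderiv ℝ (fun z => g (-z)) z) := by
  change Function.Surjective (fderiv ℝ (g ∘ ContinuousLinearEquiv.neg ℝ (M := B)) z)
  rw [ContinuousLinearEquiv.comp_right_fderiv]
  exact hg.comp (ContinuousLinearEquiv.neg ℝ (M := B)).surjective

/-- The splitting function is pulled back along the cutoff map M, which changes nothing on V₁, where
the cutoff is 1. A constant perturbation of Y is admissible in C^r and still has value w at p₀ after
the cutoff, because p₀ lies in V₁; so regularity at Z₀ survives, and it spreads to a neighbourhood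
by continuity of the derivative. -/
theorem exists_neighbourhood_of_sliding (hr : 1 ≤ r)
    (hh : ContDiffOn ℝ ((r + 1 : ℕ) : WithTop ℕ∞) h U) {Z₀ : Omega U r} {Γ₀ : Set E3}
    (hΓ₀ : IsShilnikovSliding U h (Omega.X Z₀) (Omega.Y Z₀) Γ₀) :
    ∃ V₀ : Set E3, IsOpen V₀ ∧ Γ₀ ⊆ V₀ ∧
      ∀ V : Set E3, IsOpen V → Γ₀ ⊆ V → V ⊆ V₀ →
        ∃ W : Set (Omega U r), IsOpen W ∧ Z₀ ∈ W ∧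
          ∃ g : Omega U r → ℝ, ContDiffOn ℝ 1 g W ∧
            (∀ Z ∈ W, g Z = 0 → Function.Surjective (fderiv ℝ g Z)) ∧
            ∀ Z ∈ W, (∃ Γ ⊆ V, IsSlidingShilnikovOrbit h Z Γ) ↔ g Z = 0 := by
  obtain ⟨χ, V₁, hχ, hχc, hχU, hV₁, hΓV₁, hV₁U, hχ1⟩ :=
    exists_cutoff hΓ₀.isCompact U.isOpen hΓ₀.subset
  obtain ⟨L, hL⟩ := exists_cutoff_operator (r := r) hr hχ hχc hχU
  have hh2 : ContDiffOn ℝ 2 h U := hh.of_le (by exact_mod_cast Nat.succ_le_succ hr)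
  have hH : ContDiff ℝ 2 fun x => χ x • h x :=
    contDiff_smul_of_tsupport U.isOpen (contDiff_infty.1 hχ 2) hχU hh2
  have hHc : HasCompactSupport fun x => χ x • h x := hχc.smul_right
  have hhH : EqOn h (fun x => χ x • h x) V₁ := fun x hx => by
    simp only [hχ1 hx, Pi.one_apply, one_smul]
  have hLV : ∀ F, EqOn F.1.field (L F).fld V₁ := fun F x hx => by
    rw [hL, hχ1 hx, Pi.one_apply, one_smul]
  let M : Omega U r →L[ℝ] BddC1 E3 × BddC1 E3 := L.prodMap L
  have hslide : ∀ (Z : Omega U r) (Γ : Set E3), Γ ⊆ V₁ →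
      (IsShilnikovSliding U h (Omega.X Z) (Omega.Y Z) Γ ↔
        IsShilnikovSliding ⊤ (fun x => χ x • h x) (M Z).1.fld (M Z).2.fld Γ) := fun Z Γ hΓ =>
    isShilnikovSliding_congr hV₁ hΓ hV₁U (subset_univ _) (hLV Z.1) (hLV Z.2) hhH
  have hescape : ∀ (Z : Omega U r) (Γ : Set E3), Γ ⊆ V₁ →
      (IsShilnikovEscaping U h (Omega.X Z) (Omega.Y Z) Γ ↔
        IsShilnikovEscaping ⊤ (fun x => χ x • h x) (M Z).1.fld (M Z).2.fld Γ) := fun Z Γ hΓ =>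
    isShilnikovEscaping_congr hV₁ hΓ hV₁U (subset_univ _) (hLV Z.1) (hLV Z.2) hhH
  obtain ⟨V₀, g, p₀, w, hV₀, hΓV₀, hp₀, hg, hgw, hmain⟩ :=
    exists_splitting_function hH hHc ((hslide Z₀ Γ₀ hΓV₁).1 hΓ₀)
  obtain ⟨F, hF⟩ := exists_const_field U r w
  have hLF : (L F).fld p₀ = w := by
    rw [← hLV F (hΓV₁ hp₀), hF p₀ (hV₁U (hΓV₁ hp₀))]
  have hgM : ContDiffAt ℝ 1 (fun Z => g (M Z)) Z₀ := ContDiffAt.comp Z₀ hg M.contDiff.contDiffAt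
  have hdir : fderiv ℝ (fun Z => g (M Z)) Z₀ (0, F) ≠ 0 := by
    have h1 := ((hg.differentiableAt one_ne_zero).hasFDerivAt.comp Z₀ M.hasFDerivAt).fderiv
    rw [show (fun Z => g (M Z)) = g ∘ M from rfl, h1, ContinuousLinearMap.comp_apply,
      show M (0, F) = (0, L F) by simp [M]]
    exact hgw _ hLF
  have hdir' : ∀ᶠ Z in 𝓝 Z₀, fderiv ℝ (fun Z => g (M Z)) Z (0, F) ≠ 0 := by
    have h1 : ContinuousAt (fun Z => fderiv ℝ (fun Z => g (M Z)) Z (0, F)) Z₀ :=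
      (hgM.fderiv_right (m := 0) (by norm_num)).continuousAt.clm_apply continuousAt_const
    exact h1.eventually_ne hdir
  refine ⟨V₀ ∩ V₁, hV₀.inter hV₁, subset_inter hΓV₀ hΓV₁, fun V hV hΓV hVV => ?_⟩
  have hev := (M.continuous.tendsto Z₀).eventually
    (hmain V hV hΓV (hVV.trans inter_subset_left))
  have hVV₁ := hVV.trans inter_subset_right
  have hall := (hgM.eventually (by simp)).and (hdir'.and hev)
  refine ⟨_, isOpen_interior, mem_interior_iff_mem_nhds.2 hall, fun Z => g (M Z),
    fun Z hZ => (interior_subset hZ).1.contDiffWithinAt, fun Z hZ _ => ?_, fun Z hZ => ?_⟩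
  · exact LinearMap.surjective (f := (fderiv ℝ (fun Z => g (M Z)) Z).toLinearMap) fun h0 =>
      (interior_subset hZ).2.1 (LinearMap.congr_fun h0 (0, F))
  · obtain ⟨h1, h2⟩ := (interior_subset hZ).2.2
    rw [← h1]
    constructor
    · rintro ⟨Γ, hΓ, hs | he⟩
      · exact ⟨Γ, hΓ, (hslide Z Γ (hΓ.trans hVV₁)).1 hs⟩
      · exact absurd ⟨Γ, hΓ, (hescape Z Γ (hΓ.trans hVV₁)).1 he⟩ h2
    · rintro ⟨Γ, hΓ, hs⟩
      exact ⟨Γ, hΓ, Or.inl ((hslide Z Γ (hΓ.trans hVV₁)).2 hs)⟩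

end Main

end
end SlidingShilnikov

theorem theoremA (r : ℕ) (hr : 1 ≤ r)
    (U : TopologicalSpace.Opens SlidingShilnikov.E3)
    (hU : Bornology.IsBounded (U : Set SlidingShilnikov.E3))
    (h : SlidingShilnikov.E3 → ℝ) (hh : ContDiffOn ℝ ((r + 1 : ℕ) : WithTop ℕ∞) h U)
    (hreg : ∀ x ∈ U, h x = 0 → fderiv ℝ h x ≠ 0)
    (Z₀ : SlidingShilnikov.Omega U r) (Γ₀ : Set SlidingShilnikov.E3)
    (hΓ₀ : SlidingShilnikov.IsSlidingShilnikovOrbit h Z₀ Γ₀) :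
    ∃ V₀ : Set SlidingShilnikov.E3, IsOpen V₀ ∧ Γ₀ ⊆ V₀ ∧
      ∀ V : Set SlidingShilnikov.E3, IsOpen V → Γ₀ ⊆ V → V ⊆ V₀ →
        ∃ W : Set (SlidingShilnikov.Omega U r), IsOpen W ∧ Z₀ ∈ W ∧
          ∃ g : SlidingShilnikov.Omega U r → ℝ,
            ContDiffOn ℝ 1 g W ∧
            (∀ Z ∈ W, g Z = 0 → Function.Surjective (fderiv ℝ g Z)) ∧
            ∀ Z ∈ W, (∃ Γ ⊆ V, SlidingShilnikov.IsSlidingShilnikovOrbit h Z Γ) ↔ g Z = 0 := by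

  rcases hΓ₀ with hs | he
  · exact SlidingShilnikov.exists_neighbourhood_of_sliding hr hh hs
  -- The orbit is of sliding type for -Z₀, and being a sliding Shilnikov orbit is invariant under Z
  -- ↦ -Z; hence W and g are pulled back along negation.
  · rw [SlidingShilnikov.isShilnikovEscaping_iff, ← SlidingShilnikov.Omega.X_neg,
      ← SlidingShilnikov.Omega.Y_neg] at he
    obtain ⟨V₀, hV₀, hΓV₀, hmain⟩ := SlidingShilnikov.exists_neighbourhood_of_sliding hr hh he
    refine ⟨V₀, hV₀, hΓV₀, fun V hV hΓV hVV₀ => ?_⟩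
    obtain ⟨W, hW, hZW, g, hg, hsurj, hiff⟩ := hmain V hV hΓV hVV₀
    refine ⟨Neg.neg ⁻¹' W, hW.preimage continuous_neg, hZW, fun Z => g (-Z),
      hg.comp contDiff_neg.contDiffOn fun Z hZ => hZ, fun Z hZ h0 =>
        SlidingShilnikov.surjective_fderiv_comp_neg (hsurj (-Z) hZ h0), fun Z hZ => ?_⟩
    rw [← hiff (-Z) hZ]
    simp only [SlidingShilnikov.isSlidingShilnikovOrbit_neg]
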